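/- Let $k$ be a commutative unital ring containing $\mathbb{Q}$, and let $(A,L)$ be a Lie–Rinehart algebra over $k$: $A$ is a commutative unital $k$-algebra, $L$ is a $k$-Lie algebra and an $A$-module acting on $A$ by derivations $a\mapsto X(a)$, with $(aX)(b)=a\,X(b)$ and $[X,aY]=a[X,Y]+X(a)Y$. Assume that $L$ is projective over $A$ and that $A$ is equipped with a flat right $(A,L)$-connection, i.e. a $k$-linear map $\nabla:L\to\operatorname{End}_k(A)$ with $$\nabla_X(an)=a\nabla_Xn-X(a)n,\qquad \nabla_{aX}n=a\nabla_Xn-X(a)n,\qquad [\nabla_X,\nabla_Y]=\nabla_{[Y,X]}.$$ Let $\mathscr{V}L$ be the universal enveloping algebra of $(A,L)$, i.e. the $k$-algebra generated by $A$ and $L$ subject to $1_A=1$, $a\cdot b=ab$, $XY-YX=[X,Y]$, $a\cdot X=aX$, $Xa-aX=X(a)$. It acts from the left on $A$ (by multiplication and by $X(a)$), and from the right on $A$ by $n\cdot a=an$, $n\cdot X=\nabla_Xn$; write $A_\nabla$ for the latter right module. Put $\epsilon_r(D)=1\cdot D\in A_\nabla$, let $S:\mathscr{V}L\to\mathscr{V}L$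 be the antipode, the bijective anti-homomorphism with $S(a)=a$ and $S(X)=-X+\epsilon_r(X)$, and let $\Delta(D)=D_{(1)}\otimes D_{(2)}\in\mathscr{V}L\otimes_A\mathscr{V}L$ (tensor product of left $A$-modules) be the left coproduct, determined by $\Delta(a)=a\otimes 1$, $\Delta(X)=X\otimes1+1\otimes X$ and multiplicativity. The dual Hopf-cyclic module of $\mathscr{V}L$ is $C_0=A$, $C_n=\mathscr{V}L\otimes_A\cdots\otimes_A\mathscr{V}L$ ($n$ factors, right against left multiplication by $A$), with faces $d_0,\dots,d_n:C_n\to C_{n-1}$ $$d_0(h^1\otimes\cdots\otimes h^n)=\epsilon_r(h^1)h^2\otimes h^3\otimes\cdots\otimes h^n,\qquad d_i(h^1\otimes\cdots\otimes h^n)=\cdots\otimes h^ih^{i+1}\otimes\cdots\ (1\le i\le n-1),$$ $$d_n(h^1\otimes\cdots\otimes h^n)=h^1\otimes\cdots\otimes h^{n-1}\epsilon_r(S^{-1}h^n)$$ (for $n=1$: $d_0(h)=\epsilon_r(h)$, $d_1(h)=\epsilon_r(S^{-1}h)$), and with cyclic operator $t_0=\mathrm{id}$, $$t_n(h^1\otimes\cdots\otimes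 h^n)=S^{-1}\bigl(h^1_{(2)}\cdots h^{n-1}_{(2)}h^n\bigr)\otimes h^1_{(1)}\otimes\cdots\otimes h^{n-1}_{(1)}.$$ Let $b=\sum_{i=0}^n(-1)^id_i$, $b'=\sum_{i=0}^{n-1}(-1)^id_i$, $\lambda=(-1)^nt_n$ and $N=\sum_{j=0}^n\lambda^j$ on $C_n$. The dual Hopf–Hochschild homology $HH_\bullet(\mathscr{V}L)$ is the homology of $(C_\bullet,b)$, and the dual Hopf-cyclic homology $HC_\bullet(\mathscr{V}L)$ is the homology of the total complex of the cyclic double complex with $C_q$ in position $(p,q)$, $p,q\ge0$, vertical differential $b$ in even and $-b'$ in odd columns, and horizontal differential $1-\lambda$ from odd to even and $N$ from even to odd columns. Lie–Rinehart homology is $H_n(L,A_\nabla)=\operatorname{Tor}_n^{\mathscr{V}L}(A_\nabla,A)$. **Theorem.** Under these assumptions $(C_\bullet,b)$ and the total complex are complexes, and for all $n\ge0$ there are isomorphisms of $k$-modules $$HH_n(\mathscr{V}L)\cong H_n(L,A_\nabla),\qquad HC_n(\mathscr{V}L)\cong\bigoplus_{0\le i\le n/2}H_{n-2i}(L,A_\nabla).$$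 They are natural in $(A,L,\nabla)$: a morphism $(A,L,\nabla)\to(A',L',\nabla')$, i.e. a $k$-algebra morphism $\sigma:A\to A'$ and a $k$-Lie algebra morphism $f:L\to L'$ with $f(aX)=\sigma(a)f(X)$, $\sigma(X(a))=f(X)(\sigma(a))$ and $\sigma(\nabla_Xa)=\nabla'_{f(X)}\sigma(a)$, induces maps $C_n(\mathscr{V}L)\to C_n(\mathscr{V}L')$ that respect the cycles of both complexes, and maps $H_n(L,A_\nabla)\to H_n(L',A'_{\nabla'})$, and the isomorphisms intertwine the former with the latter (on each summand $H_{n-2i}$ in the cyclic case). -/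

import Mathlib

open scoped TensorProduct DirectSum
open CategoryTheory

universe u

noncomputable section

namespace LRHopf

set_option linter.unusedSectionVars false

/-! ### Balanced tensor products

`Bal α β` is the quotient of `N ⊗[k] P` by the relations `α i n ⊗ p = n ⊗ β i p`. -/

section Balanced

variable {k : Type*} [CommRing k] {I N P : Type*} [AddCommGroup N] [Module k N]
  [AddCommGroup P] [Module k P]

/-- The span of the relations `α i n ⊗ p - n ⊗ β i p`. -/
def balRel (α : I → Module.End k N) (β : I → Module.End k P) : Submodule k (N ⊗[k] P) :=
  Submodule.span k {z | ∃ (i : I) (n : N) (p : P), z = α i n ⊗ₜ[k] p - n ⊗ₜ[k] β i p}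

/-- The tensor product of `N` and `P` balanced over the families of endomorphisms `α` and `β`. -/
abbrev Bal (α : I → Module.End k N) (β : I → Module.End k P) : Type _ :=
  (N ⊗[k] P) ⧸ balRel α β

variable {α : I → Module.End k N} {β : I → Module.End k P}

/-- The class of the elementary tensor `n ⊗ p`. -/
def Bal.mk (n : N) (p : P) : Bal α β := (balRel α β).mkQ (n ⊗ₜ[k] p)

theorem Bal.mk_rel (i : I) (n : N) (p : P) :
    (Bal.mk (α i n) p : Bal α β) = Bal.mk n (β i p) := by
  refine (Submodule.Quotient.eq _).2 (Submodule.subset_span ⟨i, n, p, rfl⟩)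

theorem balRel_le {Q : Type*} [AddCommGroup Q] [Module k Q] (f : N →ₗ[k] P →ₗ[k] Q)
    (h : ∀ i n p, f (α i n) p = f n (β i p)) :
    balRel α β ≤ LinearMap.ker (TensorProduct.lift f) := by
  refine Submodule.span_le.2 ?_
  rintro _ ⟨i, n, p, rfl⟩
  simp [h]

/-- Bilinear maps that respect the relations descend to the balanced tensor product. -/
def Bal.lift {Q : Type*} [AddCommGroup Q] [Module k Q] (f : N →ₗ[k] P →ₗ[k] Q)
    (h : ∀ i n p, f (α i n) p = f n (β i p)) : Bal α β →ₗ[k] Q :=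
  (balRel α β).liftQ (TensorProduct.lift f) (balRel_le f h)

@[simp] theorem Bal.lift_mk {Q : Type*} [AddCommGroup Q] [Module k Q] (f : N →ₗ[k] P →ₗ[k] Q)
    (h : ∀ i n p, f (α i n) p = f n (β i p)) (n : N) (p : P) :
    Bal.lift f h (Bal.mk n p) = f n p := by
  simp [Bal.lift, Bal.mk]

/-- `Bal.mk` as a bilinear map. -/
def Bal.mkBilin (α : I → Module.End k N) (β : I → Module.End k P) :
    N →ₗ[k] P →ₗ[k] Bal α β :=
  (TensorProduct.mk k N P).compr₂ (balRel α β).mkQ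

@[simp] theorem Bal.mkBilin_apply (n : N) (p : P) :
    Bal.mkBilin α β n p = Bal.mk n p := rfl

theorem Bal.hom_ext {Q : Type*} [AddCommGroup Q] [Module k Q] {f g : Bal α β →ₗ[k] Q}
    (h : ∀ n p, f (Bal.mk n p) = g (Bal.mk n p)) : f = g := by
  refine Submodule.linearMap_qext _ (TensorProduct.ext' fun n p => h n p)

theorem Bal.induction {motive : Bal α β → Prop} (hmk : ∀ n p, motive (Bal.mk n p))
    (hadd : ∀ y z, motive y → motive z → motive (y + z)) (z : Bal α β) : motive z := by
  obtain ⟨t, rfl⟩ := (balRel α β).mkQ_surjective z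
  induction t using TensorProduct.induction_on with
  | zero =>
    have h := hmk 0 0
    rwa [Bal.mk, TensorProduct.zero_tmul] at h
  | tmul n p => exact hmk n p
  | add a b ha hb => rw [map_add]; exact hadd _ _ ha hb

theorem Bal.mk_add_left (n n' : N) (p : P) :
    (Bal.mk (n + n') p : Bal α β) = Bal.mk n p + Bal.mk n' p :=
  (Bal.mkBilin α β).map_add₂ n n' p

theorem Bal.mk_add_right (n : N) (p p' : P) :
    (Bal.mk n (p + p') : Bal α β) = Bal.mk n p + Bal.mk n p' :=
  (Bal.mkBilin α β n).map_add p p'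

theorem Bal.mk_sub_left (n n' : N) (p : P) :
    (Bal.mk (n - n') p : Bal α β) = Bal.mk n p - Bal.mk n' p :=
  (Bal.mkBilin α β).map_sub₂ n n' p

theorem Bal.mk_sub_right (n : N) (p p' : P) :
    (Bal.mk n (p - p') : Bal α β) = Bal.mk n p - Bal.mk n p' :=
  (Bal.mkBilin α β n).map_sub p p'

theorem Bal.mk_smul_left (r : k) (n : N) (p : P) :
    (Bal.mk (r • n) p : Bal α β) = r • Bal.mk n p :=
  (Bal.mkBilin α β).map_smul₂ r n p

theorem Bal.mk_smul_right (r : k) (n : N) (p : P) :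
    (Bal.mk n (r • p) : Bal α β) = r • Bal.mk n p :=
  (Bal.mkBilin α β n).map_smul r p

/-- Functoriality of the balanced tensor product. -/
def Bal.map {I' N' P' : Type*} [AddCommGroup N'] [Module k N'] [AddCommGroup P'] [Module k P']
    {α' : I' → Module.End k N'} {β' : I' → Module.End k P'} (j : I → I')
    (f : N →ₗ[k] N') (g : P →ₗ[k] P') (hf : ∀ i n, f (α i n) = α' (j i) (f n))
    (hg : ∀ i p, g (β i p) = β' (j i) (g p)) : Bal α β →ₗ[k] Bal α' β' :=
  Bal.lift ((Bal.mkBilin α' β').compl₁₂ f g) fun i n p => by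
    simp [hf, hg, Bal.mk_rel]

@[simp] theorem Bal.map_mk {I' N' P' : Type*} [AddCommGroup N'] [Module k N'] [AddCommGroup P']
    [Module k P'] {α' : I' → Module.End k N'} {β' : I' → Module.End k P'} (j : I → I')
    (f : N →ₗ[k] N') (g : P →ₗ[k] P') (hf : ∀ i n, f (α i n) = α' (j i) (f n))
    (hg : ∀ i p, g (β i p) = β' (j i) (g p)) (n : N) (p : P) :
    Bal.map j f g hf hg (Bal.mk n p : Bal α β) = (Bal.mk (f n) (g p) : Bal α' β') := by
  simp [Bal.map]

end Balanced

/-! ### Homology of a sequence of linear maps -/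

section Homology

variable {k : Type*} [CommRing k] {X : ℕ → Type*} [∀ n, AddCommGroup (X n)]
  [∀ n, Module k (X n)]

/-- The cycles in degree `n`: all of `X 0`, and the kernel of `d : X (n+1) → X n` in degree
`n + 1`. -/
def cycles (d : ∀ n, X (n + 1) →ₗ[k] X n) : (n : ℕ) → Submodule k (X n)
  | 0 => ⊤
  | n + 1 => LinearMap.ker (d n)

/-- The boundaries, as a submodule of the cycles (when `d ∘ d = 0`, all of the image of `d`). -/
def boundaries (d : ∀ n, X (n + 1) →ₗ[k] X n) (n : ℕ) : Submodule k (cycles d n) :=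
  (LinearMap.range (d n)).comap (cycles d n).subtype

/-- Homology: cycles modulo boundaries. -/
abbrev Homology (d : ∀ n, X (n + 1) →ₗ[k] X n) (n : ℕ) : Type _ :=
  cycles d n ⧸ boundaries d n

end Homology

/-! ### The universal enveloping algebra of a Lie-Rinehart algebra -/

section Enveloping

variable (k A L : Type u) [CommRing k] [CommRing A] [LieRing L] [Module A L]
  [LieRingModule L A] [Algebra k A] [LieAlgebra k L]

/-- The defining relations of the enveloping algebra, on the tensor algebra of `A × L`. -/
inductive EnvRel : TensorAlgebra k (A × L) → TensorAlgebra k (A × L) → Prop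
  | one : EnvRel (TensorAlgebra.ι k (1, 0)) 1
  | mul (a b : A) : EnvRel (TensorAlgebra.ι k (a * b, 0))
      (TensorAlgebra.ι k (a, 0) * TensorAlgebra.ι k (b, 0))
  | lie (x y : L) : EnvRel (TensorAlgebra.ι k (0, ⁅x, y⁆))
      (TensorAlgebra.ι k (0, x) * TensorAlgebra.ι k (0, y)
        - TensorAlgebra.ι k (0, y) * TensorAlgebra.ι k (0, x))
  | smul (a : A) (x : L) : EnvRel (TensorAlgebra.ι k (0, a • x))
      (TensorAlgebra.ι k (a, 0) * TensorAlgebra.ι k (0, x))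
  | comm (x : L) (a : A) : EnvRel (TensorAlgebra.ι k (⁅x, a⁆, 0))
      (TensorAlgebra.ι k (0, x) * TensorAlgebra.ι k (a, 0)
        - TensorAlgebra.ι k (a, 0) * TensorAlgebra.ι k (0, x))

/-- The universal enveloping algebra `V L` of the Lie-Rinehart algebra `(A, L)`. -/
def Env : Type u := RingQuot (EnvRel k A L)

instance : Ring (Env k A L) := inferInstanceAs (Ring (RingQuot (EnvRel k A L)))

instance : Algebra k (Env k A L) := inferInstanceAs (Algebra k (RingQuot (EnvRel k A L)))

/-- The quotient map from the tensor algebra. -/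
def Env.proj : TensorAlgebra k (A × L) →ₐ[k] Env k A L := RingQuot.mkAlgHom k (EnvRel k A L)

theorem Env.proj_rel {s t : TensorAlgebra k (A × L)} (h : EnvRel k A L s t) :
    Env.proj k A L s = Env.proj k A L t :=
  RingQuot.mkAlgHom_rel k h

theorem Env.proj_surjective : Function.Surjective (Env.proj k A L) :=
  RingQuot.mkAlgHom_surjective k (EnvRel k A L)

variable {A L}

/-- The generators of the enveloping algebra. -/
def Env.gen : A × L →ₗ[k] Env k A L :=
  (Env.proj k A L).toLinearMap ∘ₗ TensorAlgebra.ι k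

variable (A L)

theorem Env.gen_mul (a b : A) :
    Env.gen k ((a * b, 0) : A × L) = Env.gen k (a, 0) * Env.gen k (b, 0) := by
  simpa [Env.gen] using Env.proj_rel k A L (EnvRel.mul (k := k) (L := L) a b)

theorem Env.gen_one : Env.gen k ((1, 0) : A × L) = 1 := by
  simpa [Env.gen] using Env.proj_rel k A L (EnvRel.one (k := k) (A := A) (L := L))

/-- The canonical algebra morphism `i_A : A → V L`. -/
def incA : A →ₐ[k] Env k A L :=
  AlgHom.ofLinearMap (Env.gen k ∘ₗ LinearMap.inl k A L) (Env.gen_one k A L)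
    (Env.gen_mul k A L)

/-- The canonical map `i_L : L → V L`. -/
def incL : L →ₗ[k] Env k A L := Env.gen k ∘ₗ LinearMap.inr k A L

theorem incL_lie (x y : L) :
    incL k A L ⁅x, y⁆ = incL k A L x * incL k A L y - incL k A L y * incL k A L x := by
  simpa [incL, Env.gen] using Env.proj_rel k A L (EnvRel.lie (k := k) (A := A) x y)

theorem incL_smul (a : A) (x : L) : incL k A L (a • x) = incA k A L a * incL k A L x := by
  simpa [incA, incL, Env.gen] using Env.proj_rel k A L (EnvRel.smul (k := k) a x)

theorem incA_lie (x : L) (a : A) :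
    incA k A L ⁅x, a⁆ = incL k A L x * incA k A L a - incA k A L a * incL k A L x := by
  simpa [incA, incL, Env.gen] using Env.proj_rel k A L (EnvRel.comm (k := k) x a)

variable {k A L}

/-- The universal property of the enveloping algebra. -/
def Env.lift {B : Type*} [Ring B] [Algebra k B] (fA : A →ₐ[k] B) (fL : L →ₗ[k] B)
    (hlie : ∀ x y, fL ⁅x, y⁆ = fL x * fL y - fL y * fL x)
    (hsmul : ∀ (a : A) (x : L), fL (a • x) = fA a * fL x)
    (hcomm : ∀ (x : L) (a : A), fA ⁅x, a⁆ = fL x * fA a - fA a * fL x) :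
    Env k A L →ₐ[k] B :=
  (RingQuot.liftAlgHom k ⟨TensorAlgebra.lift k (fA.toLinearMap.coprod fL), by
    intro _ _ h
    induction h <;> simp [hlie, hsmul, hcomm]⟩ : RingQuot (EnvRel k A L) →ₐ[k] B)

section lift

variable {B : Type*} [Ring B] [Algebra k B] (fA : A →ₐ[k] B) (fL : L →ₗ[k] B)
    (hlie : ∀ x y, fL ⁅x, y⁆ = fL x * fL y - fL y * fL x)
    (hsmul : ∀ (a : A) (x : L), fL (a • x) = fA a * fL x)
    (hcomm : ∀ (x : L) (a : A), fA ⁅x, a⁆ = fL x * fA a - fA a * fL x)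

theorem Env.lift_proj (t : TensorAlgebra k (A × L)) :
    Env.lift fA fL hlie hsmul hcomm (Env.proj k A L t)
      = TensorAlgebra.lift k (fA.toLinearMap.coprod fL) t :=
  RingQuot.liftAlgHom_mkAlgHom_apply k _ _ t

@[simp] theorem Env.lift_incA (a : A) :
    Env.lift fA fL hlie hsmul hcomm (incA k A L a) = fA a := by
  simp [incA, Env.gen, Env.lift_proj]

@[simp] theorem Env.lift_incL (x : L) :
    Env.lift fA fL hlie hsmul hcomm (incL k A L x) = fL x := by
  simp [incL, Env.gen, Env.lift_proj]

end lift

/-- Induction: the enveloping algebra is generated by `A` and `L`. -/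
theorem Env.induction {p : Env k A L → Prop} (hA : ∀ a, p (incA k A L a))
    (hL : ∀ x, p (incL k A L x)) (hadd : ∀ g h, p g → p h → p (g + h))
    (hmul : ∀ g h, p g → p h → p (g * h)) (g : Env k A L) : p g := by
  obtain ⟨t, rfl⟩ := Env.proj_surjective k A L g
  induction t using TensorAlgebra.induction with
  | algebraMap r =>
    rw [AlgHom.commutes, ← (incA k A L).commutes r]
    exact hA _
  | ι m =>
    have : Env.proj k A L (TensorAlgebra.ι k m)
        = incA k A L m.1 + incL k A L m.2 := by
      simp only [incA, incL, Env.gen, AlgHom.ofLinearMap_apply, LinearMap.comp_apply,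
        AlgHom.toLinearMap_apply, ← map_add]
      simp
    rw [this]
    exact hadd _ _ (hA _) (hL _)
  | mul a b ha hb => rw [map_mul]; exact hmul _ _ ha hb
  | add a b ha hb => rw [map_add]; exact hadd _ _ ha hb

theorem Env.hom_ext {B : Type*} [Ring B] [Algebra k B] {f g : Env k A L →ₐ[k] B}
    (hA : ∀ a, f (incA k A L a) = g (incA k A L a))
    (hL : ∀ x, f (incL k A L x) = g (incL k A L x)) : f = g := by
  refine AlgHom.ext fun v => ?_
  induction v using Env.induction with
  | hA a => exact hA a
  | hL x => exact hL x
  | hadd a b ha hb => simp [ha, hb]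
  | hmul a b ha hb => simp [ha, hb]

end Enveloping

/-! ### Modules over the enveloping algebra -/

/-- A left module over a `k`-algebra `V`, given by a `k`-module and the action of `V` on it. -/
structure LMod (k V : Type u) [CommRing k] [Ring V] [Algebra k V] where
  /-- the underlying `k`-module -/
  carrier : Type u
  [addCommGroup : AddCommGroup carrier]
  [module : Module k carrier]
  /-- the action -/
  act : V →ₐ[k] Module.End k carrier

attribute [instance] LMod.addCommGroup LMod.module

section Modules

variable (k A L : Type u) [CommRing k] [CommRing A] [LieRing L] [Module A L]
  [LieRingModule L A] [Algebra k A] [LieAlgebra k L]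

/-- `V L` as a left module over itself. -/
abbrev regMod : LMod k (Env k A L) where
  carrier := Env k A L
  act := Algebra.lmul k (Env k A L)

/-- Right multiplication of `A` on `V L`. -/
def rmulA (a : A) : Module.End k (Env k A L) := LinearMap.mulRight k (incA k A L a)

variable {k A L}

@[simp] theorem rmulA_apply (a : A) (g : Env k A L) : rmulA k A L a g = g * incA k A L a := rfl

/-- The action of `A` on a left `V L`-module. -/
def LMod.actA (M : LMod k (Env k A L)) (a : A) : Module.End k M.carrier :=
  M.act (incA k A L a)

/-- The action of `L` on a left `V L`-module. -/
def LMod.actL (M : LMod k (Env k A L)) : L →ₗ[k] Module.End k M.carrier :=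
  M.act.toLinearMap ∘ₗ incL k A L

theorem LMod.act_incA (M : LMod k (Env k A L)) (a : A) : M.act (incA k A L a) = M.actA a := rfl

theorem LMod.act_incL (M : LMod k (Env k A L)) (x : L) : M.act (incL k A L x) = M.actL x := rfl

theorem LMod.actA_mul (M : LMod k (Env k A L)) (a b : A) (m : M.carrier) :
    M.actA (a * b) m = M.actA a (M.actA b m) := by
  simp [LMod.actA]

theorem LMod.actL_actA (M : LMod k (Env k A L)) (x : L) (a : A) (m : M.carrier) :
    M.actL x (M.actA a m) = M.actA a (M.actL x m) + M.actA ⁅x, a⁆ m := by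
  simp [LMod.actA, LMod.actL, incA_lie]

theorem LMod.actL_lie (M : LMod k (Env k A L)) (x y : L) (m : M.carrier) :
    M.actL ⁅x, y⁆ m = M.actL x (M.actL y m) - M.actL y (M.actL x m) := by
  simp [LMod.actL, incL_lie]

theorem LMod.actL_smul (M : LMod k (Env k A L)) (x : L) (a : A) (m : M.carrier) :
    M.actL (a • x) m = M.actA a (M.actL x m) := by
  simp [LMod.actA, LMod.actL, incL_smul]

/-- The balanced tensor product `V L ⊗_A M`, for the right multiplication of `A` on `V L` and the
left action of `A` on the left `V L`-module `M`; thus `D a ⊗ m = D ⊗ a m`. -/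
abbrev IndTensor (M : LMod k (Env k A L)) : Type u := Bal (rmulA k A L) M.actA

/-- Left multiplication of `V L` on the first factor of `V L ⊗_A M`. -/
def indMul (M : LMod k (Env k A L)) (g : Env k A L) : Module.End k (IndTensor M) :=
  Bal.lift ((Bal.mkBilin (rmulA k A L) M.actA).comp (LinearMap.mulLeft k g)) fun a n p => by
    simp only [LinearMap.comp_apply, LinearMap.mulLeft_apply, rmulA_apply, Bal.mkBilin_apply,
      ← mul_assoc]
    exact Bal.mk_rel (α := rmulA k A L) a (g * n) p

theorem indMul_mk (M : LMod k (Env k A L)) (g h : Env k A L) (m : M.carrier) :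
    indMul M g (Bal.mk h m) = Bal.mk (g * h) m := by
  simp [indMul]

/-- Left multiplication as an action of `V L` on `V L ⊗_A M`. -/
def indAct (M : LMod k (Env k A L)) : Env k A L →ₐ[k] Module.End k (IndTensor M) :=
  AlgHom.ofLinearMap
    { toFun := indMul M
      map_add' := fun g h => Bal.hom_ext fun n p => by
        simp [indMul_mk, add_mul, Bal.mk_add_left]
      map_smul' := fun r g => Bal.hom_ext fun n p => by
        simp [indMul_mk, Bal.mk_smul_left] }
    (Bal.hom_ext fun n p => by simp [indMul_mk])
    (fun g h => Bal.hom_ext fun n p => by simp [indMul_mk, mul_assoc])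

/-- `V L ⊗_A M` as a left `V L`-module. -/
abbrev indMod (M : LMod k (Env k A L)) : LMod k (Env k A L) where
  carrier := IndTensor M
  act := indAct M

/-- The tensor product `M ⊗_A N` of two left `V L`-modules, for the left actions of `A` on both
factors; thus `a m ⊗ n = m ⊗ a n`. -/
abbrev DiagTensor (M N : LMod k (Env k A L)) : Type u := Bal M.actA N.actA

/-- `a ∈ A` acts on `M ⊗_A N` by `a (m ⊗ n) = a m ⊗ n`. -/
def diagMul (M N : LMod k (Env k A L)) (a : A) : Module.End k (DiagTensor M N) :=
  Bal.lift ((Bal.mkBilin M.actA N.actA).comp (M.actA a)) fun b m n => by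
    simp only [LinearMap.comp_apply, Bal.mkBilin_apply, ← LMod.actA_mul, mul_comm a b]
    rw [LMod.actA_mul, Bal.mk_rel]

theorem diagMul_mk (M N : LMod k (Env k A L)) (a : A) (m : M.carrier) (n : N.carrier) :
    diagMul M N a (Bal.mk m n) = Bal.mk (M.actA a m) n := by
  simp [diagMul]

/-- The action of `A` on `M ⊗_A N`. -/
def diagA (M N : LMod k (Env k A L)) : A →ₐ[k] Module.End k (DiagTensor M N) :=
  AlgHom.ofLinearMap
    { toFun := diagMul M N
      map_add' := fun a b => Bal.hom_ext fun m n => by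
        simp [diagMul_mk, LMod.actA, Bal.mk_add_left]
      map_smul' := fun r a => Bal.hom_ext fun m n => by
        simp [diagMul_mk, LMod.actA, Bal.mk_smul_left] }
    (Bal.hom_ext fun m n => by simp [diagMul_mk, LMod.actA])
    (fun a b => Bal.hom_ext fun m n => by simp [diagMul_mk, LMod.actA_mul])

theorem diagA_mk (M N : LMod k (Env k A L)) (a : A) (m : M.carrier) (n : N.carrier) :
    diagA M N a (Bal.mk m n) = Bal.mk (M.actA a m) n := diagMul_mk M N a m n

/-- `x ∈ L` acts on `M ⊗_A N` by `x (m ⊗ n) = x m ⊗ n + m ⊗ x n`. -/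
def diagDer (M N : LMod k (Env k A L)) (x : L) : Module.End k (DiagTensor M N) :=
  Bal.lift ((Bal.mkBilin M.actA N.actA).comp (M.actL x)
      + (Bal.mkBilin M.actA N.actA).compl₂ (N.actL x)) fun a m n => by
    simp only [LinearMap.add_apply, LinearMap.comp_apply, LinearMap.compl₂_apply,
      LMod.actL_actA, map_add, Bal.mkBilin_apply]
    rw [Bal.mk_rel a, Bal.mk_rel a, Bal.mk_rel ⁅x, a⁆]
    abel

theorem diagDer_mk (M N : LMod k (Env k A L)) (x : L) (m : M.carrier) (n : N.carrier) :
    diagDer M N x (Bal.mk m n) = Bal.mk (M.actL x m) n + Bal.mk m (N.actL x n) := by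
  simp [diagDer]

/-- The action of `L` on `M ⊗_A N`. -/
def diagL (M N : LMod k (Env k A L)) : L →ₗ[k] Module.End k (DiagTensor M N) where
  toFun := diagDer M N
  map_add' x y := Bal.hom_ext fun m n => by
    simp only [diagDer_mk, LinearMap.add_apply, map_add, Bal.mk_add_left, Bal.mk_add_right]
    abel
  map_smul' r x := Bal.hom_ext fun m n => by
    simp [diagDer_mk, Bal.mk_smul_left, Bal.mk_smul_right]

theorem diagL_mk (M N : LMod k (Env k A L)) (x : L) (m : M.carrier) (n : N.carrier) :
    diagL M N x (Bal.mk m n) = Bal.mk (M.actL x m) n + Bal.mk m (N.actL x n) :=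
  diagDer_mk M N x m n

/-- The action of `V L` on `M ⊗_A N` with `a (m ⊗ n) = a m ⊗ n` and
`x (m ⊗ n) = x m ⊗ n + m ⊗ x n`. -/
def diagAct (M N : LMod k (Env k A L)) : Env k A L →ₐ[k] Module.End k (DiagTensor M N) :=
  Env.lift (diagA M N) (diagL M N)
    (fun x y => Bal.hom_ext fun m n => by
      simp only [Module.End.mul_apply, LinearMap.sub_apply, diagL_mk, map_add, LMod.actL_lie]
      simp only [Bal.mk_sub_left, Bal.mk_sub_right]
      abel)
    (fun a x => Bal.hom_ext fun m n => by
      simp only [Module.End.mul_apply, diagL_mk, map_add, LMod.actL_smul, diagA_mk]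
      rw [Bal.mk_rel a m])
    (fun x a => Bal.hom_ext fun m n => by
      simp only [Module.End.mul_apply, LinearMap.sub_apply, diagL_mk, map_add, diagA_mk,
        LMod.actL_actA]
      simp only [Bal.mk_add_left, Bal.mk_add_right]
      abel)

/-- The tensor product of two left `V L`-modules. -/
abbrev diagMod (M N : LMod k (Env k A L)) : LMod k (Env k A L) where
  carrier := DiagTensor M N
  act := diagAct M N

theorem diagAct_incA (M N : LMod k (Env k A L)) (a : A) (m : M.carrier) (n : N.carrier) :
    diagAct M N (incA k A L a) (Bal.mk m n) = Bal.mk (M.actA a m) n := by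
  simp [diagAct, diagA_mk]

theorem diagAct_incL (M N : LMod k (Env k A L)) (x : L) (m : M.carrier) (n : N.carrier) :
    diagAct M N (incL k A L x) (Bal.mk m n)
      = Bal.mk (M.actL x m) n + Bal.mk m (N.actL x n) := by
  simp [diagAct, diagL_mk]

variable (k A L) in
/-- The left coproduct `Δ_l : V L → V L ⊗_A V L`, `Δ_l(D) = D · (1 ⊗ 1)`; in particular
`Δ_l(a) = a ⊗ 1` and `Δ_l(x) = x ⊗ 1 + 1 ⊗ x`. -/
def coprodL (D : Env k A L) : DiagTensor (regMod k A L) (regMod k A L) :=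
  diagAct (regMod k A L) (regMod k A L) D (Bal.mk (1 : Env k A L) (1 : Env k A L))

theorem coprodL_incA (a : A) :
    coprodL k A L (incA k A L a) = Bal.mk (incA k A L a) (1 : Env k A L) := by
  rw [coprodL, diagAct_incA]
  simp [LMod.actA]

theorem coprodL_incL (x : L) : coprodL k A L (incL k A L x)
    = Bal.mk (incL k A L x) (1 : Env k A L) + Bal.mk (1 : Env k A L) (incL k A L x) := by
  rw [coprodL, diagAct_incL]
  simp [LMod.actL]

/-- The map `V L ⊗_A V L → M ⊗_A N`, `D ⊗ E ↦ D m ⊗ E n`. -/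
def orbitMap (M N : LMod k (Env k A L)) (m : M.carrier) (n : N.carrier) :
    DiagTensor (regMod k A L) (regMod k A L) →ₗ[k] DiagTensor M N :=
  Bal.map id (M.act.toLinearMap.flip m) (N.act.toLinearMap.flip n)
    (fun a D => by simp [LMod.actA]) (fun a D => by simp [LMod.actA])

theorem orbitMap_mk (M N : LMod k (Env k A L)) (m : M.carrier) (n : N.carrier)
    (D E : (regMod k A L).carrier) :
    orbitMap M N m n (Bal.mk D E) = Bal.mk (M.act D m) (N.act E n) :=
  Bal.map_mk _ _ _ _ _ _ _

/-- The action on `M ⊗_A N` is `D (m ⊗ n) = D_(1) m ⊗ D_(2) n`. -/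
theorem diagAct_eq_coprodL (M N : LMod k (Env k A L)) (D : Env k A L) (m : M.carrier)
    (n : N.carrier) : diagAct M N D (Bal.mk m n) = orbitMap M N m n (coprodL k A L D) := by
  have key : ∀ z, diagAct M N D (orbitMap M N m n z)
      = orbitMap M N m n (diagAct (regMod k A L) (regMod k A L) D z) := by
    induction D using Env.induction with
    | hA a =>
      refine LinearMap.congr_fun (f := diagAct M N _ ∘ₗ orbitMap M N m n)
        (g := orbitMap M N m n ∘ₗ diagAct _ _ _) (Bal.hom_ext fun D E => ?_)
      simp only [LinearMap.comp_apply]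
      rw [diagAct_incA, orbitMap_mk, diagAct_incA, orbitMap_mk]
      simp [LMod.actA]
    | hL x =>
      refine LinearMap.congr_fun (f := diagAct M N _ ∘ₗ orbitMap M N m n)
        (g := orbitMap M N m n ∘ₗ diagAct _ _ _) (Bal.hom_ext fun D E => ?_)
      simp only [LinearMap.comp_apply]
      rw [diagAct_incL, orbitMap_mk, diagAct_incL, map_add, orbitMap_mk, orbitMap_mk]
      simp [LMod.actL]
    | hadd g h hg hh => intro z; simp [hg, hh]
    | hmul g h hg hh => intro z; simp [hg, hh]
  have h1 := key (Bal.mk (1 : Env k A L) (1 : Env k A L))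
  rw [orbitMap_mk, map_one, map_one] at h1
  exact h1

end Modules

/-! ### The counits and the antipode -/

section Antipode

variable (k A L : Type u) [CommRing k] [CommRing A] [LieRing L] [Module A L]
  [LieRingModule L A] [LieRinehartRing A L] [Algebra k A] [LieAlgebra k L]
  [LieRinehartAlgebra k A L]

/-- The anchor, as a linear map from `L` to the endomorphisms of `A`. -/
def anchorEnd : L →ₗ[k] Module.End k A where
  toFun x :=
    { toFun := fun a => ⁅x, a⁆
      map_add' := fun a b => lie_add x a b
      map_smul' := fun r a => lie_smul r x a }
  map_add' x y := LinearMap.ext fun a => add_lie x y a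
  map_smul' r x := LinearMap.ext fun a => smul_lie r x a

@[simp] theorem anchorEnd_apply (x : L) (a : A) : anchorEnd k A L x a = ⁅x, a⁆ := rfl

/-- The canonical left action of `V L` on `A`: `A` acts by multiplication, `L` by the anchor. -/
def anchorAct : Env k A L →ₐ[k] Module.End k A :=
  Env.lift (Algebra.lmul k A) (anchorEnd k A L)
    (fun x y => by ext a; simp)
    (fun a x => by ext b; simp)
    (fun x a => by ext b; simp)

@[simp] theorem anchorAct_incA (a b : A) : anchorAct k A L (incA k A L a) b = a * b := by
  simp [anchorAct]

@[simp] theorem anchorAct_incL (x : L) (b : A) : anchorAct k A L (incL k A L x) b = ⁅x, b⁆ := by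
  simp [anchorAct]

/-- `A` as a left `V L`-module. -/
abbrev baseMod : LMod k (Env k A L) where
  carrier := A
  act := anchorAct k A L

/-- The left counit `ε_l(D) = D · 1`. -/
def epsL (D : Env k A L) : A := anchorAct k A L D 1

/-- A flat right `(A, L)`-connection on `A`. -/
structure FlatRightConnection where
  /-- the operators `∇_x` -/
  nabla : L →ₗ[k] Module.End k A
  nabla_mul : ∀ (x : L) (a n : A), nabla x (a * n) = a * nabla x n - ⁅x, a⁆ * n
  nabla_smul : ∀ (a : A) (x : L) (n : A), nabla (a • x) n = a * nabla x n - ⁅x, a⁆ * n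
  flat : ∀ (x y : L) (n : A), nabla x (nabla y n) - nabla y (nabla x n) = nabla ⁅y, x⁆ n

variable {k A L} (c : FlatRightConnection k A L)

/-- An algebra morphism out of the commutative algebra `A`, read as one to the opposite algebra. -/
def opHom {B : Type u} [Ring B] [Algebra k B] (f : A →ₐ[k] B) : A →ₐ[k] Bᵐᵒᵖ :=
  f.toOpposite fun a b => by rw [commute_iff_eq, ← map_mul, ← map_mul, mul_comm]

@[simp] theorem unop_opHom {B : Type u} [Ring B] [Algebra k B] (f : A →ₐ[k] B) (a : A) :
    (opHom f a).unop = f a := rfl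

/-- The right action of `V L` on `A_∇`: `n · a = a n` and `n · x = ∇_x n`. -/
def rightAct : Env k A L →ₐ[k] (Module.End k A)ᵐᵒᵖ :=
  Env.lift (opHom (Algebra.lmul k A))
    ((MulOpposite.opLinearEquiv k).toLinearMap ∘ₗ c.nabla)
    (fun x y => MulOpposite.unop_injective <| LinearMap.ext fun n => by
      simp [← c.flat y x n])
    (fun a x => MulOpposite.unop_injective <| LinearMap.ext fun n => by
      simp [c.nabla_smul, c.nabla_mul])
    (fun x a => MulOpposite.unop_injective <| LinearMap.ext fun n => by
      simp [c.nabla_mul])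

@[simp] theorem rightAct_incA (a n : A) : (rightAct c (incA k A L a)).unop n = a * n := by
  simp [rightAct]

@[simp] theorem rightAct_incL (x : L) (n : A) :
    (rightAct c (incL k A L x)).unop n = c.nabla x n := by
  simp [rightAct]

/-- The right counit `ε_r(D) = 1 · D`. -/
def epsR : Env k A L →ₗ[k] A where
  toFun D := (rightAct c D).unop 1
  map_add' D E := by simp
  map_smul' r D := by simp

theorem epsR_mul_incA (D : Env k A L) (a : A) : epsR c (D * incA k A L a) = a * epsR c D := by
  simp [epsR]

/-- The antipode, as an algebra morphism to the opposite algebra: `S(a) = a` and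
`S(x) = -x + ε_r(x)`. -/
def antipodeHom : Env k A L →ₐ[k] (Env k A L)ᵐᵒᵖ :=
  Env.lift (opHom (incA k A L))
    ((MulOpposite.opLinearEquiv k).toLinearMap ∘ₗ
      (-(incL k A L) + (incA k A L).toLinearMap ∘ₗ LinearMap.applyₗ (1 : A) ∘ₗ c.nabla))
    (fun x y => MulOpposite.unop_injective <| by
      have h := congrArg (incA k A L) (c.flat y x 1)
      have h1 := c.nabla_mul y (c.nabla x 1) 1
      have h2 := c.nabla_mul x (c.nabla y 1) 1
      rw [mul_one] at h1 h2
      rw [h1, h2] at h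
      have e1 := incA_lie k A L y (c.nabla x 1)
      have e2 := incA_lie k A L x (c.nabla y 1)
      simp only [map_sub, map_mul, mul_one] at h
      have h3 : incA k A L (c.nabla x 1) * incA k A L (c.nabla y 1)
          = incA k A L (c.nabla y 1) * incA k A L (c.nabla x 1) := by
        rw [← map_mul, ← map_mul, mul_comm]
      simp only [LinearMap.comp_apply, LinearMap.add_apply, LinearMap.neg_apply,
        AlgHom.toLinearMap_apply, LinearMap.applyₗ_apply_apply, LinearEquiv.coe_coe,
        MulOpposite.coe_opLinearEquiv, MulOpposite.unop_op, MulOpposite.unop_mul,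
        MulOpposite.unop_sub, incL_lie, ← h, e1, e2, mul_add, add_mul, neg_mul, mul_neg,
        neg_neg, h3]
      abel)
    (fun a x => MulOpposite.unop_injective <| by
      have e1 := incA_lie k A L x a
      simp only [LinearMap.comp_apply, LinearMap.add_apply, LinearMap.neg_apply,
        AlgHom.toLinearMap_apply, LinearMap.applyₗ_apply_apply, LinearEquiv.coe_coe,
        MulOpposite.coe_opLinearEquiv, MulOpposite.unop_op, MulOpposite.unop_mul,
        unop_opHom, incL_smul, c.nabla_smul, mul_one, map_sub, map_mul, e1, add_mul, neg_mul]
      have h3 : incA k A L a * incA k A L (c.nabla x 1)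
          = incA k A L (c.nabla x 1) * incA k A L a := by
        rw [← map_mul, ← map_mul, mul_comm]
      rw [h3]
      abel)
    (fun x a => MulOpposite.unop_injective <| by
      have e1 := incA_lie k A L x a
      simp only [LinearMap.comp_apply, LinearMap.add_apply, LinearMap.neg_apply,
        AlgHom.toLinearMap_apply, LinearMap.applyₗ_apply_apply, LinearEquiv.coe_coe,
        MulOpposite.coe_opLinearEquiv, MulOpposite.unop_op, MulOpposite.unop_mul,
        MulOpposite.unop_sub, unop_opHom, e1]
      have h3 : incA k A L a * incA k A L (c.nabla x 1)
          = incA k A L (c.nabla x 1) * incA k A L a := by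
        rw [← map_mul, ← map_mul, mul_comm]
      simp only [mul_add, add_mul, h3, mul_neg, neg_mul]
      abel)

theorem antipodeHom_incA (a : A) : (antipodeHom c (incA k A L a)).unop = incA k A L a := by
  simp [antipodeHom]

theorem antipodeHom_incL (x : L) :
    (antipodeHom c (incL k A L x)).unop = -incL k A L x + incA k A L (c.nabla x 1) := by
  simp [antipodeHom]

theorem antipodeHom_invol (D : Env k A L) :
    (antipodeHom c (antipodeHom c D).unop).unop = D := by
  induction D using Env.induction with
  | hA a => simp [antipodeHom_incA]
  | hL x => simp [antipodeHom_incA, antipodeHom_incL]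
  | hadd g h hg hh => simp [hg, hh]
  | hmul g h hg hh => simp [hg, hh]

/-- The antipode `S : V L → V L`, a `k`-linear bijection with inverse `S⁻¹ = (antipode c).symm`. -/
def antipode : Env k A L ≃ₗ[k] Env k A L :=
  LinearEquiv.ofInvolutive
    { toFun := fun D => (antipodeHom c D).unop
      map_add' := fun D E => by simp
      map_smul' := fun r D => by simp }
    (antipodeHom_invol c)

theorem antipode_symm_apply (D : Env k A L) : (antipode c).symm D = (antipodeHom c D).unop := rfl

/-- `ε_r ∘ S⁻¹ = ε_l`. -/
theorem epsR_antipode_symm (D : Env k A L) : epsR c ((antipode c).symm D) = epsL k A L D := by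
  have key : ∀ n : A, (rightAct c (antipodeHom c D).unop).unop n = anchorAct k A L D n := by
    induction D using Env.induction with
    | hA a => intro n; simp [antipodeHom_incA]
    | hL x =>
      intro n
      have := c.nabla_mul x n 1
      rw [mul_one] at this
      simp [antipodeHom_incL, this, mul_comm]
    | hadd g h hg hh => intro n; simp [hg, hh]
    | hmul g h hg hh => intro n; simp [hg, hh]
  exact key 1

end Antipode

/-! ### The cyclic module of dual Hopf-cyclic homology -/

section Cyclic

variable {k A L : Type u} [CommRing k] [CommRing A] [LieRing L] [Module A L]
  [LieRingModule L A] [LieRinehartRing A L] [Algebra k A] [LieAlgebra k L]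
  [LieRinehartAlgebra k A L]

/-- `k`-linear and `A`-linear maps between left `V L`-modules. -/
abbrev AHom (M N : LMod k (Env k A L)) : Type u :=
  {f : M.carrier →ₗ[k] N.carrier // ∀ (a : A) (m : M.carrier), f (M.actA a m) = N.actA a (f m)}

theorem indMod_actA_mk (M : LMod k (Env k A L)) (a : A) (h : Env k A L) (m : M.carrier) :
    (indMod M).actA a (Bal.mk h m) = (Bal.mk (incA k A L a * h) m : IndTensor M) :=
  indMul_mk M _ h m

theorem diagMod_actA_mk (M N : LMod k (Env k A L)) (a : A) (m : M.carrier) (n : N.carrier) :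
    (diagMod M N).actA a (Bal.mk m n) = (Bal.mk (M.actA a m) n : DiagTensor M N) :=
  diagAct_incA M N a m n

/-- `id ⊗ f : V L ⊗_A M → V L ⊗_A N`, as a `k`-linear map. -/
def indLin {M N : LMod k (Env k A L)} (f : AHom M N) : IndTensor M →ₗ[k] IndTensor N :=
  Bal.map id LinearMap.id f.1 (fun _ _ => rfl) f.2

theorem indLin_mk {M N : LMod k (Env k A L)} (f : AHom M N) (h : Env k A L) (m : M.carrier) :
    indLin f (Bal.mk h m) = Bal.mk h (f.1 m) :=
  Bal.map_mk id LinearMap.id f.1 (fun _ _ => rfl) f.2 h m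

/-- `id ⊗ f : V L ⊗_A M → V L ⊗_A N`. -/
def indMap {M N : LMod k (Env k A L)} (f : AHom M N) : AHom (indMod M) (indMod N) :=
  ⟨indLin f, fun a z => by
    induction z using Bal.induction with
    | hmk h m => rw [indMod_actA_mk, indLin_mk, indLin_mk]; exact (indMod_actA_mk N a _ _).symm
    | hadd y z hy hz => rw [map_add, map_add, hy, hz, map_add, map_add]⟩

/-- `f ⊗ id : M ⊗_A P → N ⊗_A P`, as a `k`-linear map. -/
def diagLin {M N : LMod k (Env k A L)} (f : AHom M N) (P : LMod k (Env k A L)) :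
    DiagTensor M P →ₗ[k] DiagTensor N P :=
  Bal.map id f.1 LinearMap.id f.2 (fun _ _ => rfl)

theorem diagLin_mk {M N : LMod k (Env k A L)} (f : AHom M N) (P : LMod k (Env k A L))
    (m : M.carrier) (p : P.carrier) : diagLin f P (Bal.mk m p) = Bal.mk (f.1 m) p :=
  Bal.map_mk id f.1 LinearMap.id f.2 (fun _ _ => rfl) m p

/-- `f ⊗ id : M ⊗_A P → N ⊗_A P`. -/
def diagMap {M N : LMod k (Env k A L)} (f : AHom M N) (P : LMod k (Env k A L)) :
    AHom (diagMod M P) (diagMod N P) :=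
  ⟨diagLin f P, fun a z => by
    induction z using Bal.induction with
    | hmk m p =>
      rw [diagMod_actA_mk, diagLin_mk, diagLin_mk, f.2]; exact (diagMod_actA_mk N P a _ _).symm
    | hadd y z hy hz => rw [map_add, map_add, hy, hz, map_add, map_add]⟩

theorem act_balanced (M : LMod k (Env k A L)) (a : A) (h : Env k A L) (m : M.carrier) :
    M.act (rmulA k A L a h) m = M.act h (M.actA a m) := by
  simp [LMod.actA]

/-- Multiplication `V L ⊗_A M → M`, `h ⊗ m ↦ h m`, as a `k`-linear map. -/
def multLin (M : LMod k (Env k A L)) : IndTensor M →ₗ[k] M.carrier :=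
  Bal.lift M.act.toLinearMap (act_balanced M)

theorem multLin_mk (M : LMod k (Env k A L)) (h : Env k A L) (m : M.carrier) :
    multLin M (Bal.mk h m) = M.act h m :=
  Bal.lift_mk M.act.toLinearMap (act_balanced M) h m

/-- Multiplication `V L ⊗_A M → M`, `h ⊗ m ↦ h m`. -/
def multMap (M : LMod k (Env k A L)) : AHom (indMod M) M :=
  ⟨multLin M, fun a z => by
    induction z using Bal.induction with
    | hmk h m =>
      rw [indMod_actA_mk, multLin_mk, multLin_mk]
      simp [LMod.actA]
    | hadd y z hy hz => rw [map_add, map_add, hy, hz, map_add, map_add]⟩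

/-- Insertion of the unit `M → V L ⊗_A M`, `m ↦ 1 ⊗ m`. -/
def indUnit (M : LMod k (Env k A L)) : AHom M (indMod M) :=
  ⟨Bal.mkBilin (rmulA k A L) M.actA 1, fun a m => by
    rw [Bal.mkBilin_apply, Bal.mkBilin_apply, indMod_actA_mk, ← Bal.mk_rel]
    simp⟩

/-- The bilinear map `(h, a) ↦ 1 ⊗ h a` to `A ⊗_A V L`. -/
def zeroBilin : Env k A L →ₗ[k] A →ₗ[k] DiagTensor (baseMod k A L) (regMod k A L) :=
  ((LinearMap.mul k (Env k A L)).compl₂ (incA k A L).toLinearMap).compr₂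
    (Bal.mkBilin (baseMod k A L).actA (regMod k A L).actA (1 : A))

theorem zeroBilin_apply (h : Env k A L) (b : A) : zeroBilin h b
    = (Bal.mk (1 : A) (h * incA k A L b) : DiagTensor (baseMod k A L) (regMod k A L)) := rfl

theorem zeroBilin_balanced (a : A) (h : Env k A L) (b : A) :
    zeroBilin (rmulA k A L a h) b = zeroBilin h ((baseMod k A L).actA a b) := by
  have : (baseMod k A L).actA a b = a * b := anchorAct_incA k A L a b
  rw [this, zeroBilin_apply, zeroBilin_apply, rmulA_apply, map_mul, mul_assoc]

variable (k A L) in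
/-- `V L ⊗_A A → A ⊗_A V L`, `h ⊗ a ↦ 1 ⊗ h a`, as a `k`-linear map. -/
def zeroLin : IndTensor (baseMod k A L) →ₗ[k] DiagTensor (baseMod k A L) (regMod k A L) :=
  Bal.lift zeroBilin zeroBilin_balanced

theorem zeroLin_mk (h : Env k A L) (a : A) :
    zeroLin k A L (Bal.mk h a : IndTensor (baseMod k A L))
      = (Bal.mk (1 : A) (h * incA k A L a) : DiagTensor (baseMod k A L) (regMod k A L)) :=
  Bal.lift_mk (β := (baseMod k A L).actA) zeroBilin zeroBilin_balanced h a

variable (k A L) in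
/-- `V L ⊗_A A → A ⊗_A V L`, `h ⊗ a ↦ 1 ⊗ h a`. -/
def spreadZero : AHom (indMod (baseMod k A L)) (diagMod (baseMod k A L) (regMod k A L)) :=
  ⟨zeroLin k A L, fun a z => by
    induction z using Bal.induction with
    | hmk h b =>
      rw [indMod_actA_mk, zeroLin_mk, zeroLin_mk]
      refine Eq.trans ?_ (diagMod_actA_mk (baseMod k A L) (regMod k A L) a (1 : A)
        (h * incA k A L b)).symm
      rw [Bal.mk_rel]
      simp [LMod.actA, mul_assoc]
    | hadd y z hy hz => rw [map_add, map_add, hy, hz, map_add, map_add]⟩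

section Succ

variable {M : LMod k (Env k A L)} (f : AHom (indMod M) (diagMod M (regMod k A L)))

/-- The map `w ↦ (1 ⊗ w') ⊗ w''`, where `f w = w' ⊗ w''`. -/
def succAux : AHom (indMod M) (diagMod (indMod M) (regMod k A L)) :=
  ⟨(diagMap (indUnit M) (regMod k A L)).1 ∘ₗ f.1, fun a w =>
    (congrArg (diagMap (indUnit M) (regMod k A L)).1 (f.2 a w)).trans
      ((diagMap (indUnit M) (regMod k A L)).2 a (f.1 w))⟩

/-- The bilinear map `(h, w) ↦ h · ((1 ⊗ w') ⊗ w'')`, where `f w = w' ⊗ w''`. -/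
def succBilin : Env k A L →ₗ[k] IndTensor M →ₗ[k] DiagTensor (indMod M) (regMod k A L) :=
  (diagAct (indMod M) (regMod k A L)).toLinearMap.compl₂ (succAux f).1

theorem succBilin_apply (h : Env k A L) (w : IndTensor M) :
    succBilin f h w = diagAct (indMod M) (regMod k A L) h ((succAux f).1 w) := rfl

theorem succBilin_balanced (a : A) (h : Env k A L) (w : IndTensor M) :
    succBilin f (rmulA k A L a h) w = succBilin f h ((indMod M).actA a w) := by
  rw [succBilin_apply, succBilin_apply, (succAux f).2]
  exact act_balanced (diagMod (indMod M) (regMod k A L)) a h ((succAux f).1 w)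

/-- The map `h ⊗ w ↦ h · ((1 ⊗ w') ⊗ w'')`, where `f w = w' ⊗ w''`. -/
def succLin : IndTensor (indMod M) →ₗ[k] DiagTensor (indMod M) (regMod k A L) :=
  Bal.lift (succBilin f) (succBilin_balanced f)

theorem succLin_mk (h : Env k A L) (w : IndTensor M) : succLin f (Bal.mk h w)
    = diagAct (indMod M) (regMod k A L) h ((succAux f).1 w) :=
  Bal.lift_mk (β := (indMod M).actA) (succBilin f) (succBilin_balanced f) h w

/-- From `f : V L ⊗_A M → M ⊗_A V L`, `w ↦ w' ⊗ w''`, the map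
`V L ⊗_A (V L ⊗_A M) → (V L ⊗_A M) ⊗_A V L`, `h ⊗ w ↦ (h_(1) ⊗ w') ⊗ h_(2) w''`. -/
def spreadSucc : AHom (indMod (indMod M)) (diagMod (indMod M) (regMod k A L)) :=
  ⟨succLin f, fun a z => by
    induction z using Bal.induction with
    | hmk h w =>
      rw [indMod_actA_mk, succLin_mk, succLin_mk, map_mul]
      rfl
    | hadd y z hy hz => rw [map_add, map_add, hy, hz, map_add, map_add]⟩

end Succ

theorem indEpsR_balanced (c : FlatRightConnection k A L) (M : LMod k (Env k A L)) (a : A)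
    (h : Env k A L) (m : M.carrier) :
    M.actA (epsR c (rmulA k A L a h)) m = M.actA (epsR c h) (M.actA a m) := by
  rw [rmulA_apply, epsR_mul_incA, mul_comm, LMod.actA_mul]

/-- `V L ⊗_A M → M`, `h ⊗ m ↦ ε_r(h) m`. -/
def indEpsR (c : FlatRightConnection k A L) (M : LMod k (Env k A L)) :
    IndTensor M →ₗ[k] M.carrier :=
  Bal.lift (M.act.toLinearMap ∘ₗ (incA k A L).toLinearMap ∘ₗ epsR c) (indEpsR_balanced c M)

theorem rotate_balanced (c : FlatRightConnection k A L) (M : LMod k (Env k A L)) (a : A)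
    (m : M.carrier) (h : Env k A L) :
    (Bal.mk ((antipode c).symm h) (M.actA a m) : IndTensor M)
      = Bal.mk ((antipode c).symm ((regMod k A L).actA a h)) m := by
  have : (antipode c).symm ((regMod k A L).actA a h) = rmulA k A L a ((antipode c).symm h) := by
    simp [antipode_symm_apply, antipodeHom_incA, LMod.actA]
  rw [this, Bal.mk_rel]

/-- `M ⊗_A V L → V L ⊗_A M`, `m ⊗ h ↦ S⁻¹(h) ⊗ m`. -/
def rotate (c : FlatRightConnection k A L) (M : LMod k (Env k A L)) :
    DiagTensor M (regMod k A L) →ₗ[k] IndTensor M :=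
  Bal.lift ((Bal.mkBilin (rmulA k A L) M.actA ∘ₗ
      ((antipode c).symm : Env k A L →ₗ[k] Env k A L)).flip) (rotate_balanced c M)

variable (k A L) in
/-- The chains `C_n(V L) = V L ⊗_A ⋯ ⊗_A V L` (`n` factors), for the bimodule structure on `V L`
given by left and right multiplication, with `C_0 = A` and `C_{n+1} = V L ⊗_A C_n`. So
`h¹ ⊗ ⋯ ⊗ hⁿ` is `h¹ ⊗ (h² ⊗ (⋯ ⊗ (hⁿ ⊗ 1)))`, and `⋯ ⊗ (hⁿ ⊗ a) = ⋯ ⊗ (hⁿ a ⊗ 1)`. Left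
multiplication on the first factor (and the canonical action on `C_0 = A`) is recorded as well. -/
def chainMod : ℕ → LMod k (Env k A L)
  | 0 => baseMod k A L
  | n + 1 => indMod (chainMod n)

variable (k A L) in
/-- The `k`-module `C_n(V L)`. -/
abbrev Chain (n : ℕ) : Type u := (chainMod k A L n).carrier

/-- The element `h ⊗ w` of `C_{n+1} = V L ⊗_A C_n`. -/
def Chain.tmul {n : ℕ} (h : Env k A L) (w : Chain k A L n) : Chain k A L (n + 1) :=
  Bal.mk (α := rmulA k A L) (β := (chainMod k A L n).actA) h w

/-- The element `a ∈ A = C_0`. -/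
def Chain.base (a : A) : Chain k A L 0 := a

variable (k A L) in
/-- For `i < n`, the map `h⁰ ⊗ ⋯ ⊗ hⁿ ↦ h⁰ ⊗ ⋯ ⊗ hⁱ hⁱ⁺¹ ⊗ ⋯ ⊗ hⁿ` on `C_{n+1}`, and for `i = n`
the map `h⁰ ⊗ ⋯ ⊗ hⁿ ↦ h⁰ ⊗ ⋯ ⊗ hⁿ⁻¹ ε_l(hⁿ)`, where `ε_l = ε_r ∘ S⁻¹` (see `barFace_zero`).
Not used for `i > n`. -/
def barFace : (n i : ℕ) → AHom (chainMod k A L (n + 1)) (chainMod k A L n)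
  | n, 0 => multMap (chainMod k A L n)
  | 0, _ + 1 => ⟨0, fun _ _ => by simp⟩
  | n + 1, i + 1 => indMap (barFace n i)

variable (c : FlatRightConnection k A L)

theorem barFace_zero (h : Env k A L) (a : A) :
    (barFace k A L 0 0).1 (Chain.tmul h (Chain.base a))
      = Chain.base (epsR c ((antipode c).symm (h * incA k A L a))) := by
  rw [epsR_antipode_symm]
  refine (multLin_mk (baseMod k A L) h a).trans ?_
  change anchorAct k A L h a = anchorAct k A L (h * incA k A L a) 1
  simp

/-- The face `h¹ ⊗ ⋯ ⊗ hⁿ⁺¹ ↦ ε_r(h¹) h² ⊗ ⋯ ⊗ hⁿ⁺¹` (and `h ↦ ε_r(h)` on `C_1`). -/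
def firstFace (n : ℕ) : Chain k A L (n + 1) →ₗ[k] Chain k A L n :=
  indEpsR c (chainMod k A L n)

/-- The faces `d_i : C_{n+1} → C_n`, `0 ≤ i ≤ n + 1`. -/
def face (n : ℕ) : ℕ → (Chain k A L (n + 1) →ₗ[k] Chain k A L n)
  | 0 => firstFace c n
  | i + 1 => (barFace k A L n i).1

/-- The Hochschild differential `b = ∑_{i=0}^{n+1} (-1)^i d_i : C_{n+1} → C_n`. -/
def hochschildB (n : ℕ) : Chain k A L (n + 1) →ₗ[k] Chain k A L n :=
  ∑ i ∈ Finset.range (n + 2), (-1 : k) ^ i • face c n i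

/-- The truncated differential `b' = ∑_{i=0}^{n} (-1)^i d_i : C_{n+1} → C_n`. -/
def hochschildB' (n : ℕ) : Chain k A L (n + 1) →ₗ[k] Chain k A L n :=
  ∑ i ∈ Finset.range (n + 1), (-1 : k) ^ i • face c n i

variable (k A L) in
/-- The map `h¹ ⊗ ⋯ ⊗ hⁿ⁺¹ ↦ (h¹_(1) ⊗ ⋯ ⊗ hⁿ_(1)) ⊗ h¹_(2) ⋯ hⁿ_(2) hⁿ⁺¹` from `C_{n+1}` to
`C_n ⊗_A V L`, in the recursive form `h ⊗ w ↦ h · (1 ⊗ w' ⊗ w'')`, where `w ↦ w' ⊗ w''` is the map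
one degree below and `h ∈ V L` acts through the left coproduct. -/
def spread : (n : ℕ) →
    AHom (chainMod k A L (n + 1)) (diagMod (chainMod k A L n) (regMod k A L))
  | 0 => spreadZero k A L
  | n + 1 => spreadSucc (spread n)

/-- The cyclic operator
`t_n(h¹ ⊗ ⋯ ⊗ hⁿ) = S⁻¹(h¹_(2) ⋯ hⁿ⁻¹_(2) hⁿ) ⊗ h¹_(1) ⊗ ⋯ ⊗ hⁿ⁻¹_(1)`, with `t_0 = id`. -/
def cyclicT : (n : ℕ) → Module.End k (Chain k A L n)
  | 0 => LinearMap.id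
  | n + 1 => rotate c (chainMod k A L n) ∘ₗ (spread k A L n).1

/-- The signed cyclic operator `λ_n = (-1)^n t_n`. -/
def signedT (n : ℕ) : Module.End k (Chain k A L n) := (-1 : k) ^ n • cyclicT c n

/-- The norm operator `N = ∑_{j=0}^n λ_n^j`. -/
def normT (n : ℕ) : Module.End k (Chain k A L n) :=
  ∑ j ∈ Finset.range (n + 1), signedT c n ^ j

variable (k A L) in
/-- The total complex of the cyclic double complex `CC_{p,q} = C_q`, `p, q ≥ 0`: in degree `n` it
is `⨁_{p+q=n} C_q`, and a family is indexed by `q = 0, …, n`. -/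
abbrev CycTot (n : ℕ) : Type u := (q : Fin (n + 1)) → Chain k A L q

/-- The total differential of the cyclic double complex. The vertical differential is `b` in the
even columns and `-b'` in the odd columns; the horizontal one, from column `p + 1` to column `p`,
is `1 - λ` for `p` even and `N` for `p` odd. -/
def cycD (n : ℕ) : CycTot k A L (n + 1) →ₗ[k] CycTot k A L n :=
  LinearMap.pi fun q =>
    if Even (n - (q : ℕ)) then
      hochschildB c q ∘ₗ LinearMap.proj (φ := fun q : Fin (n + 2) => Chain k A L q) q.succ
        + (1 - signedT c q) ∘ₗ
          LinearMap.proj (φ := fun q : Fin (n + 2) => Chain k A L q) q.castSucc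
    else
      -(hochschildB' c q ∘ₗ LinearMap.proj (φ := fun q : Fin (n + 2) => Chain k A L q) q.succ)
        + normT c q ∘ₗ
          LinearMap.proj (φ := fun q : Fin (n + 2) => Chain k A L q) q.castSucc

/-- The dual Hopf-Hochschild homology `HH_n(V L)`. -/
abbrev HH (n : ℕ) : Type u := Homology (X := Chain k A L) (hochschildB c) n

/-- The dual Hopf-cyclic homology `HC_n(V L)`. -/
abbrev HC (n : ℕ) : Type u := Homology (X := CycTot k A L) (cycD c) n

end Cyclic


/-! ### Tor over the enveloping algebra -/

section Tor

variable {k V N : Type u} [CommRing k] [Ring V] [Algebra k V] [AddCommGroup N] [Module k N]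

/-- A left `V`-module in the sense of `LMod`, as an object of the category of `V`-modules. -/
def LMod.toModuleCat (M : LMod k V) : ModuleCat.{u} V :=
  letI : Module V M.carrier := Module.compHom M.carrier M.act.toRingHom
  ModuleCat.of V M.carrier

variable (k) in
/-- A `V`-module, as a left `V`-module in the sense of `LMod`, by restriction of scalars. -/
def LMod.ofModuleCat (P : ModuleCat.{u} V) : LMod k V where
  carrier := P
  module := Module.compHom P (algebraMap k V)
  act :=
    letI : Module k P := Module.compHom P (algebraMap k V)
    haveI : IsScalarTower k V P := IsScalarTower.of_algebraMap_smul fun _ _ => rfl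
    Algebra.lsmul k k P

variable (k) in
/-- A morphism of `V`-modules, as a `k`-linear map. -/
def linOver {P Q : ModuleCat.{u} V} (g : P ⟶ Q) :
    (LMod.ofModuleCat k P).carrier →ₗ[k] (LMod.ofModuleCat k Q).carrier where
  toFun p := g.hom p
  map_add' p q := map_add g.hom p q
  map_smul' r p := g.hom.map_smul' (algebraMap k V r) p

theorem linOver_act {P Q : ModuleCat.{u} V} (g : P ⟶ Q) (v : V)
    (p : (LMod.ofModuleCat k P).carrier) :
    linOver k g ((LMod.ofModuleCat k P).act v p) = (LMod.ofModuleCat k Q).act v (linOver k g p) :=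
  g.hom.map_smul' v p

/-- The tensor product `N ⊗_V P` of the right `V`-module `N`, whose action is
`ρ : V → End(N)ᵒᵖ`, and the left `V`-module `P`; thus `n v ⊗ p = n ⊗ v p`. -/
abbrev TensorOver (ρ : V →ₐ[k] (Module.End k N)ᵐᵒᵖ) (P : ModuleCat.{u} V) : Type u :=
  Bal (fun v : V => (ρ v).unop) (fun v : V => (LMod.ofModuleCat k P).act v)

/-- The map `n ⊗ p ↦ n ⊗ g(p)`. -/
def tensorMap (ρ : V →ₐ[k] (Module.End k N)ᵐᵒᵖ) {P Q : ModuleCat.{u} V} (g : P ⟶ Q) :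
    TensorOver ρ P →ₗ[k] TensorOver ρ Q :=
  Bal.map id LinearMap.id (linOver k g) (fun _ _ => rfl) (linOver_act g)

theorem tensorMap_mk (ρ : V →ₐ[k] (Module.End k N)ᵐᵒᵖ) {P Q : ModuleCat.{u} V} (g : P ⟶ Q)
    (n : N) (p : (LMod.ofModuleCat k P).carrier) :
    tensorMap ρ g (Bal.mk n p) = Bal.mk n (linOver k g p) :=
  Bal.map_mk id LinearMap.id (linOver k g) (fun _ _ => rfl) (linOver_act g) n p

/-- The functor `N ⊗_V -` from left `V`-modules to `k`-modules. -/
def tensorFunctor (ρ : V →ₐ[k] (Module.End k N)ᵐᵒᵖ) : ModuleCat.{u} V ⥤ ModuleCat.{u} k where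
  obj P := ModuleCat.of k (TensorOver ρ P)
  map g := ModuleCat.ofHom (tensorMap ρ g)
  map_id P := ModuleCat.hom_ext <| Bal.hom_ext fun n p => tensorMap_mk ρ (𝟙 P) n p
  map_comp f g := ModuleCat.hom_ext <| Bal.hom_ext fun n p =>
    (tensorMap_mk ρ (f ≫ g) n p).trans
      (((congrArg (tensorMap ρ g) (tensorMap_mk ρ f n p)).trans (tensorMap_mk ρ g n _)).symm)

instance tensorFunctor_additive (ρ : V →ₐ[k] (Module.End k N)ᵐᵒᵖ) :
    (tensorFunctor ρ).Additive where
  map_add {P Q f g} := ModuleCat.hom_ext <| Bal.hom_ext fun n p => by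
    refine (tensorMap_mk ρ (f + g) n p).trans ?_
    refine Eq.trans ?_ (congrArg₂ (· + ·) (tensorMap_mk ρ f n p) (tensorMap_mk ρ g n p)).symm
    exact Bal.mk_add_right n (linOver k f p) (linOver k g p)

/-- `Tor_n^V(N, P)`, the left derived functors of `N ⊗_V -`. -/
def torOver (ρ : V →ₐ[k] (Module.End k N)ᵐᵒᵖ) (n : ℕ) (P : ModuleCat.{u} V) : ModuleCat.{u} k :=
  ((tensorFunctor ρ).leftDerived n).obj P

end Tor

section LRHomology

variable {k A L : Type u} [CommRing k] [CommRing A] [LieRing L] [Module A L]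
  [LieRingModule L A] [LieRinehartRing A L] [Algebra k A] [LieAlgebra k L]
  [LieRinehartAlgebra k A L]

/-- Lie-Rinehart homology `H_n(L, A_∇) = Tor_n^{V L}(A_∇, A)`. -/
abbrev lrHomology (c : FlatRightConnection k A L) (n : ℕ) : ModuleCat.{u} k :=
  torOver (rightAct c) n (baseMod k A L).toModuleCat

end LRHomology

/-! ### Functoriality -/

/-- A Lie-Rinehart algebra `(A, L)` over `k`, with `L` projective over `A`, together with a flat
right connection on `A`. -/
structure LRData (k : Type u) [CommRing k] where
  /-- the commutative algebra -/
  A : Type u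
  /-- the Lie algebra -/
  L : Type u
  [commRing : CommRing A]
  [lieRing : LieRing L]
  [module : Module A L]
  [lieRingModule : LieRingModule L A]
  [lieRinehartRing : LieRinehartRing A L]
  [algebra : Algebra k A]
  [lieAlgebra : LieAlgebra k L]
  [lieRinehartAlgebra : LieRinehartAlgebra k A L]
  [projective : Module.Projective A L]
  /-- the flat right connection -/
  conn : FlatRightConnection k A L

attribute [instance] LRData.commRing LRData.lieRing LRData.module LRData.lieRingModule
  LRData.lieRinehartRing LRData.algebra LRData.lieAlgebra LRData.lieRinehartAlgebra
  LRData.projective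

/-- Morphisms: morphisms of Lie-Rinehart algebras that are compatible with the connections. -/
structure LRData.Hom {k : Type u} [CommRing k] (X Y : LRData k) where
  /-- the morphism of commutative algebras -/
  σ : X.A →ₐ[k] Y.A
  /-- the morphism of Lie algebras over it -/
  f : LieRinehartAlgebra.Hom σ X.L Y.L
  nabla : ∀ (x : X.L) (a : X.A), σ (X.conn.nabla x a) = Y.conn.nabla (f x) (σ a)

section Functoriality

variable {k : Type u} [CommRing k] {X Y : LRData k} (F : X.Hom Y)

/-- The algebra morphism `V L → V L'` induced by a morphism of Lie-Rinehart algebras. -/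
def LRData.Hom.env : Env k X.A X.L →ₐ[k] Env k Y.A Y.L :=
  Env.lift ((incA k Y.A Y.L).comp F.σ) (incL k Y.A Y.L ∘ₗ F.f.toLieHom.toLinearMap)
    (fun x y => by simp [incL_lie])
    (fun a x => by simp [F.f.map_smul_apply, incL_smul])
    (fun x a => by simp [F.f.apply_lie, incA_lie])

theorem LRData.Hom.env_incA (a : X.A) :
    F.env (incA k X.A X.L a) = incA k Y.A Y.L (F.σ a) :=
  Env.lift_incA _ _ _ _ _ a

theorem LRData.Hom.env_incL (x : X.L) :
    F.env (incL k X.A X.L x) = incL k Y.A Y.L (F.f x) :=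
  Env.lift_incL _ _ _ _ _ x

theorem LRData.Hom.σ_anchorAct (D : Env k X.A X.L) (a : X.A) :
    F.σ (anchorAct k X.A X.L D a) = anchorAct k Y.A Y.L (F.env D) (F.σ a) := by
  induction D using Env.induction generalizing a with
  | hA b => simp [F.env_incA]
  | hL x => simp [F.env_incL, F.f.apply_lie]
  | hadd g h hg hh => simp [hg, hh]
  | hmul g h hg hh => simp [hg, hh]

theorem LRData.Hom.σ_rightAct (D : Env k X.A X.L) (a : X.A) :
    F.σ ((rightAct X.conn D).unop a) = (rightAct Y.conn (F.env D)).unop (F.σ a) := by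
  induction D using Env.induction generalizing a with
  | hA b => simp [F.env_incA]
  | hL x => simp [F.env_incL, F.nabla]
  | hadd g h hg hh => simp [hg, hh]
  | hmul g h hg hh => simp [hg, hh]

theorem LRData.Hom.env_rmulA (a : X.A) (h : Env k X.A X.L) :
    F.env (rmulA k X.A X.L a h) = rmulA k Y.A Y.L (F.σ a) (F.env h) := by
  simp [F.env_incA]

/-- Maps `M → M'` that are `k`-linear and linear over `A → A'`. -/
abbrev LRData.Hom.SemiHom (M : LMod k (Env k X.A X.L)) (M' : LMod k (Env k Y.A Y.L)) : Type u :=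
  {g : M.carrier →ₗ[k] M'.carrier // ∀ (a : X.A) (m : M.carrier),
    g (M.actA a m) = M'.actA (F.σ a) (g m)}

/-- The map `h ⊗ m ↦ F(h) ⊗ g(m)`, as a `k`-linear map. -/
def LRData.Hom.indLin {M : LMod k (Env k X.A X.L)} {M' : LMod k (Env k Y.A Y.L)}
    (g : F.SemiHom M M') : IndTensor M →ₗ[k] IndTensor M' :=
  Bal.map F.σ F.env.toLinearMap g.1 F.env_rmulA g.2

theorem LRData.Hom.indLin_mk {M : LMod k (Env k X.A X.L)} {M' : LMod k (Env k Y.A Y.L)}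
    (g : F.SemiHom M M') (h : Env k X.A X.L) (m : M.carrier) :
    F.indLin g (Bal.mk h m) = Bal.mk (F.env h) (g.1 m) :=
  Bal.map_mk F.σ F.env.toLinearMap g.1 F.env_rmulA g.2 h m

/-- The map `h ⊗ m ↦ F(h) ⊗ g(m)`. -/
def LRData.Hom.indMap {M : LMod k (Env k X.A X.L)} {M' : LMod k (Env k Y.A Y.L)}
    (g : F.SemiHom M M') : F.SemiHom (indMod M) (indMod M') :=
  ⟨F.indLin g, fun a z => by
    induction z using Bal.induction with
    | hmk h m =>
      rw [indMod_actA_mk, F.indLin_mk, F.indLin_mk, map_mul, F.env_incA]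
      exact (indMod_actA_mk M' (F.σ a) (F.env h) (g.1 m)).symm
    | hadd y z hy hz => rw [map_add, map_add, hy, hz, map_add, map_add]⟩

/-- The induced map `C_n(V L) → C_n(V L')`, as a map over `A → A'`. -/
def LRData.Hom.chainAux :
    (n : ℕ) → F.SemiHom (chainMod k X.A X.L n) (chainMod k Y.A Y.L n)
  | 0 => ⟨F.σ.toLinearMap, fun a b => by
      refine (F.σ_anchorAct (incA k X.A X.L a) b).trans ?_
      rw [F.env_incA]
      rfl⟩
  | n + 1 => F.indMap (LRData.Hom.chainAux n)

/-- The induced map `C_n(V L) → C_n(V L')`,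
`h¹ ⊗ ⋯ ⊗ hⁿ ↦ F(h¹) ⊗ ⋯ ⊗ F(hⁿ)`, which is `A → A'` for `n = 0`. -/
def LRData.Hom.chain (n : ℕ) : Chain k X.A X.L n →ₗ[k] Chain k Y.A Y.L n :=
  (F.chainAux n).1

/-- The induced map on the total complexes of the cyclic double complexes. -/
def LRData.Hom.cycTot (n : ℕ) : CycTot k X.A X.L n →ₗ[k] CycTot k Y.A Y.L n :=
  LinearMap.pi fun q => F.chain q ∘ₗ
    LinearMap.proj (φ := fun q : Fin (n + 1) => Chain k X.A X.L q) q

/-- The restriction of scalars along `V L → V L'`. -/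
abbrev LRData.Hom.res : ModuleCat.{u} (Env k Y.A Y.L) ⥤ ModuleCat.{u} (Env k X.A X.L) :=
  ModuleCat.restrictScalars F.env.toRingHom

/-- The map `A → A'` as a morphism of `V L`-modules. -/
def LRData.Hom.baseHom :
    (baseMod k X.A X.L).toModuleCat ⟶ F.res.obj (baseMod k Y.A Y.L).toModuleCat :=
  letI : Module (Env k X.A X.L) X.A := Module.compHom X.A (anchorAct k X.A X.L).toRingHom
  letI : Module (Env k X.A X.L) Y.A :=
    Module.compHom Y.A ((anchorAct k Y.A Y.L).comp F.env).toRingHom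
  ModuleCat.ofHom (X := X.A) (Y := Y.A)
    { toFun := F.σ
      map_add' := map_add F.σ
      map_smul' := F.σ_anchorAct }

/-- The identity of the `V L'`-module `P`, as a `k`-linear map from its restriction to `V L`. -/
def LRData.Hom.resId (P : ModuleCat.{u} (Env k Y.A Y.L)) :
    (LMod.ofModuleCat k (F.res.obj P)).carrier →ₗ[k] (LMod.ofModuleCat k P).carrier where
  toFun p := p
  map_add' _ _ := rfl
  map_smul' r p := by
    have key : ∀ q : P, F.env (algebraMap k _ r) • q = algebraMap k (Env k Y.A Y.L) r • q :=
      fun q => by rw [AlgHom.commutes]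
    exact key p

/-- The map `A_∇ ⊗_{V L} P → A'_∇' ⊗_{V L'} P` for a `V L'`-module `P`. -/
def LRData.Hom.tensorApp (P : ModuleCat.{u} (Env k Y.A Y.L)) :
    TensorOver (rightAct X.conn) (F.res.obj P) →ₗ[k] TensorOver (rightAct Y.conn) P :=
  Bal.map F.env F.σ.toLinearMap (F.resId P) F.σ_rightAct fun _ _ => rfl

theorem LRData.Hom.tensorApp_mk (P : ModuleCat.{u} (Env k Y.A Y.L)) (a : X.A)
    (p : (LMod.ofModuleCat k (F.res.obj P)).carrier) :
    F.tensorApp P (Bal.mk a p) = Bal.mk (F.σ a) (F.resId P p) :=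
  Bal.map_mk F.env F.σ.toLinearMap (F.resId P) F.σ_rightAct (fun _ _ => rfl) a p

/-- The natural map `A_∇ ⊗_{V L} P → A'_∇' ⊗_{V L'} P`, `a ⊗ p ↦ F(a) ⊗ p`, for `V L'`-modules
`P`. -/
def LRData.Hom.tensorNat :
    F.res ⋙ tensorFunctor (rightAct X.conn) ⟶ tensorFunctor (rightAct Y.conn) where
  app P := ModuleCat.ofHom (F.tensorApp P)
  naturality P Q g := ModuleCat.hom_ext <| Bal.hom_ext fun a p =>
    ((congrArg (F.tensorApp Q) (tensorMap_mk (rightAct X.conn) (F.res.map g) a p)).trans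
      (F.tensorApp_mk Q a _)).trans
      ((congrArg (tensorMap (rightAct Y.conn) g) (F.tensorApp_mk P a p)).trans
        (tensorMap_mk (rightAct Y.conn) g _ _)).symm

/-- `θ` is the map `H_n(L, A_∇) → H_n(L', A'_∇')` induced by `F`: for some projective resolutions
`P → A` over `V L` and `Q → A'` over `V L'` and some lift `g : P → Q` of `A → A'` to a chain map over
`V L → V L'`, it is induced by the chain map `A_∇ ⊗_{V L} P → A'_∇' ⊗_{V L'} Q`,
`a ⊗ p ↦ F(a) ⊗ g(p)`. -/
def LRData.Hom.IsInduced (n : ℕ) (θ : lrHomology X.conn n ⟶ lrHomology Y.conn n) : Prop :=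
  ∃ (P : ProjectiveResolution (baseMod k X.A X.L).toModuleCat)
    (Q : ProjectiveResolution (baseMod k Y.A Y.L).toModuleCat)
    (g : P.complex ⟶ (F.res.mapHomologicalComplex _).obj Q.complex),
    g.f 0 ≫ F.res.map (Q.π.f 0) = P.π.f 0 ≫ F.baseHom ∧
    θ = (P.isoLeftDerivedObj (tensorFunctor (rightAct X.conn)) n).hom ≫
      HomologicalComplex.homologyMap
        (((tensorFunctor (rightAct X.conn)).mapHomologicalComplex _).map g ≫
          (NatTrans.mapHomologicalComplex F.tensorNat _).app Q.complex) n ≫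
      (Q.isoLeftDerivedObj (tensorFunctor (rightAct Y.conn)) n).inv

end Functoriality

end LRHopf

end

/-! Hochschild homology. The modules `C_{n+1} = V L ⊗_A C_n`, with left multiplication by `V L`,
form the bar resolution of `A`, contracted by `w ↦ 1 ⊗ w`. They are projective over `V L` once `V L`
is projective as a left `A`-module. Applying `A_∇ ⊗ -` over `V L` amounts to identifying `h z` with
`ε_r(h) z`; it turns `C_{n+1}` into `C_n` and the bar differential into `b` (`IsCoinv.equivTensor`,
`firstFace_barD`). So `(C, b)` computes Tor (`hochschildEquiv`).

Projectivity of `V L` over `A` (`Env.projective`). For free `L`, the free `A`-module on monomials in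
a basis receives the action of `V L` that symmetrised products force. Its flatness follows from a
recursion on the degree and the Bianchi identity. Symmetrisation is then a `V L`-linear map back to
`V L` taking `1` to `1`, which makes `V L` a direct summand of a free `A`-module. For projective
`L`, a large free module with coordinatewise action is added to reach the free case, and `V L` is a
retract of the larger enveloping algebra.

The cyclic structure. `C_n` is the module of coinvariants of the tensor power of `n + 1` copies of
`V L` over `A`, formed with the left `A`-structures and given the diagonal action. Upstairs the
faces drop a factor through `ε_l`, and the cyclic operator merely permutes the factors, which is `V
L`-linear because the coproduct is cocommutative. The tensor identity (`tensorIdentEquiv`, `psi`)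
compares these powers with the bar resolution. Passing to coinvariants is an integration by parts
and produces the `S⁻¹` in the cyclic operator (`indEpsR_homAct`, `symCoinv_symRot`). The cyclic
relations are evident upstairs and descend along the surjections `symCoinv`.

The splitting. The total complex of the cyclic double complex of the tensor powers consists of
projective `V L`-modules. Hence the identity of `A` lifts to a chain map from it to the bar
resolution, and on the first column this map is homotopic to the identity. Coinvariants give a
retraction, up to homotopy, of the cyclic complex to the Hochschild complex (`colRetract_chain`). As
`b'` is acyclic and the columns have period two, such a retraction makes Connes' boundary vanish;
applied to all shifts of a cycle, it identifies `HC_n` with the sum of the `HH_{n-2i}`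
(`isBdry_of_retract`, `exists_retract_eq`).

Naturality. A morphism acts compatibly on all complexes. The retractions of the source and the
target agree up to homotopy, since both composites lift `A → A'` from a complex of projectives to an
exact complex (`LRData.Hom.exists_homotopy_rho`). -/

noncomputable section

namespace LRHopf

set_option linter.unusedSectionVars false

/-! ### Sums over the elements of a multiset -/

section EraseSum

variable {I : Type*} [DecidableEq I] {E : Type*} [AddCommGroup E]

/-- The sum of `f j (Y - j)` over the elements `j` of `Y`, with multiplicity. -/
def eraseSum (Y : Multiset I) (f : I → Multiset I → E) : E :=
  (Y.map fun j => f j (Y.erase j)).sum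

theorem eraseSum_zero (f : I → Multiset I → E) : eraseSum 0 f = 0 := by simp [eraseSum]

theorem eraseSum_congr {Y : Multiset I} {f g : I → Multiset I → E}
    (h : ∀ j ∈ Y, f j (Y.erase j) = g j (Y.erase j)) : eraseSum Y f = eraseSum Y g := by
  rw [eraseSum, eraseSum, Multiset.map_congr rfl h]

theorem eraseSum_cons (i : I) (Y : Multiset I) (f : I → Multiset I → E) :
    eraseSum (i ::ₘ Y) f = f i Y + eraseSum Y fun j Z => f j (i ::ₘ Z) := by
  rw [eraseSum, Multiset.map_cons, Multiset.sum_cons, Multiset.erase_cons_head, eraseSum]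
  congr 2
  refine Multiset.map_congr rfl fun j hj => ?_
  rw [Multiset.erase_cons_tail_of_mem hj]

theorem eraseSum_add (Y : Multiset I) (f g : I → Multiset I → E) :
    eraseSum Y (fun j Z => f j Z + g j Z) = eraseSum Y f + eraseSum Y g := by
  simp [eraseSum]

theorem eraseSum_sub (Y : Multiset I) (f g : I → Multiset I → E) :
    eraseSum Y (fun j Z => f j Z - g j Z) = eraseSum Y f - eraseSum Y g := by
  simp [eraseSum]

theorem eraseSum_neg (Y : Multiset I) (f : I → Multiset I → E) :
    eraseSum Y (fun j Z => - f j Z) = - eraseSum Y f := by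
  simp [eraseSum]

theorem map_eraseSum {E' : Type*} [AddCommGroup E'] (φ : E →+ E') (Y : Multiset I)
    (f : I → Multiset I → E) :
    φ (eraseSum Y f) = eraseSum Y fun j Z => φ (f j Z) := by
  simp [eraseSum, map_multiset_sum, Multiset.map_map]

theorem eraseSum_smul_const (Y : Multiset I) (v : E) :
    eraseSum Y (fun _ _ => v) = Multiset.card Y • v := by
  simp [eraseSum]

theorem eraseSum_cons_erase (Y : Multiset I) (f : Multiset I → E) :
    eraseSum Y (fun j Z => f (j ::ₘ Z)) = Multiset.card Y • f Y := by
  rw [← eraseSum_smul_const]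
  exact eraseSum_congr fun j hj => by rw [Multiset.cons_erase hj]

theorem eraseSum_mem {K : Type*} [Semiring K] [Module K E] (W : Submodule K E) (Y : Multiset I)
    (f : I → Multiset I → E) (h : ∀ j ∈ Y, f j (Y.erase j) ∈ W) : eraseSum Y f ∈ W := by
  refine multiset_sum_mem _ fun a ha => ?_
  obtain ⟨j, hj, rfl⟩ := Multiset.mem_map.1 ha
  exact h j hj

/-- Both sides run over the ordered pairs of distinct occurrences in `Y`, and such pairs may be
reversed. It serves to antisymmetrise brackets and to move an operator out of the inner sum. -/
theorem eraseSum_comm (Y : Multiset I) (f : I → I → Multiset I → E) :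
    eraseSum Y (fun j Z => eraseSum Z fun i W => f j i W)
      = eraseSum Y fun j Z => eraseSum Z fun i W => f i j W := by
  induction Y using Multiset.induction_on generalizing f with
  | empty => simp [eraseSum_zero]
  | cons x Y ih =>
    simp only [eraseSum_cons, eraseSum_add]
    rw [ih fun j i W => f j i (x ::ₘ W)]
    abel

end EraseSum

/-! ### Operators on the free module on the monomials -/

section Monomials

variable {k A L : Type u} [CommRing k] [CommRing A] [LieRing L] [Module A L]
  [LieRingModule L A] [LieRinehartRing A L] [Algebra k A] [LieAlgebra k L]
  [LieRinehartAlgebra k A L] {I : Type u} (e : Module.Basis I A L)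

/-- The free `A`-module on the monomials in the elements of `I`. -/
abbrev Mono (A I : Type u) [CommRing A] : Type u := Multiset I →₀ A

/-- A monomial. -/
abbrev mono (A : Type u) {I : Type u} [CommRing A] (Y : Multiset I) : Mono A I :=
  Finsupp.single Y 1

/-- The part of degree at most `n`. -/
def filt (A I : Type u) [CommRing A] (n : ℕ) : Submodule A (Mono A I) :=
  Finsupp.supported A A {Y | Multiset.card Y ≤ n}

theorem mono_mem_filt {n : ℕ} {Y : Multiset I} (h : Multiset.card Y ≤ n) :
    mono A Y ∈ filt A I n :=
  Finsupp.single_mem_supported A 1 h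

theorem filt_mono {m n : ℕ} (h : m ≤ n) : filt A I m ≤ filt A I n :=
  Finsupp.supported_mono fun _ hY => le_trans hY h

theorem filt_induction {n : ℕ} {p : Mono A I → Prop} (h0 : p 0)
    (hadd : ∀ s t, p s → p t → p (s + t)) (hsmul : ∀ (a : A) s, p s → p (a • s))
    (hmono : ∀ Y, Multiset.card Y ≤ n → p (mono A Y)) {s : Mono A I} (hs : s ∈ filt A I n) :
    p s := by
  rw [filt, Finsupp.supported_eq_span_single] at hs
  induction hs using Submodule.span_induction with
  | mem x hx => obtain ⟨Y, hY, rfl⟩ := hx; exact hmono Y hY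
  | zero => exact h0
  | add x y _ _ hx hy => exact hadd x y hx hy
  | smul a x _ hx => exact hsmul a x hx

theorem exists_mem_filt (s : Mono A I) : ∃ n, s ∈ filt A I n := by
  induction s using Finsupp.induction_linear with
  | zero => exact ⟨0, zero_mem _⟩
  | add s t hs ht =>
    obtain ⟨m, hm⟩ := hs
    obtain ⟨n, hn⟩ := ht
    exact ⟨max m n, add_mem (filt_mono (le_max_left m n) hm) (filt_mono (le_max_right m n) hn)⟩
  | single Y a =>
    exact ⟨Multiset.card Y, Finsupp.single_mem_supported A a (le_refl (Multiset.card Y))⟩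

variable (k) (d : I → Multiset I → Mono A I)

/-- The `A`-linear extension of `d` in the first argument. -/
def extL (x : L) (Y : Multiset I) : Mono A I :=
  Finsupp.linearCombination A (fun i => d i Y) (e.repr x)

/-- The derivation-like extension of `d` to an operator on `Mono A I`. -/
def extD (x : L) : Module.End k (Mono A I) :=
  Finsupp.mapRange.linearMap (anchorEnd k A L x)
    + (Finsupp.linearCombination A (fun Y => extL e d x Y)).restrictScalars k

variable {k}

theorem extD_single (x : L) (Y : Multiset I) (a : A) :
    extD k e d x (Finsupp.single Y a) = Finsupp.single Y ⁅x, a⁆ + a • extL e d x Y := by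
  simp [extD]

theorem lie_one_eq_zero (x : L) : ⁅x, (1 : A)⁆ = 0 := by
  have h := LieRinehartRing.leibniz_mul_right x (1 : A) 1
  simpa using h

theorem extD_mono (x : L) (Y : Multiset I) : extD k e d x (mono A Y) = extL e d x Y := by
  rw [extD_single, lie_one_eq_zero]
  simp

theorem extD_basis_mono (i : I) (Y : Multiset I) : extD k e d (e i) (mono A Y) = d i Y := by
  simp [extD_mono, extL]

/-- The Leibniz rule of a connection. Together with linearity in `x` (`extD_smul_left`) it reduces
the later identities to basis elements and monomials. -/
theorem extD_smul (x : L) (a : A) (s : Mono A I) :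
    extD k e d x (a • s) = ⁅x, a⁆ • s + a • extD k e d x s := by
  induction s using Finsupp.induction_linear with
  | zero => simp
  | add s t hs ht => rw [smul_add, map_add, hs, ht, map_add]; simp only [smul_add]; abel
  | single Y b =>
    simp only [Finsupp.smul_single, extD_single, smul_eq_mul, LieRinehartRing.leibniz_mul_right,
      Finsupp.single_add, smul_add, mul_smul]
    abel

theorem extD_smul_left (a : A) (x : L) (s : Mono A I) :
    extD k e d (a • x) s = a • extD k e d x s := by
  induction s using Finsupp.induction_linear with
  | zero => simp
  | add s t hs ht => rw [map_add, hs, ht, map_add, smul_add]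
  | single Y b =>
    simp only [extD_single, LieRinehartRing.lie_smul_eq_mul, smul_add, extL, map_smul,
      Finsupp.smul_single, smul_eq_mul]
    rw [smul_comm]

theorem extD_add_left (x y : L) (s : Mono A I) :
    extD k e d (x + y) s = extD k e d x s + extD k e d y s := by
  induction s using Finsupp.induction_linear with
  | zero => simp
  | add s t hs ht => rw [map_add, hs, ht, map_add, map_add]; abel
  | single Y b =>
    simp only [extD_single, add_lie, smul_add, extL, map_add, Finsupp.single_add]
    abel

variable (k) in
/-- `extD` as a linear map in the first argument. -/
def extDLin : L →ₗ[k] Module.End k (Mono A I) where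
  toFun := extD k e d
  map_add' x y := LinearMap.ext fun s => extD_add_left e d x y s
  map_smul' r x := LinearMap.ext fun s => by
    rw [← algebraMap_smul A r x, extD_smul_left]
    simp

theorem extDLin_apply (x : L) : extDLin k e d x = extD k e d x := rfl

theorem extD_neg_left (x : L) (s : Mono A I) : extD k e d (-x) s = - extD k e d x s := by
  rw [← extDLin_apply, map_neg, LinearMap.neg_apply, extDLin_apply]

theorem extD_sub_left (x y : L) (s : Mono A I) :
    extD k e d (x - y) s = extD k e d x s - extD k e d y s := by
  rw [← extDLin_apply, map_sub, LinearMap.sub_apply, extDLin_apply, extDLin_apply]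

theorem extL_mem {W : Submodule A (Mono A I)} {Y : Multiset I} (h : ∀ i, d i Y ∈ W) (x : L) :
    extL e d x Y ∈ W := by
  rw [extL, Finsupp.linearCombination_apply]
  exact Submodule.sum_mem _ fun i _ => W.smul_mem _ (h i)

theorem extD_mem_filt {n : ℕ} (h : ∀ i Y, Multiset.card Y ≤ n → d i Y ∈ filt A I (n + 1)) (x : L)
    {s : Mono A I} (hs : s ∈ filt A I n) : extD k e d x s ∈ filt A I (n + 1) := by
  have key : s ∈ filt A I n ∧ extD k e d x s ∈ filt A I (n + 1) := by
    -- Membership of `s` is carried along because the Leibniz rule leaves a term `⁅x, a⁆ • s`.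
    refine filt_induction (p := fun s => s ∈ filt A I n ∧ extD k e d x s ∈ filt A I (n + 1))
      ?_ ?_ ?_ ?_ hs
    · simp
    · rintro s t ⟨hs, hs'⟩ ⟨ht, ht'⟩
      exact ⟨add_mem hs ht, by rw [map_add]; exact add_mem hs' ht'⟩
    · rintro a s ⟨hs, hs'⟩
      refine ⟨Submodule.smul_mem _ _ hs, ?_⟩
      rw [extD_smul]
      exact add_mem (Submodule.smul_mem _ _ (filt_mono (Nat.le_succ n) hs))
        (Submodule.smul_mem _ _ hs')
    · intro Y hY
      refine ⟨mono_mem_filt hY, ?_⟩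
      rw [extD_mono]
      exact extL_mem e d (fun i => h i Y hY) x
  exact key.2

/-- On degree at most `n` the operator sees only the values of `d` there; this is what makes a
recursion on the degree stabilise. -/
theorem extD_congr {d' : I → Multiset I → Mono A I} {n : ℕ}
    (h : ∀ i Y, Multiset.card Y ≤ n → d i Y = d' i Y) (x : L) {s : Mono A I}
    (hs : s ∈ filt A I n) : extD k e d x s = extD k e d' x s := by
  refine filt_induction (p := fun s => extD k e d x s = extD k e d' x s) ?_ ?_ ?_ ?_ hs
  · simp
  · intro s t hs ht
    rw [map_add, map_add, hs, ht]
  · intro a s hs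
    rw [extD_smul, extD_smul, hs]
  · intro Y hY
    rw [extD_mono, extD_mono, extL, extL]
    congr 2
    funext i
    exact h i Y hY

/-- Maps that agree on basis elements, in a tensorial argument, agree. -/
theorem basis_induction {p : L → Prop} (h0 : p 0) (hadd : ∀ x y, p x → p y → p (x + y))
    (hsmul : ∀ (a : A) x, p x → p (a • x)) (he : ∀ i, p (e i)) (x : L) : p x := by
  induction e.mem_span x using Submodule.span_induction with
  | mem x hx => obtain ⟨i, rfl⟩ := hx; exact he i
  | zero => exact h0
  | add x y _ _ hx hy => exact hadd x y hx hy
  | smul a x _ hx => exact hsmul a x hx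

end Monomials

/-! ### The module of monomials over the enveloping algebra of a free Lie-Rinehart algebra -/

section PBW

variable {k A L : Type u} [CommRing k] [CommRing A] [LieRing L] [Module A L]
  [LieRingModule L A] [LieRinehartRing A L] [Algebra k A] [LieAlgebra k L]
  [LieRinehartAlgebra k A L] {I : Type u} [DecidableEq I] (e : Module.Basis I A L)
  (w : ℕ → k)

/-- Approximations of the operators by which the basis elements act on monomials. -/
def pbwAux : ℕ → I → Multiset I → Mono A I
  | 0 => fun i Y => mono A (i ::ₘ Y)
  -- The formula is forced if a monomial `Y` of degree `m` is to stand for the symmetrised product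
  -- `S(Y)`, where `m S(Y) = ∑ e_j S(Z)` with `Z = Y - j`. Then `(m + 1) S(iY) = e_i S(Y) + ∑ e_j
  -- S(iZ)` and `m e_i S(Y) = ∑ ([e_i, e_j] + e_j e_i) S(Z)`. Adding these expresses `e_i S(Y)` as
  -- `S(iY)` plus `1 / (m + 1)` times the sum below, so `w m` will be `1 / (m + 1)`. The difference
  -- `e_i Z - iZ` has degree at most `m - 1`, so only smaller degrees are called.
  | n + 1 => fun i Y => mono A (i ::ₘ Y) + w (Multiset.card Y) • eraseSum Y fun j Z =>
      extD k e (pbwAux n) ⁅e i, e j⁆ (mono A Z)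
        + extD k e (pbwAux n) (e j) (pbwAux n i Z - mono A (i ::ₘ Z))

theorem card_erase_le {Y : Multiset I} {n : ℕ} {j : I} (hj : j ∈ Y)
    (h : Multiset.card Y ≤ n + 1) : Multiset.card (Y.erase j) ≤ n := by
  rw [Multiset.card_erase_of_mem hj]
  exact Nat.pred_le_pred h

theorem card_erase_succ {Y : Multiset I} {j : I} (hj : j ∈ Y) :
    Multiset.card (Y.erase j) + 1 = Multiset.card Y := Multiset.card_erase_add_one hj

/-- Each correction term applies a single operator, which raises degrees by at most one, to
something of degree below that of `Y`. So multiplication by `i` is the leading term of the action of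
`e_i`. -/
theorem pbwAux_sub_mem (n : ℕ) (i : I) (Y : Multiset I) :
    pbwAux e w n i Y - mono A (i ::ₘ Y) ∈ filt A I (Multiset.card Y) := by
  induction n generalizing i Y with
  | zero => simp [pbwAux]
  | succ n ih =>
    have hd : ∀ m i (Y : Multiset I), Multiset.card Y ≤ m →
        pbwAux e w n i Y ∈ filt A I (m + 1) := fun m i Y hY => by
      have h := add_mem (filt_mono (hY.trans (Nat.le_succ m)) (ih i Y))
        (mono_mem_filt (A := A) (I := I) (Y := i ::ₘ Y) (n := m + 1) (by simpa using hY))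
      simpa using h
    rw [pbwAux, add_sub_cancel_left]
    refine Submodule.smul_of_tower_mem _ _ (eraseSum_mem _ _ _ fun j hj => ?_)
    rw [← card_erase_succ hj]
    exact add_mem (extD_mem_filt e _ (hd _) _ (mono_mem_filt le_rfl))
      (extD_mem_filt e _ (hd _) _ (ih i _))

/-- The approximation with index `n` is exact in degrees at most `n`, since the recursion calls only
smaller degrees. -/
theorem pbwAux_stable (m n : ℕ) (i : I) (Y : Multiset I) (hm : Multiset.card Y ≤ m)
    (hn : Multiset.card Y ≤ n) : pbwAux e w m i Y = pbwAux e w n i Y := by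
  induction m generalizing n i Y with
  | zero =>
    obtain rfl : Y = 0 := Multiset.card_eq_zero.1 (Nat.le_zero.1 hm)
    cases n <;> simp [pbwAux, eraseSum_zero]
  | succ m ih =>
    cases n with
    | zero =>
      obtain rfl : Y = 0 := Multiset.card_eq_zero.1 (Nat.le_zero.1 hn)
      simp [pbwAux, eraseSum_zero]
    | succ n =>
      rw [pbwAux, pbwAux]
      refine congrArg (fun t => mono A (i ::ₘ Y) + w (Multiset.card Y) • t)
        (eraseSum_congr fun j hj => ?_)
      have h1 := card_erase_le hj hm
      have h2 := card_erase_le hj hn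
      have hc : ∀ i' Y', Multiset.card Y' ≤ Multiset.card (Y.erase j) →
          pbwAux e w m i' Y' = pbwAux e w n i' Y' := fun i' Y' hY' =>
        ih n i' Y' (hY'.trans h1) (hY'.trans h2)
      rw [hc i _ le_rfl, extD_congr e _ hc _ (mono_mem_filt le_rfl),
        extD_congr e _ hc _ (pbwAux_sub_mem e w n i _)]

/-- The action of a basis element on a monomial. -/
def pbwVal (i : I) (Y : Multiset I) : Mono A I := pbwAux e w (Multiset.card Y) i Y

/-- The action of `L` on the module of monomials. -/
abbrev pbwD (x : L) : Module.End k (Mono A I) := extD k e (pbwVal e w) x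

theorem pbwVal_sub_mem (i : I) (Y : Multiset I) :
    pbwVal e w i Y - mono A (i ::ₘ Y) ∈ filt A I (Multiset.card Y) := pbwAux_sub_mem e w _ i Y

variable {w} (hw : ∀ n : ℕ, w n * (n + 1) = 1)
include hw

theorem succ_nsmul_w_smul {E : Type*} [AddCommGroup E] [Module k E] (n : ℕ) (s : E) :
    (n + 1) • w n • s = s := by
  rw [← Nat.cast_smul_eq_nsmul k, smul_smul, Nat.cast_succ, mul_comm, hw, one_smul]

theorem nsmul_cancel {E : Type*} [AddCommGroup E] [Module k E] {n : ℕ} {s t : E}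
    (h : (n + 1) • s = (n + 1) • t) : s = t := by
  have h' := congrArg (w n • ·) h
  simp only [smul_comm (w n) (n + 1), succ_nsmul_w_smul hw] at h'
  exact h'

/-- By stability the approximations on the right are already the limit; clearing the denominator
removes `w` from the identity. -/
theorem pbwVal_rec (i : I) (Y : Multiset I) :
    (Multiset.card Y + 1) • pbwVal e w i Y = (Multiset.card Y + 1) • mono A (i ::ₘ Y)
      + eraseSum Y fun j Z => pbwD e w ⁅e i, e j⁆ (mono A Z)
        + pbwD e w (e j) (pbwVal e w i Z - mono A (i ::ₘ Z)) := by
  have h : pbwVal e w i Y = pbwAux e w (Multiset.card Y + 1) i Y :=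
    pbwAux_stable e w _ _ i Y le_rfl (Nat.le_succ _)
  rw [h, pbwAux, smul_add, succ_nsmul_w_smul hw]
  refine congrArg ((Multiset.card Y + 1) • mono A (i ::ₘ Y) + ·) (eraseSum_congr fun j hj => ?_)
  have hc : ∀ i' Y', Multiset.card Y' ≤ Multiset.card (Y.erase j) →
      pbwAux e w (Multiset.card Y) i' Y' = pbwVal e w i' Y' := fun i' Y' hY' =>
    pbwAux_stable e w _ _ i' Y' (hY'.trans (Multiset.card_le_card (Multiset.erase_le j Y))) le_rfl
  rw [extD_congr e _ hc _ (mono_mem_filt le_rfl), hc i _ le_rfl,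
    extD_congr e _ hc _ (pbwVal_sub_mem e w i _)]

/-- The monomial `Y` behaves as a symmetrised product. Multiplied by `n + 1`, the recursion leaves
two double sums over pairs from `Y`. The brackets cancel by antisymmetry; in the other sum, with the
two indices exchanged, `e_i` is applied to a difference that vanishes by induction. -/
theorem eraseSum_pbwVal (Y : Multiset I) :
    eraseSum Y (fun j Z => pbwVal e w j Z) = Multiset.card Y • mono A Y := by
  induction hn : Multiset.card Y generalizing Y with
  | zero =>
    obtain rfl := Multiset.card_eq_zero.1 hn
    simp [eraseSum_zero]
  | succ n ih =>
    have hc : ∀ j ∈ Y, Multiset.card (Y.erase j) = n := fun j hj => by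
      have := card_erase_succ hj
      omega
    have hcc : ∀ j ∈ Y, ∀ i ∈ Y.erase j, Multiset.card (Y.erase i) = n := fun j _ i hi =>
      hc i (Multiset.mem_of_mem_erase hi)
    refine nsmul_cancel hw (n := n) ?_
    have h1 : (n + 1) • eraseSum Y (fun j Z => pbwVal e w j Z)
        = eraseSum Y fun j Z => (n + 1) • mono A (j ::ₘ Z)
          + eraseSum Z fun i W => pbwD e w ⁅e j, e i⁆ (mono A W)
            + pbwD e w (e i) (pbwVal e w j W - mono A (j ::ₘ W)) := by
      refine (map_eraseSum (nsmulAddMonoidHom (α := Mono A I) (n + 1)) Y _).trans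
        (eraseSum_congr fun j hj => ?_)
      have h := pbwVal_rec e hw j (Y.erase j)
      rw [hc j hj] at h
      exact h
    have h2 : eraseSum Y (fun j Z => eraseSum Z fun i W => pbwD e w ⁅e j, e i⁆ (mono A W)) = 0 := by
      have h := eraseSum_comm Y fun j i W => pbwD e w ⁅e j, e i⁆ (mono A W)
      have h' : eraseSum Y (fun j Z => eraseSum Z fun i W => pbwD e w ⁅e i, e j⁆ (mono A W))
          = - eraseSum Y (fun j Z => eraseSum Z fun i W => pbwD e w ⁅e j, e i⁆ (mono A W)) := by
        rw [← eraseSum_neg]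
        simp only [← eraseSum_neg]
        refine eraseSum_congr fun j _ => eraseSum_congr fun i _ => ?_
        rw [← lie_skew, extD_neg_left]
      rw [h'] at h
      -- The sum equals its own negative, and `2` is invertible.
      refine nsmul_cancel hw (n := 1) ?_
      rw [smul_zero, two_nsmul]
      nth_rewrite 1 [h]
      exact neg_add_cancel _
    have h3 : eraseSum Y (fun j Z => eraseSum Z fun i W =>
        pbwD e w (e i) (pbwVal e w j W - mono A (j ::ₘ W))) = 0 := by
      rw [eraseSum_comm Y fun j i W => pbwD e w (e i) (pbwVal e w j W - mono A (j ::ₘ W))]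
      have : ∀ i ∈ Y, eraseSum (Y.erase i) (fun j W =>
          pbwD e w (e i) (pbwVal e w j W - mono A (j ::ₘ W))) = 0 := fun i hi => by
        refine (map_eraseSum (pbwD e w (e i)).toAddMonoidHom (Y.erase i)
          fun j W => pbwVal e w j W - mono A (j ::ₘ W)).symm.trans ?_
        rw [eraseSum_sub, ih _ (hc i hi),
          eraseSum_cons_erase _ fun W => mono A W, hc i hi, sub_self, map_zero]
      rw [eraseSum_congr (g := fun _ _ => 0) this, eraseSum_smul_const, smul_zero]
    rw [h1, eraseSum_add]
    simp only [eraseSum_add]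
    rw [h2, h3, eraseSum_cons_erase Y fun W => (n + 1) • mono A W, hn]
    simp

end PBW

/-! ### Flatness of the operators, and the resulting action of `V L` on the monomials. -/

section PBWFlat

variable {k A L : Type u} [CommRing k] [CommRing A] [LieRing L] [Module A L]
  [LieRingModule L A] [LieRinehartRing A L] [Algebra k A] [LieAlgebra k L]
  [LieRinehartAlgebra k A L] {I : Type u} [DecidableEq I] (e : Module.Basis I A L)
  (w : ℕ → k)

/-- The curvature of the operators by which `L` acts on the monomials. -/
def pbwCurv (x y : L) : Module.End k (Mono A I) :=
  pbwD e w x * pbwD e w y - pbwD e w y * pbwD e w x - pbwD e w ⁅x, y⁆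

theorem pbwCurv_apply (x y : L) (s : Mono A I) : pbwCurv e w x y s
    = pbwD e w x (pbwD e w y s) - pbwD e w y (pbwD e w x s) - pbwD e w ⁅x, y⁆ s := rfl

theorem pbwCurv_swap (x y : L) (s : Mono A I) : pbwCurv e w y x s = - pbwCurv e w x y s := by
  rw [pbwCurv_apply, pbwCurv_apply, ← lie_skew, extD_neg_left]
  abel

/-- Curvature is tensorial: the derivatives of `a` cancel by the Leibniz rule and because the anchor
is a morphism of Lie algebras. -/
theorem pbwCurv_smul (x y : L) (a : A) (s : Mono A I) :
    pbwCurv e w x y (a • s) = a • pbwCurv e w x y s := by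
  simp only [pbwCurv_apply, extD_smul, map_add, smul_sub, lie_lie, sub_smul]
  abel

theorem pbwCurv_smul_left (x y : L) (a : A) (s : Mono A I) :
    pbwCurv e w (a • x) y s = a • pbwCurv e w x y s := by
  have h : ⁅a • x, y⁆ = a • ⁅x, y⁆ - ⁅y, a⁆ • x := by
    rw [← lie_skew, LieRinehartRing.leibniz_smul_right, ← lie_skew x y]
    simp only [smul_neg]
    abel
  simp only [pbwCurv_apply, extD_smul_left, extD_smul, h, extD_sub_left, smul_sub]
  abel

theorem pbwCurv_add_left (x x' y : L) (s : Mono A I) :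
    pbwCurv e w (x + x') y s = pbwCurv e w x y s + pbwCurv e w x' y s := by
  simp only [pbwCurv_apply, extD_add_left, add_lie, map_add]
  abel

theorem pbwCurv_zero_left (y : L) (s : Mono A I) : pbwCurv e w 0 y s = 0 := by
  have h := pbwCurv_smul_left e w (0 : L) y (0 : A) s
  simpa using h

theorem pbwCurv_eq_zero_of_basis {n : ℕ}
    (h : ∀ i j Y, Multiset.card Y ≤ n → pbwCurv e w (e i) (e j) (mono A Y) = 0) (x y : L)
    {s : Mono A I} (hs : s ∈ filt A I n) : pbwCurv e w x y s = 0 := by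
  refine filt_induction (p := fun s => pbwCurv e w x y s = 0) (map_zero _) ?_ ?_ ?_ hs
  · intro s t hs ht; rw [map_add, hs, ht, add_zero]
  · intro a s hs; rw [pbwCurv_smul, hs, smul_zero]
  intro Y hY
  have h1 : ∀ i, pbwCurv e w (e i) y (mono A Y) = 0 := fun i => by
    rw [← neg_eq_zero, ← pbwCurv_swap]
    refine basis_induction e (p := fun y => pbwCurv e w y (e i) (mono A Y) = 0)
      (pbwCurv_zero_left e w _ _) ?_ ?_ (fun j => h j i Y hY) y
    · intro x y hx hy; rw [pbwCurv_add_left, hx, hy, add_zero]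
    · intro a x hx; rw [pbwCurv_smul_left, hx, smul_zero]
  refine basis_induction e (p := fun x => pbwCurv e w x y (mono A Y) = 0)
      (pbwCurv_zero_left e w _ _) ?_ ?_ h1 x
  · intro x y hx hy; rw [pbwCurv_add_left, hx, hy, add_zero]
  · intro a x hx; rw [pbwCurv_smul_left, hx, smul_zero]

/-- The Bianchi identity, where the curvature is known to vanish on `s`. -/
theorem pbwCurv_bianchi (x y z : L) (s : Mono A I) (h : ∀ x y, pbwCurv e w x y s = 0) :
    pbwCurv e w x y (pbwD e w z s) + pbwCurv e w y z (pbwD e w x s)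
      + pbwCurv e w z x (pbwD e w y s) = 0 := by
  have h' : ∀ x y, pbwD e w ⁅x, y⁆ s = pbwD e w x (pbwD e w y s) - pbwD e w y (pbwD e w x s) :=
    fun x y => (sub_eq_zero.1 (h x y)).symm
  have j : pbwD e w ⁅x, ⁅y, z⁆⁆ s + pbwD e w ⁅y, ⁅z, x⁆⁆ s + pbwD e w ⁅z, ⁅x, y⁆⁆ s = 0 := by
    rw [← extD_add_left, ← extD_add_left, lie_jacobi, ← extDLin_apply, map_zero,
      LinearMap.zero_apply]
  rw [h' x ⁅y, z⁆, h' y ⁅z, x⁆, h' z ⁅x, y⁆, h' y z, h' z x, h' x y] at j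
  simp only [map_sub] at j
  rw [← j]
  simp only [pbwCurv_apply]
  abel

variable {w} (hw : ∀ n : ℕ, w n * (n + 1) = 1)
include hw

/-- This is the recursion for `e_i` on `Z` in another form. The identity `eraseSum_pbwVal` for `i
::ₘ Z` eliminates the products, and for `Z` it turns `card Z` times `e_i Z` into the sum of the `e_i
e_j (Z - j)`. -/
theorem eraseSum_pbwCurv (i : I) (Z : Multiset I) :
    eraseSum Z (fun j W => pbwCurv e w (e i) (e j) (mono A W)) = 0 := by
  set n := Multiset.card Z with hn
  have hrec := pbwVal_rec e hw i Z
  have hnorm := eraseSum_pbwVal e hw (i ::ₘ Z)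
  rw [eraseSum_cons, Multiset.card_cons] at hnorm
  simp only [map_sub, extD_basis_mono] at hrec
  rw [eraseSum_add, eraseSum_sub, ← hn] at hrec
  rw [← hn] at hnorm
  have h1 : eraseSum Z (fun j W => pbwD e w (e i) (pbwVal e w j W)) = n • pbwVal e w i Z := by
    refine (map_eraseSum (pbwD e w (e i)).toAddMonoidHom Z fun j W => pbwVal e w j W).symm.trans ?_
    rw [eraseSum_pbwVal e hw, map_nsmul]
    exact congrArg (n • ·) (extD_basis_mono e _ i Z)
  simp only [pbwCurv_apply, extD_basis_mono]
  rw [eraseSum_sub, eraseSum_sub, h1]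
  rw [← hnorm, add_smul, one_smul] at hrec
  have : n • pbwVal e w i Z
      = eraseSum Z (fun j W => pbwD e w ⁅e i, e j⁆ (mono A W))
        + eraseSum Z (fun j W => pbwD e w (e j) (pbwVal e w i W)) := by
    have h2 := sub_eq_zero.2 hrec
    rw [← sub_eq_zero, ← h2]
    abel
  rw [this]
  abel

/-- Let `R` be the curvature, known to vanish in degrees below `n`. The Bianchi identity on `W = Y -
l`, summed over `l`, gives `n R(i,j) Y + ∑ R(j,l)(iW) - ∑ R(i,l)(jW) = 0`. By `eraseSum_pbwCurv` for
`iY` and for `jY`, the second and the third term are each equal to `R(i,j) Y`. Hence `(n + 2) R(i,j)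
Y = 0`. -/
theorem pbwCurv_mono (n : ℕ) : ∀ i j (Y : Multiset I), Multiset.card Y = n →
    pbwCurv e w (e i) (e j) (mono A Y) = 0 := by
  induction n using Nat.strong_induction_on with
  | _ n ih =>
  intro i j Y hY
  have hlow : ∀ m < n, ∀ x y, ∀ s ∈ filt A I m, pbwCurv e w x y s = 0 := fun m hm x y s hs =>
    pbwCurv_eq_zero_of_basis e w (fun i j Y hY => ih _ (lt_of_le_of_lt hY hm) i j Y rfl) x y hs
  -- Acting with a basis element differs from multiplying by it only in degrees below `n`, where the
  -- curvature vanishes.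
  have hcons : ∀ l ∈ Y, ∀ x y i', pbwCurv e w x y (pbwD e w (e i') (mono A (Y.erase l)))
      = pbwCurv e w x y (mono A (i' ::ₘ Y.erase l)) := fun l hl x y i' => by
    have h := card_erase_succ hl
    rw [← sub_eq_zero, ← map_sub, extD_basis_mono]
    exact hlow _ (by omega) x y _ (pbwVal_sub_mem e w i' _)
  have hcyc : eraseSum Y (fun l W => pbwCurv e w (e i) (e j) (mono A (l ::ₘ W))
      + pbwCurv e w (e j) (e l) (mono A (i ::ₘ W))
      - pbwCurv e w (e i) (e l) (mono A (j ::ₘ W))) = 0 := by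
    rw [eraseSum_congr (g := fun _ _ => 0), eraseSum_smul_const, smul_zero]
    intro l hl
    have h := card_erase_succ hl
    rw [← pbwCurv_bianchi e w (e i) (e j) (e l) (mono A (Y.erase l))
      (fun x y => hlow _ (by omega) x y _ (mono_mem_filt le_rfl)), hcons l hl, hcons l hl,
      hcons l hl, pbwCurv_swap e w (e i) (e l)]
    abel
  rw [eraseSum_sub, eraseSum_add,
    eraseSum_cons_erase Y fun W => pbwCurv e w (e i) (e j) (mono A W), hY] at hcyc
  have h1 := eraseSum_pbwCurv e hw i (j ::ₘ Y)
  have h2 := eraseSum_pbwCurv e hw j (i ::ₘ Y)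
  rw [eraseSum_cons] at h1 h2
  rw [pbwCurv_swap e w (e i) (e j)] at h2
  refine nsmul_cancel hw (n := n + 1) ?_
  rw [smul_zero, ← hcyc, add_smul, one_smul, add_smul, one_smul,
    eq_neg_of_add_eq_zero_right h1, eq_neg_of_add_eq_zero_right h2]
  abel

theorem pbwCurv_eq_zero (x y : L) (s : Mono A I) : pbwCurv e w x y s = 0 := by
  obtain ⟨n, hn⟩ := exists_mem_filt s
  exact pbwCurv_eq_zero_of_basis e w (fun i j Y _ => pbwCurv_mono e hw _ i j Y rfl) x y hn

/-- The action of the enveloping algebra on the module of monomials. -/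
def pbwAct : Env k A L →ₐ[k] Module.End k (Mono A I) :=
  Env.lift (B := Module.End k (Mono A I)) (Algebra.lsmul k k (Mono A I))
    (extDLin k e (pbwVal e w))
    (fun x y => LinearMap.ext fun s => (sub_eq_zero.1 (pbwCurv_eq_zero e hw x y s)).symm)
    (fun a x => LinearMap.ext fun s => extD_smul_left e _ a x s)
    (fun x a => LinearMap.ext fun s => by
      simp only [extDLin_apply, LinearMap.sub_apply, Module.End.mul_apply, Algebra.lsmul_coe]
      exact eq_sub_of_add_eq (extD_smul e _ x a s).symm)

theorem pbwAct_incA (a : A) (s : Mono A I) : pbwAct e hw (incA k A L a) s = a • s := by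
  simp [pbwAct]

theorem pbwAct_incL (x : L) (s : Mono A I) : pbwAct e hw (incL k A L x) s = pbwD e w x s := by
  simp [pbwAct, extDLin_apply]

end PBWFlat

/-! ### The enveloping algebra as a left module over `A` -/

section LeftModule

variable (k A L : Type u) [CommRing k] [CommRing A] [LieRing L] [Module A L]
  [LieRingModule L A] [Algebra k A] [LieAlgebra k L]

/-- `V L` as a left `A`-module. -/
abbrev Env.leftModule : Module A (Env k A L) := Module.compHom _ (incA k A L).toRingHom

end LeftModule

/-! ### Symmetrisation, and projectivity of `V L` over `A` for free `L`. -/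

section PBWProj

attribute [local instance] Env.leftModule

variable {k A L : Type u} [CommRing k] [CommRing A] [LieRing L] [Module A L]
  [LieRingModule L A] [LieRinehartRing A L] [Algebra k A] [LieAlgebra k L]
  [LieRinehartAlgebra k A L] {I : Type u} [DecidableEq I] (e : Module.Basis I A L)
  (w : ℕ → k)

theorem Env.smul_def (a : A) (v : Env k A L) : a • v = incA k A L a * v := rfl

/-- The symmetrized product of `n` basis elements in the enveloping algebra. -/
def symProdAux : ℕ → Multiset I → Env k A L
  | 0 => fun _ => 1
  | n + 1 => fun Y => w n • eraseSum Y fun j Z => incL k A L (e j) * symProdAux n Z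

/-- The symmetrized product of basis elements in the enveloping algebra. -/
def symProd (Y : Multiset I) : Env k A L := symProdAux e w (Multiset.card Y) Y

/-- The symmetrization map. -/
def symMap : Mono A I →ₗ[A] Env k A L := Finsupp.linearCombination A (symProd e w)

theorem symMap_mono (Y : Multiset I) : symMap e w (mono A Y) = symProd e w Y := by
  simp [symMap]

theorem symMap_of_basis {n : ℕ} (h : ∀ i (Y : Multiset I), Multiset.card Y ≤ n →
      symMap e w (pbwVal e w i Y) = incL k A L (e i) * symProd e w Y)
    (x : L) {s : Mono A I} (hs : s ∈ filt A I n) :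
    symMap e w (pbwD e w x s) = incL k A L x * symMap e w s := by
  refine filt_induction (p := fun s => symMap e w (pbwD e w x s) = incL k A L x * symMap e w s)
    (by simp) ?_ ?_ ?_ hs
  · intro s t hs ht; rw [map_add, map_add, hs, ht, map_add, mul_add]
  · intro a s hs
    rw [extD_smul, map_add, map_smul, map_smul, map_smul, hs, Env.smul_def, Env.smul_def,
      Env.smul_def, incA_lie]
    noncomm_ring
  intro Y hY
  refine basis_induction e (p := fun x => symMap e w (pbwD e w x (mono A Y))
    = incL k A L x * symMap e w (mono A Y)) ?_ ?_ ?_ ?_ x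
  · rw [pbwD, ← extDLin_apply]; simp
  · intro x y hx hy; rw [extD_add_left, map_add, hx, hy, map_add, add_mul]
  · intro a x hx; rw [extD_smul_left, map_smul, hx, incL_smul, Env.smul_def, mul_assoc]
  · intro i; rw [extD_basis_mono, symMap_mono, h i Y hY]

variable {w} (hw : ∀ n : ℕ, w n * (n + 1) = 1)
include hw

theorem symProd_rec (Y : Multiset I) : Multiset.card Y • symProd e w Y
    = eraseSum Y fun j Z => incL k A L (e j) * symProd e w Z := by
  rw [symProd]
  rcases hn : Multiset.card Y with _ | n
  · obtain rfl := Multiset.card_eq_zero.1 hn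
    simp [eraseSum_zero]
  · rw [symProdAux, succ_nsmul_w_smul hw]
    refine eraseSum_congr fun j hj => ?_
    have := card_erase_succ hj
    rw [symProd, show Multiset.card (Y.erase j) = n by omega]

/-- The symmetrised products in `V L` satisfy the very recursion that defines the action (by
`symProd_rec` for `Y` and for `i ::ₘ Y`), so the two agree by induction on the degree. -/
theorem symMap_pbwVal (n : ℕ) : ∀ i (Y : Multiset I), Multiset.card Y = n →
    symMap e w (pbwVal e w i Y) = incL k A L (e i) * symProd e w Y := by
  induction n using Nat.strong_induction_on with
  | _ n ih =>
  intro i Y hY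
  have hlow : ∀ m < n, ∀ x, ∀ s ∈ filt A I m,
      symMap e w (pbwD e w x s) = incL k A L x * symMap e w s := fun m hm x s hs =>
    symMap_of_basis e w (fun i Y hY => ih _ (lt_of_le_of_lt hY hm) i Y rfl) x hs
  have h := congrArg (symMap e w) (pbwVal_rec e hw i Y)
  have hs : symMap e w (eraseSum Y fun j Z => pbwD e w ⁅e i, e j⁆ (mono A Z)
        + pbwD e w (e j) (pbwVal e w i Z - mono A (i ::ₘ Z)))
      = eraseSum Y fun j Z => incL k A L (e i) * (incL k A L (e j) * symProd e w Z)
        - incL k A L (e j) * symProd e w (i ::ₘ Z) := by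
    refine (map_eraseSum (symMap e w).toAddMonoidHom Y _).trans (eraseSum_congr fun j hj => ?_)
    have hc := card_erase_succ hj
    have e1 := hlow _ (by omega) ⁅e i, e j⁆ _ (mono_mem_filt (A := A) (Y := Y.erase j) le_rfl)
    have e2 := hlow _ (by omega) (e j) _ (pbwVal_sub_mem e w i (Y.erase j))
    refine (map_add (symMap e w) _ _).trans ?_
    rw [e1, e2, map_sub, ih _ (by omega) i _ rfl, symMap_mono, symMap_mono, incL_lie]
    noncomm_ring
  have h2 := symProd_rec e hw (i ::ₘ Y)
  rw [eraseSum_cons, Multiset.card_cons] at h2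
  have h3 : eraseSum Y (fun j Z => incL k A L (e i) * (incL k A L (e j) * symProd e w Z))
      = Multiset.card Y • (incL k A L (e i) * symProd e w Y) := by
    refine (map_eraseSum (AddMonoidHom.mulLeft (incL k A L (e i))) Y
      fun j Z => incL k A L (e j) * symProd e w Z).symm.trans ?_
    rw [← symProd_rec e hw, map_nsmul]
    rfl
  rw [map_add, map_nsmul, map_nsmul, hs, eraseSum_sub, h3, symMap_mono, h2] at h
  refine nsmul_cancel hw (n := Multiset.card Y) ?_
  rw [h, add_smul, one_smul]
  abel

theorem symMap_pbwD (x : L) (s : Mono A I) :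
    symMap e w (pbwD e w x s) = incL k A L x * symMap e w s := by
  obtain ⟨n, hn⟩ := exists_mem_filt s
  exact symMap_of_basis e w (fun i Y _ => symMap_pbwVal e hw _ i Y rfl) x hn

theorem symMap_pbwAct (v : Env k A L) (s : Mono A I) :
    symMap e w (pbwAct e hw v s) = v * symMap e w s := by
  induction v using Env.induction generalizing s with
  | hA a => rw [pbwAct_incA, map_smul, Env.smul_def]
  | hL x => rw [pbwAct_incL, symMap_pbwD e hw]
  | hadd g h hg hh => rw [map_add, LinearMap.add_apply, map_add, hg, hh, add_mul]
  | hmul g h hg hh => rw [map_mul, Module.End.mul_apply, hg, hh, mul_assoc]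

include e in
/-- The enveloping algebra of a free Lie-Rinehart algebra is projective over `A`. -/
theorem Env.projective_of_basis : Module.Projective A (Env k A L) := by
  let θ : Env k A L →ₗ[A] Mono A I :=
    { toFun := fun v => pbwAct e hw v (mono A 0)
      map_add' := fun v v' => by rw [map_add, LinearMap.add_apply]
      map_smul' := fun a v => by
        rw [Env.smul_def, map_mul, Module.End.mul_apply, pbwAct_incA, RingHom.id_apply] }
  -- `θ v` is `v` acting on the empty monomial. Symmetrisation is `V L`-linear and takes the empty
  -- monomial to `1`, so it takes `θ v` back to `v`. Injectivity of symmetrisation plays no role.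
  refine Module.Projective.of_split θ (symMap e w) (LinearMap.ext fun v => ?_)
  have h0 : symMap e w (mono A 0) = (1 : Env k A L) := by
    rw [symMap_mono]
    rfl
  exact (symMap_pbwAct e hw v (mono A 0)).trans (by rw [h0, mul_one]; rfl)

end PBWProj

/-! ### Extension of a projective Lie-Rinehart algebra to a free one -/

section Extension

/-- The semidirect product of `L` with the free module on `J`, on which `L` acts coordinatewise. -/
def FlatExt (A L J : Type u) [CommRing A] : Type u := L × (J →₀ A)

variable {k A L J : Type u} [CommRing k] [CommRing A] [LieRing L] [Module A L]
  [LieRingModule L A] [Algebra k A] [LieAlgebra k L]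

instance : AddCommGroup (FlatExt A L J) := inferInstanceAs (AddCommGroup (L × (J →₀ A)))

instance : Module A (FlatExt A L J) := inferInstanceAs (Module A (L × (J →₀ A)))

instance : Module k (FlatExt A L J) := inferInstanceAs (Module k (L × (J →₀ A)))

theorem FlatExt.ext' {z z' : FlatExt A L J} (h1 : z.1 = z'.1) (h2 : ∀ j, z.2 j = z'.2 j) :
    z = z' := Prod.ext h1 (Finsupp.ext h2)

theorem FlatExt.add_fst (z z' : FlatExt A L J) : (z + z').1 = z.1 + z'.1 := rfl
theorem FlatExt.add_snd (z z' : FlatExt A L J) (j : J) : (z + z').2 j = z.2 j + z'.2 j := rfl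
theorem FlatExt.zero_fst : (0 : FlatExt A L J).1 = 0 := rfl
theorem FlatExt.zero_snd (j : J) : (0 : FlatExt A L J).2 j = 0 := rfl
theorem FlatExt.smul_fst (a : A) (z : FlatExt A L J) : (a • z).1 = a • z.1 := rfl
theorem FlatExt.smul_snd (a : A) (z : FlatExt A L J) (j : J) : (a • z).2 j = a * z.2 j := rfl
theorem FlatExt.smul_fst' (r : k) (z : FlatExt A L J) : (r • z).1 = r • z.1 := rfl
theorem FlatExt.smul_snd' (r : k) (z : FlatExt A L J) (j : J) : (r • z).2 j = r • z.2 j := rfl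

instance : Bracket (FlatExt A L J) (FlatExt A L J) where
  bracket z z' := (⁅z.1, z'.1⁆,
    z'.2.mapRange (fun a => ⁅z.1, a⁆) (lie_zero _) - z.2.mapRange (fun a => ⁅z'.1, a⁆) (lie_zero _))

theorem FlatExt.lie_fst (z z' : FlatExt A L J) : ⁅z, z'⁆.1 = ⁅z.1, z'.1⁆ := rfl
theorem FlatExt.lie_snd (z z' : FlatExt A L J) (j : J) :
    ⁅z, z'⁆.2 j = ⁅z.1, z'.2 j⁆ - ⁅z'.1, z.2 j⁆ := rfl

instance : LieRing (FlatExt A L J) where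
  add_lie x y z := FlatExt.ext' (by simp [FlatExt.lie_fst, FlatExt.add_fst]) fun j => by
    simp only [FlatExt.lie_snd, FlatExt.add_snd, FlatExt.add_fst, add_lie, lie_add]
    abel
  lie_add x y z := FlatExt.ext' (by simp [FlatExt.lie_fst, FlatExt.add_fst]) fun j => by
    simp only [FlatExt.lie_snd, FlatExt.add_snd, FlatExt.add_fst, add_lie, lie_add]
    abel
  lie_self x := FlatExt.ext' (by simp [FlatExt.lie_fst, FlatExt.zero_fst]) fun j => by
    simp [FlatExt.lie_snd, FlatExt.zero_snd]
  leibniz_lie x y z := FlatExt.ext'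
    (by simp only [FlatExt.lie_fst, FlatExt.add_fst]; exact leibniz_lie _ _ _) fun j => by
    simp only [FlatExt.lie_snd, FlatExt.lie_fst, FlatExt.add_snd, lie_sub, lie_lie]
    abel

instance : Bracket (FlatExt A L J) A where
  bracket z a := ⁅z.1, a⁆

theorem FlatExt.lie_def (z : FlatExt A L J) (a : A) : ⁅z, a⁆ = ⁅z.1, a⁆ := rfl

instance : LieRingModule (FlatExt A L J) A where
  add_lie x y a := add_lie x.1 y.1 a
  lie_add x a b := lie_add x.1 a b
  leibniz_lie x y a := leibniz_lie x.1 y.1 a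

variable [LieRinehartRing A L] [LieRinehartAlgebra k A L]

instance : LieAlgebra k (FlatExt A L J) where
  lie_smul r x y := FlatExt.ext' (by simp [FlatExt.lie_fst, FlatExt.smul_fst']) fun j => by
    have h : ⁅x.1, r • y.2 j⁆ = r • ⁅x.1, y.2 j⁆ := lie_smul r x.1 (y.2 j)
    simp only [FlatExt.lie_snd, FlatExt.smul_fst', FlatExt.smul_snd', h, smul_lie, smul_sub]

instance : LieRinehartRing A (FlatExt A L J) where
  lie_smul_eq_mul' a b x := LieRinehartRing.lie_smul_eq_mul a b x.1
  leibniz_mul_right' x a b := LieRinehartRing.leibniz_mul_right x.1 a b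
  leibniz_smul_right' x y a := FlatExt.ext'
    (by simp [FlatExt.lie_fst, FlatExt.smul_fst, FlatExt.add_fst, FlatExt.lie_def]) fun j => by
    simp only [FlatExt.lie_snd, FlatExt.smul_fst, FlatExt.smul_snd, FlatExt.add_snd,
      FlatExt.lie_def, LieRinehartRing.leibniz_mul_right, LieRinehartRing.lie_smul_eq_mul,
      smul_eq_mul]
    ring

instance : LieRinehartAlgebra k A (FlatExt A L J) where
  smul_assoc r a x := FlatExt.ext' (smul_assoc r a x.1) fun j => smul_assoc r a (x.2 j)
  smul_lie r x a := smul_lie r x.1 a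
  lie_smul r x a := lie_smul r x.1 a

variable (k A L J) in
/-- The inclusion of `L`. -/
def FlatExt.inl : L →ₗ[k] FlatExt A L J where
  toFun x := (x, 0)
  map_add' _ _ := FlatExt.ext' rfl fun _ => (add_zero (0 : A)).symm
  map_smul' r _ := FlatExt.ext' rfl fun _ => (smul_zero (A := A) r).symm

variable (k A L J) in
/-- The projection to `L`. -/
def FlatExt.fst : FlatExt A L J →ₗ[k] L where
  toFun x := x.1
  map_add' _ _ := rfl
  map_smul' _ _ := rfl

attribute [local instance] Env.leftModule

/-- If `V` of the extension is projective over `A`, then so is `V L`. -/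
theorem Env.projective_of_flatExt (h : Module.Projective A (Env k A (FlatExt A L J))) :
    Module.Projective A (Env k A L) := by
  let i : Env k A L →ₐ[k] Env k A (FlatExt A L J) :=
    Env.lift (incA k A _)
      (incL k A _ ∘ₗ FlatExt.inl k A L J)
      (fun x y => by
        rw [LinearMap.comp_apply, LinearMap.comp_apply, LinearMap.comp_apply, ← incL_lie]
        exact congrArg _ (FlatExt.ext' rfl fun j => by
          rw [FlatExt.lie_snd]
          change (0 : A) = ⁅x, (0 : A)⁆ - ⁅y, (0 : A)⁆
          simp))
      (fun a x => by
        rw [LinearMap.comp_apply, LinearMap.comp_apply, ← incL_smul]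
        exact congrArg _ (FlatExt.ext' rfl fun j =>
          (mul_zero a).symm))
      (fun x a => by
        rw [LinearMap.comp_apply, ← incA_lie]
        rfl)
  let p : Env k A (FlatExt A L J) →ₐ[k] Env k A L :=
    Env.lift (incA k A _)
      (incL k A _ ∘ₗ FlatExt.fst k A L J)
      (fun x y => by
        rw [LinearMap.comp_apply, LinearMap.comp_apply, LinearMap.comp_apply, ← incL_lie]
        rfl)
      (fun a x => by
        rw [LinearMap.comp_apply, LinearMap.comp_apply, ← incL_smul]
        rfl)
      (fun x a => by
        rw [LinearMap.comp_apply, ← incA_lie]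
        rfl)
  -- `L → L ⊕ A^(J) → L` consists of morphisms of Lie-Rinehart algebras over `A` and composes to the
  -- identity; the inclusion respects brackets because `L` acts coordinatewise, so that no second
  -- component arises.
  have hpi : p.comp i = AlgHom.id k _ := Env.hom_ext (fun a => by simp [p, i]) fun x => by
    simp only [p, i, AlgHom.comp_apply, Env.lift_incL, LinearMap.comp_apply]
    rfl
  refine Module.Projective.of_split
    (⟨i.toLinearMap.toAddHom, fun a v => ?_⟩ : Env k A L →ₗ[A] Env k A (FlatExt A L J))
    (⟨p.toLinearMap.toAddHom, fun a v => ?_⟩ : Env k A (FlatExt A L J) →ₗ[A] Env k A L)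
    (LinearMap.ext fun v => AlgHom.congr_fun hpi v)
  · exact (map_mul i (incA k A L a) v).trans (by rw [Env.lift_incA]; rfl)
  · exact (map_mul p (incA k A _ a) v).trans (by rw [Env.lift_incA]; rfl)

end Extension

/-! ### Eilenberg's trick -/

section Swindle

variable {A L : Type u} [CommRing A] [AddCommGroup L] [Module A L]

/-- Finitely supported functions with values in a product. -/
def finsuppProdLEquiv (A I M N : Type*) [CommRing A] [AddCommGroup M] [Module A M]
    [AddCommGroup N] [Module A N] : (I →₀ M × N) ≃ₗ[A] ((I →₀ M) × (I →₀ N)) :=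
  LinearEquiv.ofLinearMap
    ((Finsupp.mapRange.linearMap (LinearMap.fst A M N)).prod
      (Finsupp.mapRange.linearMap (LinearMap.snd A M N)))
    ((Finsupp.mapRange.linearMap (LinearMap.inl A M N)).coprod
      (Finsupp.mapRange.linearMap (LinearMap.inr A M N)))
    (LinearMap.ext fun f => Prod.ext (Finsupp.ext fun i => by simp) (Finsupp.ext fun i => by simp))
    (LinearMap.ext fun f => Finsupp.ext fun i => by simp)

/-- Adding a large free module to a projective module gives a free module. -/
theorem exists_free_prod [Module.Projective A L] :
    ∃ J : Type u, Module.Free A (L × (J →₀ A)) := by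
  obtain ⟨s, hs⟩ := Module.projective_def'.1 ‹Module.Projective A L›
  set π : (L →₀ A) →ₗ[A] L := Finsupp.linearCombination A id
  -- The splitting `s` writes the free module on the set `L` as `L ⊕ K`, with `K` the kernel of `π`.
  have eK : (L →₀ A) ≃ₗ[A] (L × LinearMap.ker π) := by
    refine LinearEquiv.ofBijective
      (π.prod (LinearMap.codRestrict (LinearMap.ker π) (LinearMap.id - s ∘ₗ π) fun f => ?_))
      ⟨?_, ?_⟩
    · have := LinearMap.congr_fun hs (π f)
      simp only [LinearMap.comp_apply, LinearMap.id_apply] at this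
      simp [this]
    · refine (injective_iff_map_eq_zero _).2 fun f hf => ?_
      have h1 : π f = 0 := congrArg Prod.fst hf
      have h2 : f - s (π f) = 0 := congrArg (fun z => (z.2 : L →₀ A)) hf
      rwa [h1, map_zero, sub_zero] at h2
    · rintro ⟨x, ⟨f, hf⟩⟩
      have h1 : π (s x) = x := LinearMap.congr_fun hs x
      have h2 : π f = 0 := hf
      refine ⟨s x + f, Prod.ext ?_ (Subtype.ext ?_)⟩
      · simp [h1, h2]
      · simp [h1, h2]
  -- Countably many copies of `L` absorb one more.
  have e1 : (L × (ℕ →₀ L)) ≃ₗ[A] (ℕ →₀ L) :=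
    ((Finsupp.uniqueLinearEquiv A L ()).symm.prodCongr (LinearEquiv.refl A _)).trans
      ((Finsupp.sumFinsuppLEquivProdFinsupp A).symm.trans
        (Finsupp.domLCongr ((Equiv.sumComm Unit ℕ).trans Equiv.natSumPUnitEquivNat)))
  have e2 : (ℕ →₀ (L →₀ A)) ≃ₗ[A] ((ℕ →₀ L) × (ℕ →₀ LinearMap.ker π)) :=
    (Finsupp.mapRange.linearEquiv eK).trans (finsuppProdLEquiv A ℕ L (LinearMap.ker π))
  -- The swindle: `L ⊕ (L ⊕ K)^(ℕ) ≅ (L ⊕ L^(ℕ)) ⊕ K^(ℕ) ≅ L^(ℕ) ⊕ K^(ℕ) ≅ (L ⊕ K)^(ℕ)`.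
  have e3 : (L × (ℕ →₀ (L →₀ A))) ≃ₗ[A] (ℕ →₀ (L →₀ A)) :=
    ((LinearEquiv.refl A L).prodCongr e2).trans ((LinearEquiv.prodAssoc A _ _ _).symm.trans
      ((e1.prodCongr (LinearEquiv.refl A _)).trans e2.symm))
  have e4 : (ℕ →₀ (L →₀ A)) ≃ₗ[A] (ℕ × L →₀ A) := (Finsupp.curryLinearEquiv A).symm
  have e5 : (L × (ℕ × L →₀ A)) ≃ₗ[A] (ℕ × L →₀ A) :=
    ((LinearEquiv.refl A L).prodCongr e4.symm).trans (e3.trans e4)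
  exact ⟨ℕ × L, Module.Free.of_equiv e5.symm⟩

end Swindle

/-! ### Projectivity of `V L` over `A` for projective `L`. -/

section Projective

attribute [local instance] Env.leftModule

variable {k A L : Type u} [CommRing k] [CommRing A] [LieRing L] [Module A L]
  [LieRingModule L A] [LieRinehartRing A L] [Algebra k A] [LieAlgebra k L]
  [LieRinehartAlgebra k A L]

/-- The enveloping algebra of a projective Lie-Rinehart algebra over a `ℚ`-algebra is projective
over `A`. -/
theorem Env.projective [Algebra ℚ k] [Module.Projective A L] :
    Module.Projective A (Env k A L) := by
  classical
  obtain ⟨J, hJ⟩ := exists_free_prod (A := A) (L := L)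
  have hfree : Module.Free A (FlatExt A L J) := hJ
  refine Env.projective_of_flatExt (J := J)
    (Env.projective_of_basis (Module.Free.chooseBasis A (FlatExt A L J))
      (w := fun n => algebraMap ℚ k (1 / (n + 1))) fun n => ?_)
  have h : ((n : k) + 1) = algebraMap ℚ k (n + 1) := by simp
  rw [h, ← map_mul, one_div_mul_cancel (by positivity), map_one]

end Projective

/-! ### Linear maps between modules over the enveloping algebra -/

section VLin

variable {k A L : Type u} [CommRing k] [CommRing A] [LieRing L] [Module A L]
  [LieRingModule L A] [LieRinehartRing A L] [Algebra k A] [LieAlgebra k L]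
  [LieRinehartAlgebra k A L]

/-- Linearity over the enveloping algebra. -/
def IsVLin (M N : LMod k (Env k A L)) (f : M.carrier →ₗ[k] N.carrier) : Prop :=
  ∀ (h : Env k A L) (m : M.carrier), f (M.act h m) = N.act h (f m)

variable {P Q M N : LMod k (Env k A L)}

theorem IsVLin.of_gen {f : M.carrier →ₗ[k] N.carrier}
    (hA : ∀ (a : A) m, f (M.actA a m) = N.actA a (f m))
    (hL : ∀ (x : L) m, f (M.actL x m) = N.actL x (f m)) : IsVLin M N f := fun h => by
  induction h using Env.induction with
  | hA a => exact hA a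
  | hL x => exact hL x
  | hadd g h hg hh => intro m; simp [hg, hh]
  | hmul g h hg hh => intro m; simp [hg, hh]

theorem IsVLin.actA {f : M.carrier →ₗ[k] N.carrier} (hf : IsVLin M N f) (a : A)
    (m : M.carrier) : f (M.actA a m) = N.actA a (f m) := hf _ m

theorem IsVLin.actL {f : M.carrier →ₗ[k] N.carrier} (hf : IsVLin M N f) (x : L)
    (m : M.carrier) : f (M.actL x m) = N.actL x (f m) := hf _ m

/-- A linear map over the enveloping algebra as a linear map over `A`. -/
def IsVLin.toAHom {f : M.carrier →ₗ[k] N.carrier} (hf : IsVLin M N f) : AHom M N := ⟨f, hf.actA⟩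

theorem IsVLin.id : IsVLin M M LinearMap.id := fun _ _ => rfl

theorem IsVLin.comp {g : N.carrier →ₗ[k] P.carrier} {f : M.carrier →ₗ[k] N.carrier}
    (hg : IsVLin N P g) (hf : IsVLin M N f) : IsVLin M P (g ∘ₗ f) := fun h m => by
  rw [LinearMap.comp_apply, hf, hg, LinearMap.comp_apply]

theorem IsVLin.zero : IsVLin M N 0 := fun h m => by simp

theorem IsVLin.smul {f : M.carrier →ₗ[k] N.carrier} (r : k) (hf : IsVLin M N f) :
    IsVLin M N (r • f) := fun h m => by
  rw [LinearMap.smul_apply, hf, LinearMap.smul_apply, map_smul]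

theorem IsVLin.neg {f : M.carrier →ₗ[k] N.carrier} (hf : IsVLin M N f) :
    IsVLin M N (-f) := fun h m => by
  rw [LinearMap.neg_apply, hf, LinearMap.neg_apply, map_neg]

theorem IsVLin.sub {f g : M.carrier →ₗ[k] N.carrier} (hf : IsVLin M N f) (hg : IsVLin M N g) :
    IsVLin M N (f - g) := fun h m => by
  rw [LinearMap.sub_apply, hf, hg, LinearMap.sub_apply, map_sub]

theorem IsVLin.sum {ι : Type*} (s : Finset ι) {f : ι → M.carrier →ₗ[k] N.carrier}
    (hf : ∀ i ∈ s, IsVLin M N (f i)) : IsVLin M N (∑ i ∈ s, f i) := fun h m => by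
  rw [LinearMap.sum_apply, LinearMap.sum_apply, map_sum]
  exact Finset.sum_congr rfl fun i hi => hf i hi h m

theorem IsVLin.pow {f : Module.End k M.carrier} (hf : IsVLin M M f) (n : ℕ) :
    IsVLin M M (f ^ n) := by
  induction n with
  | zero => exact IsVLin.id
  | succ n ih => rw [pow_succ]; exact ih.comp hf

/-- The inverse of a bijective linear map over the enveloping algebra. -/
theorem IsVLin.symm {f : M.carrier ≃ₗ[k] N.carrier} (hf : IsVLin M N f.toLinearMap) :
    IsVLin N M f.symm.toLinearMap := fun h m => by
  refine f.injective ?_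
  have := hf h (f.symm m)
  simp only [LinearEquiv.coe_coe, LinearEquiv.apply_symm_apply] at this ⊢
  exact this.symm

theorem indMod_act_mk (M : LMod k (Env k A L)) (g h : Env k A L) (m : M.carrier) :
    (indMod M).act g (Bal.mk h m) = (Bal.mk (g * h) m : IndTensor M) := indMul_mk M g h m

theorem diagMod_actL_mk (M N : LMod k (Env k A L)) (x : L) (m : M.carrier) (n : N.carrier) :
    (diagMod M N).actL x (Bal.mk m n)
      = (Bal.mk (M.actL x m) n + Bal.mk m (N.actL x n) : DiagTensor M N) :=
  diagAct_incL M N x m n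

theorem isVLin_multLin (M : LMod k (Env k A L)) : IsVLin (indMod M) M (multLin M) := fun g z => by
  induction z using Bal.induction with
  | hmk h m => rw [indMod_act_mk, multLin_mk, multLin_mk, map_mul]; rfl
  | hadd y z hy hz => rw [map_add, map_add, hy, hz, map_add, map_add]

theorem isVLin_indLin (f : AHom M N) : IsVLin (indMod M) (indMod N) (indLin f) := fun g z => by
  induction z using Bal.induction with
  | hmk h m =>
    rw [indMod_act_mk, indLin_mk, indLin_mk]
    exact (indMod_act_mk N g h _).symm
  | hadd y z hy hz => rw [map_add, map_add, hy, hz, map_add, map_add]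

/-- The elements `1 ⊗ m` generate the induced module over `V L`. Most identities on the bar complex
are checked on them only. -/
theorem indMod_ext {f g : IndTensor M →ₗ[k] N.carrier} (hf : IsVLin (indMod M) N f)
    (hg : IsVLin (indMod M) N g) (h : ∀ m, f (Bal.mk 1 m) = g (Bal.mk 1 m)) : f = g :=
  Bal.hom_ext fun v m => by
    have e : (Bal.mk v m : IndTensor M) = (indMod M).act v (Bal.mk 1 m) := by
      rw [indMod_act_mk, mul_one]
    rw [e, hf, hg, h]

theorem IsVLin.of_diag {f : DiagTensor M P →ₗ[k] N.carrier}
    (hA : ∀ (a : A) m p, f (Bal.mk (M.actA a m) p) = N.actA a (f (Bal.mk m p)))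
    (hL : ∀ (x : L) m p, f (Bal.mk (M.actL x m) p) + f (Bal.mk m (P.actL x p))
      = N.actL x (f (Bal.mk m p))) : IsVLin (diagMod M P) N f := by
  refine IsVLin.of_gen (fun a z => ?_) (fun x z => ?_)
  · induction z using Bal.induction with
    | hmk m p => rw [diagMod_actA_mk, hA]
    | hadd y z hy hz => rw [map_add, map_add, hy, hz, map_add, map_add]
  · induction z using Bal.induction with
    | hmk m p => rw [diagMod_actL_mk, map_add, hL]
    | hadd y z hy hz => rw [map_add, map_add, hy, hz, map_add, map_add]

/-- `id ⊗ f : P ⊗_A M → P ⊗_A N`. -/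
def diagLinR (P : LMod k (Env k A L)) (f : AHom M N) : DiagTensor P M →ₗ[k] DiagTensor P N :=
  Bal.map _root_.id LinearMap.id f.1 (fun _ _ => rfl) f.2

theorem diagLinR_mk (P : LMod k (Env k A L)) (f : AHom M N) (p : P.carrier) (m : M.carrier) :
    diagLinR P f (Bal.mk p m) = Bal.mk p (f.1 m) :=
  Bal.map_mk _root_.id LinearMap.id f.1 (fun _ _ => rfl) f.2 p m

theorem isVLin_diagLinR (P : LMod k (Env k A L)) {f : M.carrier →ₗ[k] N.carrier}
    (hf : IsVLin M N f) : IsVLin (diagMod P M) (diagMod P N) (diagLinR P hf.toAHom) := by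
  refine IsVLin.of_diag (fun a p m => ?_) fun x p m => ?_
  · rw [diagLinR_mk, diagLinR_mk]
    exact (diagMod_actA_mk P N a _ _).symm
  · rw [diagLinR_mk, diagLinR_mk, diagLinR_mk]
    exact (congrArg (fun t => Bal.mk (P.actL x p) (f m) + Bal.mk p t) (hf.actL x m)).trans
      (diagMod_actL_mk P N x _ _).symm

/-- `m ↦ p ⊗ m`. -/
def insertL (M : LMod k (Env k A L)) (p : P.carrier) : AHom M (diagMod P M) :=
  ⟨Bal.mkBilin P.actA M.actA p, fun a m => by
    rw [Bal.mkBilin_apply, Bal.mkBilin_apply, diagMod_actA_mk, Bal.mk_rel]⟩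

variable (P Q M) in
/-- The bilinear map underlying `p ⊗ (q ⊗ m) ↦ q ⊗ (p ⊗ m)`. -/
def swapBilin : P.carrier →ₗ[k] DiagTensor Q M →ₗ[k] DiagTensor Q (diagMod P M) where
  toFun p := diagLinR Q (insertL M p)
  map_add' p p' := Bal.hom_ext fun q m => by
    rw [LinearMap.add_apply, diagLinR_mk, diagLinR_mk, diagLinR_mk, ← Bal.mk_add_right]
    exact congrArg (Bal.mk q) (Bal.mk_add_left p p' m)
  map_smul' r p := Bal.hom_ext fun q m => by
    rw [RingHom.id_apply, LinearMap.smul_apply, diagLinR_mk, diagLinR_mk, ← Bal.mk_smul_right]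
    exact congrArg (Bal.mk q) (Bal.mk_smul_left r p m)

theorem swapBilin_apply (p : P.carrier) (q : Q.carrier) (m : M.carrier) :
    swapBilin P Q M p (Bal.mk q m) = Bal.mk q (Bal.mk p m : DiagTensor P M) :=
  diagLinR_mk Q (insertL M p) q m

theorem swapBilin_balanced (a : A) (p : P.carrier) (z : DiagTensor Q M) :
    swapBilin P Q M (P.actA a p) z = swapBilin P Q M p ((diagMod Q M).actA a z) := by
  induction z using Bal.induction with
  | hmk q m =>
    rw [diagMod_actA_mk, swapBilin_apply, swapBilin_apply, ← diagMod_actA_mk]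
    exact (Bal.mk_rel (β := (diagMod P M).actA) a q _).symm
  | hadd y z hy hz => rw [map_add, map_add, hy, hz, map_add]

variable (P Q M) in
/-- The symmetry `p ⊗ (q ⊗ m) ↦ q ⊗ (p ⊗ m)`. -/
def diagSwap : DiagTensor P (diagMod Q M) →ₗ[k] DiagTensor Q (diagMod P M) :=
  Bal.lift (swapBilin P Q M) swapBilin_balanced

theorem diagSwap_mk (p : P.carrier) (q : Q.carrier) (m : M.carrier) :
    diagSwap P Q M (Bal.mk p (Bal.mk q m : DiagTensor Q M))
      = Bal.mk q (Bal.mk p m : DiagTensor P M) :=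
  (Bal.lift_mk (β := (diagMod Q M).actA) (swapBilin P Q M) swapBilin_balanced p _).trans
    (swapBilin_apply p q m)

theorem diag_hom_ext₂ {E : Type*} [AddCommGroup E] [Module k E]
    {f g : DiagTensor P (diagMod Q M) →ₗ[k] E}
    (h : ∀ p q m, f (Bal.mk p (Bal.mk q m : DiagTensor Q M)) = g (Bal.mk p (Bal.mk q m : DiagTensor Q M))) :
    f = g := Bal.hom_ext fun p z => by
  induction z using Bal.induction with
  | hmk q m => exact h p q m
  | hadd y z hy hz => rw [Bal.mk_add_right, map_add, map_add, hy, hz]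

/-- Cocommutativity of the left coproduct: `L` acts on a tensor product as a derivation, whatever
the order of the factors. This is why the cyclic operator of the tensor powers is linear over `V L`.
-/
theorem isVLin_diagSwap :
    IsVLin (diagMod P (diagMod Q M)) (diagMod Q (diagMod P M)) (diagSwap P Q M) := by
  refine IsVLin.of_diag (fun a p z => ?_) fun x p z => ?_
  · induction z using Bal.induction with
    | hmk q m =>
      rw [diagSwap_mk, diagSwap_mk, diagMod_actA_mk, Bal.mk_rel a q, diagMod_actA_mk]
    | hadd y z hy hz => rw [Bal.mk_add_right, Bal.mk_add_right, map_add, map_add, hy, hz, map_add]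
  · induction z using Bal.induction with
    | hmk q m =>
      rw [diagSwap_mk, diagSwap_mk, diagMod_actL_mk, diagMod_actL_mk, diagMod_actL_mk,
        Bal.mk_add_right, Bal.mk_add_right, map_add, diagSwap_mk, diagSwap_mk]
      abel
    | hadd y z hy hz =>
      rw [map_add, Bal.mk_add_right, Bal.mk_add_right, Bal.mk_add_right, map_add, map_add,
        map_add, map_add, ← hy, ← hz]
      abel

end VLin

/-! ### The tensor powers of the enveloping algebra as a cyclic object -/

section SymTensor

variable (k A L : Type u) [CommRing k] [CommRing A] [LieRing L] [Module A L]
  [LieRingModule L A] [LieRinehartRing A L] [Algebra k A] [LieAlgebra k L]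
  [LieRinehartAlgebra k A L]

variable {k A L}

theorem epsL_incA_mul (a : A) (v : Env k A L) :
    epsL k A L (incA k A L a * v) = a * epsL k A L v := by
  simp [epsL]

theorem epsL_incL_mul (x : L) (v : Env k A L) :
    epsL k A L (incL k A L x * v) = ⁅x, epsL k A L v⁆ := by
  simp [epsL]

theorem epsL_one : epsL k A L 1 = 1 := by simp [epsL]

variable (k A L) in
/-- The left counit as a linear map. -/
def epsLLin : Env k A L →ₗ[k] A := LinearMap.applyₗ (1 : A) ∘ₗ (anchorAct k A L).toLinearMap

/-- `v ⊗ m ↦ ε_l(v) m`. -/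
def diagCounit (M : LMod k (Env k A L)) : DiagTensor (regMod k A L) M →ₗ[k] M.carrier :=
  Bal.lift (M.act.toLinearMap ∘ₗ (incA k A L).toLinearMap ∘ₗ epsLLin k A L) fun a v m => by
    change M.actA (epsL k A L (incA k A L a * v)) m = M.actA (epsL k A L v) (M.actA a m)
    rw [epsL_incA_mul, mul_comm, LMod.actA_mul]

theorem diagCounit_mk (M : LMod k (Env k A L)) (v : Env k A L) (m : M.carrier) :
    diagCounit M (Bal.mk v m) = M.actA (epsL k A L v) m :=
  Bal.lift_mk (α := (regMod k A L).actA) _ _ v m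

/-- `ε_l : V L → A` is a map of left modules, and `A` is the unit of the diagonal tensor product. -/
theorem isVLin_diagCounit (M : LMod k (Env k A L)) :
    IsVLin (diagMod (regMod k A L) M) M (diagCounit M) := by
  refine IsVLin.of_diag (fun a v m => ?_) fun x v m => ?_
  · rw [diagCounit_mk, diagCounit_mk, ← LMod.actA_mul, ← epsL_incA_mul]
    rfl
  · rw [diagCounit_mk, diagCounit_mk, diagCounit_mk, LMod.actL_actA, ← epsL_incL_mul, add_comm]
    rfl

variable (k A L) in
/-- The tensor powers `V L ⊗_A ⋯ ⊗_A V L` for the left actions of `A`, with the diagonal action. -/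
def symTensor : ℕ → LMod k (Env k A L)
  | 0 => baseMod k A L
  | n + 1 => diagMod (regMod k A L) (symTensor n)

variable (k A L) in
/-- The underlying `k`-module of the tensor power. -/
abbrev SymT (n : ℕ) : Type u := (symTensor k A L n).carrier

/-- The element `v ⊗ z`. -/
def SymT.tmul {n : ℕ} (v : Env k A L) (z : SymT k A L n) : SymT k A L (n + 1) :=
  Bal.mk (α := (regMod k A L).actA) (β := (symTensor k A L n).actA) v z

theorem SymT.hom_ext {n : ℕ} {E : Type*} [AddCommGroup E] [Module k E]
    {f g : SymT k A L (n + 1) →ₗ[k] E} (h : ∀ v z, f (SymT.tmul v z) = g (SymT.tmul v z)) :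
    f = g := Bal.hom_ext h

theorem SymT.hom_ext₂ {n : ℕ} {E : Type*} [AddCommGroup E] [Module k E]
    {f g : SymT k A L (n + 2) →ₗ[k] E}
    (h : ∀ v v' z, f (SymT.tmul v (SymT.tmul v' z)) = g (SymT.tmul v (SymT.tmul v' z))) :
    f = g := diag_hom_ext₂ h

/-- `v ⊗ z ↦ v ⊗ f z`. -/
def SymT.map {m n : ℕ} (f : SymT k A L m →ₗ[k] SymT k A L n)
    (hf : IsVLin (symTensor k A L m) (symTensor k A L n) f) :
    SymT k A L (m + 1) →ₗ[k] SymT k A L (n + 1) :=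
  diagLinR (regMod k A L) hf.toAHom

theorem SymT.map_tmul {m n : ℕ} (f : SymT k A L m →ₗ[k] SymT k A L n)
    (hf : IsVLin (symTensor k A L m) (symTensor k A L n) f) (v : Env k A L) (z : SymT k A L m) :
    SymT.map f hf (SymT.tmul v z) = SymT.tmul v (f z) := diagLinR_mk (regMod k A L) hf.toAHom v z

theorem SymT.isVLin_map {m n : ℕ} {f : SymT k A L m →ₗ[k] SymT k A L n}
    (hf : IsVLin (symTensor k A L m) (symTensor k A L n) f) :
    IsVLin (symTensor k A L (m + 1)) (symTensor k A L (n + 1)) (SymT.map f hf) :=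
  isVLin_diagLinR (regMod k A L) hf

theorem SymT.tmul_add {n : ℕ} (v : Env k A L) (z z' : SymT k A L n) :
    SymT.tmul v (z + z') = SymT.tmul v z + SymT.tmul v z' := Bal.mk_add_right v z z'

theorem SymT.tmul_smul {n : ℕ} (v : Env k A L) (r : k) (z : SymT k A L n) :
    SymT.tmul v (r • z) = r • SymT.tmul v z := Bal.mk_smul_right r v z

theorem SymT.tmul_zero {n : ℕ} (v : Env k A L) : SymT.tmul v (0 : SymT k A L n) = 0 := by
  have := SymT.tmul_smul v (0 : k) (0 : SymT k A L n)
  rwa [zero_smul, zero_smul] at this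

theorem SymT.actA_tmul {n : ℕ} (a : A) (v : Env k A L) (z : SymT k A L n) :
    (symTensor k A L (n + 1)).actA a (SymT.tmul v z) = SymT.tmul (incA k A L a * v) z :=
  diagMod_actA_mk (regMod k A L) (symTensor k A L n) a v z

theorem SymT.tmul_actA {n : ℕ} (a : A) (v : Env k A L) (z : SymT k A L n) :
    SymT.tmul v ((symTensor k A L n).actA a z) = (symTensor k A L (n + 1)).actA a (SymT.tmul v z) :=
  (Bal.mk_rel (α := (regMod k A L).actA) a v z).symm.trans (SymT.actA_tmul a v z).symm

theorem SymT.actL_tmul {n : ℕ} (x : L) (v : Env k A L) (z : SymT k A L n) :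
    (symTensor k A L (n + 1)).actL x (SymT.tmul v z)
      = SymT.tmul (incL k A L x * v) z + SymT.tmul v ((symTensor k A L n).actL x z) :=
  diagMod_actL_mk (regMod k A L) (symTensor k A L n) x v z

variable (k A L) in
/-- The faces, bundled with their linearity. -/
def symFaceAux : (n i : ℕ) → {f : SymT k A L (n + 1) →ₗ[k] SymT k A L n //
    IsVLin (symTensor k A L (n + 1)) (symTensor k A L n) f}
  | n, 0 => ⟨diagCounit (symTensor k A L n), isVLin_diagCounit _⟩
  -- Indices beyond the last face yield zero, so that sums of faces may run too far without harm.
  | 0, _ + 1 => ⟨0, IsVLin.zero⟩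
  | n + 1, i + 1 => ⟨SymT.map (symFaceAux n i).1 (symFaceAux n i).2, SymT.isVLin_map _⟩

variable (k A L) in
/-- The face `v_0 ⊗ ⋯ ⊗ v_n ↦ ε_l(v_i) v_0 ⊗ ⋯ ⊗ v_{i-1} ⊗ v_{i+1} ⊗ ⋯ ⊗ v_n`, for `i ≤ n`. -/
def symFace (n i : ℕ) : SymT k A L (n + 1) →ₗ[k] SymT k A L n := (symFaceAux k A L n i).1

theorem isVLin_symFace (n i : ℕ) :
    IsVLin (symTensor k A L (n + 1)) (symTensor k A L n) (symFace k A L n i) :=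
  (symFaceAux k A L n i).2

theorem symFace_zero {n : ℕ} (v : Env k A L) (z : SymT k A L n) :
    symFace k A L n 0 (SymT.tmul v z) = (symTensor k A L n).actA (epsL k A L v) z := by
  cases n <;> exact diagCounit_mk _ v z

theorem symFace_succ {n i : ℕ} (v : Env k A L) (z : SymT k A L (n + 1)) :
    symFace k A L (n + 1) (i + 1) (SymT.tmul v z) = SymT.tmul v (symFace k A L n i z) :=
  SymT.map_tmul (symFace k A L n i) (isVLin_symFace n i) v z

variable (k A L) in
/-- The exchange of the first two factors. -/
def symSwap (n : ℕ) : SymT k A L (n + 2) →ₗ[k] SymT k A L (n + 2) :=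
  diagSwap (regMod k A L) (regMod k A L) (symTensor k A L n)

theorem isVLin_symSwap (n : ℕ) :
    IsVLin (symTensor k A L (n + 2)) (symTensor k A L (n + 2)) (symSwap k A L n) :=
  isVLin_diagSwap

theorem symSwap_tmul {n : ℕ} (v v' : Env k A L) (z : SymT k A L n) :
    symSwap k A L n (SymT.tmul v (SymT.tmul v' z)) = SymT.tmul v' (SymT.tmul v z) :=
  diagSwap_mk _ _ _

variable (k A L) in
/-- The rotation, bundled with its linearity. -/
def symRotAux : (n : ℕ) → {f : SymT k A L n →ₗ[k] SymT k A L n //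
    IsVLin (symTensor k A L n) (symTensor k A L n) f}
  | 0 => ⟨LinearMap.id, IsVLin.id⟩
  | 1 => ⟨LinearMap.id, IsVLin.id⟩
  -- Rotate the tail, then exchange its new first factor with the head.
  | n + 2 => ⟨symSwap k A L n ∘ₗ SymT.map (symRotAux (n + 1)).1 (symRotAux (n + 1)).2,
      (isVLin_symSwap n).comp (SymT.isVLin_map _)⟩

variable (k A L) in
/-- The rotation `v_1 ⊗ ⋯ ⊗ v_n ↦ v_n ⊗ v_1 ⊗ ⋯ ⊗ v_{n-1}`. -/
def symRot (n : ℕ) : Module.End k (SymT k A L n) := (symRotAux k A L n).1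

theorem isVLin_symRot (n : ℕ) :
    IsVLin (symTensor k A L n) (symTensor k A L n) (symRot k A L n) := (symRotAux k A L n).2

theorem symRot_one : symRot k A L 1 = LinearMap.id := rfl

theorem symRot_tmul {n : ℕ} (v : Env k A L) (z : SymT k A L (n + 1)) :
    symRot k A L (n + 2) (SymT.tmul v z)
      = symSwap k A L n (SymT.tmul v (symRot k A L (n + 1) z)) :=
  congrArg (symSwap k A L n) (SymT.map_tmul (symRot k A L (n + 1)) (isVLin_symRot (n + 1)) v z)

end SymTensor

/-! ### The relations of a cyclic object -/

section CyclicRelations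

variable {k : Type*} [CommRing k] {E : ℕ → Type*} [∀ n, AddCommGroup (E n)] [∀ n, Module k (E n)]
  (f : ∀ n : ℕ, ℕ → E (n + 1) →ₗ[k] E n) (lam : ∀ n, Module.End k (E n))

/-- The sum of the first `m` signed faces. -/
def faceSum (n m : ℕ) : E (n + 1) →ₗ[k] E n := ∑ i ∈ Finset.range m, f n i

/-- The norm operator. -/
def normOp (n : ℕ) : Module.End k (E n) := ∑ j ∈ Finset.range (n + 1), lam n ^ j

variable {f lam} (h0 : ∀ n, f n 0 ∘ₗ lam (n + 1) = f n (n + 1))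
  (h1 : ∀ n i, i ≤ n → f n (i + 1) ∘ₗ lam (n + 1) = lam n ∘ₗ f n i)
  (hp : ∀ n, lam n ^ (n + 1) = 1)

include hp in
theorem normOp_mul_lam (n : ℕ) : normOp lam n * lam n = normOp lam n := by
  rw [← sub_eq_zero, ← mul_sub_one, normOp, geom_sum_mul, hp, sub_self]

include hp in
theorem lam_mul_normOp (n : ℕ) : lam n * normOp lam n = normOp lam n := by
  rw [← sub_eq_zero, ← sub_one_mul, normOp, mul_geom_sum, hp, sub_self]

-- Composing with `λ` shifts the faces: `b λ = d_{n+1} + λ b'`, while `b = b' + d_{n+1}`.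
include h0 h1 in
theorem faceSum_one_sub (n : ℕ) : faceSum f n (n + 2) ∘ₗ (1 - lam (n + 1))
    = (1 - lam n) ∘ₗ faceSum f n (n + 1) := by
  have h2 : faceSum f n (n + 2) ∘ₗ lam (n + 1)
      = f n (n + 1) + lam n ∘ₗ faceSum f n (n + 1) := by
    rw [faceSum, Finset.sum_range_succ', LinearMap.add_comp, h0, add_comm (LinearMap.comp _ _)]
    congr 1
    ext z
    simp only [faceSum, LinearMap.comp_apply, LinearMap.sum_apply, map_sum]
    exact Finset.sum_congr rfl fun i hi =>
      LinearMap.congr_fun (h1 n i (Nat.lt_succ_iff.1 (Finset.mem_range.1 hi))) z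
  have h3 : faceSum f n (n + 2) = faceSum f n (n + 1) + f n (n + 1) := Finset.sum_range_succ _ _
  rw [LinearMap.comp_sub, LinearMap.sub_comp, h2, Module.End.one_eq_id, LinearMap.comp_id,
    Module.End.one_eq_id, LinearMap.id_comp, h3]
  abel

include h1 in
theorem face_comp_pow (n i : ℕ) (hi : i ≤ n + 1) :
    f n i ∘ₗ (lam (n + 1) ^ i) = (lam n ^ i) ∘ₗ f n 0 := by
  induction i with
  | zero => rfl
  | succ i ih =>
    rw [pow_succ', pow_succ', Module.End.mul_eq_comp, ← LinearMap.comp_assoc,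
      h1 n i (by omega), LinearMap.comp_assoc, ih (by omega)]
    rfl

theorem pow_mul_normOp (hp : ∀ n, lam n ^ (n + 1) = 1) (n j : ℕ) :
    lam n ^ j * normOp lam n = normOp lam n := by
  induction j with
  | zero => simp
  | succ j ih => rw [pow_succ, mul_assoc, lam_mul_normOp hp, ih]

theorem normOp_mul_pow (hp : ∀ n, lam n ^ (n + 1) = 1) (n j : ℕ) :
    normOp lam n * lam n ^ j = normOp lam n := by
  induction j with
  | zero => simp
  | succ j ih => rw [pow_succ', ← mul_assoc, normOp_mul_lam hp, ih]

-- Both sides equal `N d_0 N`. Since `d_i = λ^i d_0 λ^{-i}`, the norm already present absorbs the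
-- power next to it, and the powers on the other side of `d_0` add up to the other norm.
include h1 hp in
theorem faceSum_normOp (n : ℕ) : faceSum f n (n + 1) ∘ₗ normOp lam (n + 1)
    = normOp lam n ∘ₗ faceSum f n (n + 2) := by
  have e1 : ∀ i ≤ n + 1, f n i ∘ₗ normOp lam (n + 1)
      = (lam n ^ i) ∘ₗ f n 0 ∘ₗ normOp lam (n + 1) := fun i hi => by
    rw [← LinearMap.comp_assoc, ← face_comp_pow h1 n i hi, LinearMap.comp_assoc,
      ← Module.End.mul_eq_comp, pow_mul_normOp hp]
  have e2 : faceSum f n (n + 1) ∘ₗ normOp lam (n + 1)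
      = normOp lam n ∘ₗ f n 0 ∘ₗ normOp lam (n + 1) := by
    ext z
    simp only [faceSum, LinearMap.comp_apply, LinearMap.sum_apply]
    nth_rewrite 2 [normOp]
    rw [LinearMap.sum_apply]
    exact Finset.sum_congr rfl fun i hi =>
      LinearMap.congr_fun (e1 i (Finset.mem_range.1 hi).le) z
  have e3 : ∀ i ≤ n + 1, normOp lam n ∘ₗ f n i
      = normOp lam n ∘ₗ f n 0 ∘ₗ (lam (n + 1) ^ (n + 2 - i)) := fun i hi => by
    have e : f n i = (lam n ^ i) ∘ₗ f n 0 ∘ₗ (lam (n + 1) ^ (n + 2 - i)) := by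
      rw [← LinearMap.comp_assoc, ← face_comp_pow h1 n i hi, LinearMap.comp_assoc,
        ← Module.End.mul_eq_comp, ← pow_add, Nat.add_sub_cancel' (by omega), hp]
      rfl
    nth_rewrite 1 [e]
    rw [← LinearMap.comp_assoc, ← Module.End.mul_eq_comp, normOp_mul_pow hp]
  -- The exponents `n + 2 - i` run through a full period, because the power of `λ` with exponent `n
  -- + 2` is the identity here.
  have e4 : normOp lam (n + 1) = ∑ i ∈ Finset.range (n + 2), lam (n + 1) ^ (n + 2 - i) := by
    rw [← lam_mul_normOp hp (n + 1), normOp, Finset.mul_sum,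
      ← Finset.sum_range_reflect]
    refine Finset.sum_congr rfl fun i hi => ?_
    have := Finset.mem_range.1 hi
    rw [← pow_succ']
    congr 1
    omega
  rw [e2, e4]
  ext z
  simp only [faceSum, LinearMap.comp_apply, LinearMap.sum_apply, map_sum]
  exact Finset.sum_congr rfl fun i hi =>
    (LinearMap.congr_fun (e3 i (Nat.lt_succ_iff.1 (Finset.mem_range.1 hi))) z).symm

end CyclicRelations

/-! ### The relations for the tensor powers -/

section SymRelations

variable {k A L : Type u} [CommRing k] [CommRing A] [LieRing L] [Module A L]
  [LieRingModule L A] [LieRinehartRing A L] [Algebra k A] [LieAlgebra k L]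
  [LieRinehartAlgebra k A L]

theorem symFace_zero_symSwap {n : ℕ} (y : SymT k A L (n + 2)) :
    symFace k A L (n + 1) 0 (symSwap k A L n y) = symFace k A L (n + 1) 1 y := by
  refine LinearMap.congr_fun (f := symFace k A L (n + 1) 0 ∘ₗ symSwap k A L n)
    (SymT.hom_ext₂ fun v v' z => ?_) y
  rw [LinearMap.comp_apply, symSwap_tmul, symFace_zero, symFace_succ, symFace_zero,
    SymT.tmul_actA]

theorem symFace_one_symSwap {n : ℕ} (y : SymT k A L (n + 2)) :
    symFace k A L (n + 1) 1 (symSwap k A L n y) = symFace k A L (n + 1) 0 y := by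
  refine LinearMap.congr_fun (f := symFace k A L (n + 1) 1 ∘ₗ symSwap k A L n)
    (SymT.hom_ext₂ fun v v' z => ?_) y
  rw [LinearMap.comp_apply, symSwap_tmul, symFace_zero, symFace_succ, symFace_zero,
    SymT.tmul_actA]

theorem symFace_symSwap {n i : ℕ} (y : SymT k A L (n + 3)) :
    symFace k A L (n + 2) (i + 2) (symSwap k A L (n + 1) y)
      = symSwap k A L n (symFace k A L (n + 2) (i + 2) y) := by
  refine LinearMap.congr_fun (f := symFace k A L (n + 2) (i + 2) ∘ₗ symSwap k A L (n + 1))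
    (g := symSwap k A L n ∘ₗ symFace k A L (n + 2) (i + 2)) (SymT.hom_ext₂ fun v v' z => ?_) y
  rw [LinearMap.comp_apply, LinearMap.comp_apply, symSwap_tmul, symFace_succ, symFace_succ,
    symFace_succ, symFace_succ, symSwap_tmul]

theorem symFace_zero_symRot (n : ℕ) (z : SymT k A L (n + 1)) :
    symFace k A L n 0 (symRot k A L (n + 1) z) = symFace k A L n n z := by
  induction n with
  | zero => rfl
  | succ n ih =>
    refine LinearMap.congr_fun (f := symFace k A L (n + 1) 0 ∘ₗ symRot k A L (n + 2))
      (SymT.hom_ext fun v z => ?_) z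
    rw [LinearMap.comp_apply, symRot_tmul, symFace_zero_symSwap, symFace_succ, ih, symFace_succ]

theorem symFace_succ_symRot (n i : ℕ) (hi : i + 1 ≤ n) (z : SymT k A L (n + 1)) :
    symFace k A L n (i + 1) (symRot k A L (n + 1) z) = symRot k A L n (symFace k A L n i z) := by
  induction n generalizing i with
  | zero => omega
  | succ n ih =>
    refine LinearMap.congr_fun (f := symFace k A L (n + 1) (i + 1) ∘ₗ symRot k A L (n + 2))
      (g := symRot k A L (n + 1) ∘ₗ symFace k A L (n + 1) i) (SymT.hom_ext fun v z => ?_) z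
    rw [LinearMap.comp_apply, LinearMap.comp_apply, symRot_tmul]
    cases i with
    | zero =>
      rw [symFace_one_symSwap, symFace_zero, symFace_zero, (isVLin_symRot _).actA]
    | succ i =>
      obtain ⟨n, rfl⟩ : ∃ m, n = m + 1 := ⟨n - 1, by omega⟩
      rw [symFace_symSwap, symFace_succ, ih i (by omega), symFace_succ, symRot_tmul]

/-- Pure tensors. -/
def pureT : {n : ℕ} → (Fin n → Env k A L) → SymT k A L n
  | 0, _ => (1 : A)
  | _ + 1, v => SymT.tmul (v 0) (pureT (Fin.tail v))

theorem pureT_span (n : ℕ) (z : SymT k A L n) :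
    z ∈ Submodule.span k {z | ∃ a v, z = (symTensor k A L n).actA a (pureT v)} := by
  induction n with
  | zero =>
    refine Submodule.subset_span ⟨z, Fin.elim0, ?_⟩
    exact ((anchorAct_incA k A L (z : A) (1 : A)).trans (mul_one _)).symm
  | succ n ih =>
    induction z using Bal.induction with
    | hmk v z =>
      change SymT.tmul v z ∈ _
      refine Submodule.span_induction (p := fun z _ => SymT.tmul v z ∈ Submodule.span k
        {z | ∃ a v, z = (symTensor k A L (n + 1)).actA a (pureT v)}) ?_ ?_ ?_ ?_ (ih z)
      · rintro _ ⟨a, w, rfl⟩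
        refine Submodule.subset_span ⟨a, Fin.cons v w, ?_⟩
        rw [SymT.tmul_actA]
        rfl
      · rw [SymT.tmul_zero]; exact zero_mem _
      · intro x y _ _ hx hy; rw [SymT.tmul_add]; exact add_mem hx hy
      · intro r x _ hx; rw [SymT.tmul_smul]; exact Submodule.smul_mem _ _ hx
    | hadd y z hy hz => exact add_mem hy hz

theorem pureT_ext {n : ℕ} {f g : Module.End k (SymT k A L n)}
    (hf : IsVLin (symTensor k A L n) (symTensor k A L n) f)
    (hg : IsVLin (symTensor k A L n) (symTensor k A L n) g)
    (h : ∀ v, f (pureT v) = g (pureT v)) : f = g := by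
  refine LinearMap.ext_on (s := {z | ∃ a v, z = (symTensor k A L n).actA a (pureT v)})
    (eq_top_iff.2 fun z _ => pureT_span n z) ?_
  rintro _ ⟨a, v, rfl⟩
  rw [hf.actA, hg.actA, h]

theorem symRot_pureT (n : ℕ) (v : Fin (n + 1) → Env k A L) :
    symRot k A L (n + 1) (pureT v) = pureT (Fin.cons (v (Fin.last n)) (Fin.init v)) := by
  induction n with
  | zero =>
    rw [symRot_one, LinearMap.id_apply]
    congr 1
    funext i
    obtain rfl := Fin.fin_one_eq_zero i
    rfl
  | succ n ih =>
    rw [pureT, symRot_tmul, ih]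
    exact symSwap_tmul _ _ _

theorem symRot_pureT' (n : ℕ) (v : Fin (n + 1) → Env k A L) :
    symRot k A L (n + 1) (pureT v) = pureT (v ∘ (finRotate (n + 1)).symm) := by
  rw [symRot_pureT]
  congr 1
  funext i
  obtain ⟨j, rfl⟩ := (finRotate (n + 1)).surjective i
  have h := congrFun (Fin.snoc_eq_cons_rotate (α := Env k A L) (Fin.init v) (v (Fin.last n))) j
  rw [Function.comp_apply, Equiv.symm_apply_apply, ← h, Fin.snoc_init_self]

theorem finRotate_pow_self (n : ℕ) : finRotate (n + 1) ^ (n + 1) = 1 := by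
  have h : ∀ (m : ℕ) (i : Fin (n + 1)), (finRotate (n + 1) ^ m) i = i + m • (1 : Fin (n + 1)) := fun m => by
    induction m with
    | zero => intro i; simp
    | succ m ih =>
      intro i
      rw [pow_succ', Equiv.Perm.mul_apply, ih, finRotate_apply, succ_nsmul, add_assoc]
  refine Equiv.ext fun i => ?_
  have h0 : (n + 1) • (1 : Fin (n + 1)) = 0 := by
    simpa using card_nsmul_eq_zero (x := (1 : Fin (n + 1)))
  rw [h, h0, add_zero, Equiv.Perm.one_apply]

/-- On pure tensors the operator is a cyclic permutation of the `n + 1` factors, and pure tensors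
generate over `A`. -/
theorem symRot_pow (n : ℕ) : symRot k A L (n + 1) ^ (n + 1) = 1 := by
  refine pureT_ext ((isVLin_symRot _).pow _) IsVLin.id fun v => ?_
  have h : ∀ m, (symRot k A L (n + 1) ^ m) (pureT v)
      = pureT (v ∘ ((finRotate (n + 1))⁻¹ ^ m : Equiv.Perm (Fin (n + 1)))) := fun m => by
    induction m with
    | zero => rfl
    | succ m ih =>
      rw [pow_succ', Module.End.mul_apply, ih, symRot_pureT', pow_succ]
      rfl
  rw [h, inv_pow, finRotate_pow_self]
  rfl

variable (k A L)

/-- The signed faces of the cyclic object `n ↦ V L^{⊗ (n + 1)}`. -/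
def symSFace (n i : ℕ) : SymT k A L (n + 2) →ₗ[k] SymT k A L (n + 1) :=
  (-1 : k) ^ i • symFace k A L (n + 1) i

/-- The signed rotation of the cyclic object `n ↦ V L^{⊗ (n + 1)}`. -/
def symLam (n : ℕ) : Module.End k (SymT k A L (n + 1)) := (-1 : k) ^ n • symRot k A L (n + 1)

variable {k A L}

theorem symSFace_zero_symLam (n : ℕ) :
    symSFace k A L n 0 ∘ₗ symLam k A L (n + 1) = symSFace k A L n (n + 1) := by
  ext z
  simp [symSFace, symLam, symFace_zero_symRot]

theorem symSFace_succ_symLam (n i : ℕ) (hi : i ≤ n) :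
    symSFace k A L n (i + 1) ∘ₗ symLam k A L (n + 1) = symLam k A L n ∘ₗ symSFace k A L n i := by
  ext z
  simp only [symSFace, symLam, LinearMap.comp_apply, LinearMap.smul_apply, map_smul,
    symFace_succ_symRot (n + 1) i (by omega), smul_smul]
  congr 1
  ring

theorem symLam_pow (n : ℕ) : symLam k A L n ^ (n + 1) = 1 := by
  rw [symLam, smul_pow, symRot_pow, ← pow_mul, Even.neg_one_pow (Nat.even_mul_succ_self n),
    one_smul]

theorem isVLin_symSFace (n i : ℕ) :
    IsVLin (symTensor k A L (n + 2)) (symTensor k A L (n + 1)) (symSFace k A L n i) :=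
  (isVLin_symFace _ _).smul _

theorem isVLin_symLam (n : ℕ) :
    IsVLin (symTensor k A L (n + 1)) (symTensor k A L (n + 1)) (symLam k A L n) :=
  (isVLin_symRot _).smul _

/-- Only the first face touches `v`. The others act on the tail with their index lowered by one,
whence the sign. -/
theorem altFace_tmul (n m : ℕ) (v : Env k A L) (z : SymT k A L (n + 1)) :
    (∑ i ∈ Finset.range (m + 1), (-1 : k) ^ i • symFace k A L (n + 1) i) (SymT.tmul v z)
      = (symTensor k A L (n + 1)).actA (epsL k A L v) z
        - SymT.tmul v ((∑ i ∈ Finset.range m, (-1 : k) ^ i • symFace k A L n i) z) := by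
  have h : ∀ s : Finset ℕ, SymT.tmul v ((∑ i ∈ s, (-1 : k) ^ i • symFace k A L n i) z)
      = ∑ i ∈ s, (-1 : k) ^ i • SymT.tmul v (symFace k A L n i z) := fun s => by
    induction s using Finset.induction_on with
    | empty => simp [SymT.tmul_zero]
    | insert a s ha ih =>
      rw [Finset.sum_insert ha, Finset.sum_insert ha, LinearMap.add_apply, SymT.tmul_add, ih,
        LinearMap.smul_apply, SymT.tmul_smul]
  rw [Finset.sum_range_succ', LinearMap.add_apply, h, LinearMap.sum_apply, pow_zero, one_smul,
    symFace_zero, sub_eq_neg_add, ← Finset.sum_neg_distrib]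
  refine congrArg (· + _) (Finset.sum_congr rfl fun i _ => ?_)
  rw [LinearMap.smul_apply, symFace_succ, pow_succ, mul_neg_one, neg_smul]

/-- The numbers of terms are `m` and `m + 1` for arbitrary `m`: this covers both `b b = 0` and `b'
b' = 0`, and lets the recursion of `altFace_tmul` close the induction. -/
theorem altFace_comp (n m : ℕ) (z : SymT k A L (n + 2)) :
    (∑ i ∈ Finset.range m, (-1 : k) ^ i • symFace k A L n i)
      ((∑ i ∈ Finset.range (m + 1), (-1 : k) ^ i • symFace k A L (n + 1) i) z) = 0 := by
  induction m generalizing n with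
  | zero => simp
  | succ m ih =>
    refine LinearMap.congr_fun
      (f := (∑ i ∈ Finset.range (m + 1), (-1 : k) ^ i • symFace k A L n i) ∘ₗ
      (∑ i ∈ Finset.range (m + 2), (-1 : k) ^ i • symFace k A L (n + 1) i)) (g := 0)
      (SymT.hom_ext fun v z => ?_) z
    rw [LinearMap.comp_apply, altFace_tmul, map_sub,
      (IsVLin.sum _ fun i _ => (isVLin_symFace n i).smul _).actA, LinearMap.zero_apply]
    cases n with
    | zero =>
      -- In the lowest degree every face but the first is zero by definition.
      have h : ∀ y : SymT k A L 1,
          (∑ i ∈ Finset.range (m + 1), (-1 : k) ^ i • symFace k A L 0 i) y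
            = symFace k A L 0 0 y := fun y => by
        rw [Finset.sum_range_succ', LinearMap.add_apply, LinearMap.sum_apply,
          Finset.sum_eq_zero]
        · simp
        · intro i _
          change (-1 : k) ^ (i + 1) • (0 : SymT k A L 0) = 0
          exact smul_zero _
      rw [h, h, symFace_zero, sub_self]
    | succ n =>
      rw [altFace_tmul, ih]
      rw [SymT.tmul_zero, sub_zero, sub_self]

end SymRelations

/-! ### The tensor identity -/

section TensorIdentity

variable {k A L : Type u} [CommRing k] [CommRing A] [LieRing L] [Module A L]
  [LieRingModule L A] [LieRinehartRing A L] [Algebra k A] [LieAlgebra k L]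
  [LieRinehartAlgebra k A L]

/-- The `A`-linear maps between two modules over the enveloping algebra. -/
def homSub (M N : LMod k (Env k A L)) : Submodule k (M.carrier →ₗ[k] N.carrier) where
  carrier := {f | ∀ (a : A) (m : M.carrier), f (M.actA a m) = N.actA a (f m)}
  add_mem' hf hg a m := by
    rw [LinearMap.add_apply, LinearMap.add_apply, hf, hg, map_add]
  zero_mem' a m := by simp
  smul_mem' r f hf a m := by
    rw [LinearMap.smul_apply, LinearMap.smul_apply, hf, map_smul]

variable (M N : LMod k (Env k A L))

variable {M N} in
theorem homSub_map (f : homSub M N) (a : A) (m : M.carrier) :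
    f.1 (M.actA a m) = N.actA a (f.1 m) := f.2 a m

/-- The action of `A` on `Hom_A(M, N)`. -/
def homA : A →ₐ[k] Module.End k (homSub M N) :=
  AlgHom.ofLinearMap
    { toFun := fun a =>
        { toFun := fun f => ⟨N.actA a ∘ₗ f.1, fun b m => by
            rw [LinearMap.comp_apply, f.2, ← LMod.actA_mul, mul_comm, LMod.actA_mul,
              LinearMap.comp_apply]⟩
          map_add' := fun f g => Subtype.ext (LinearMap.comp_add _ _ _)
          map_smul' := fun r f => Subtype.ext (LinearMap.comp_smul _ _ _) }
      map_add' := fun a b => LinearMap.ext fun f => Subtype.ext <| LinearMap.ext fun m => by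
        simp [LMod.actA]
      map_smul' := fun r a => LinearMap.ext fun f => Subtype.ext <| LinearMap.ext fun m => by
        simp [LMod.actA] }
    (LinearMap.ext fun f => Subtype.ext <| LinearMap.ext fun m => by simp [LMod.actA])
    (fun a b => LinearMap.ext fun f => Subtype.ext <| LinearMap.ext fun m => by
      simp [LMod.actA])

/-- The action of `L` on `Hom_A(M, N)`. -/
def homL : L →ₗ[k] Module.End k (homSub M N) where
  toFun x :=
    { toFun := fun f => ⟨N.actL x ∘ₗ f.1 - f.1 ∘ₗ M.actL x, fun a m => by
        simp only [LinearMap.sub_apply, LinearMap.comp_apply, LMod.actL_actA, map_add, homSub_map,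
          map_sub]
        abel⟩
      map_add' := fun f g => Subtype.ext <| LinearMap.ext fun m => by
        simp only [Submodule.coe_add, LinearMap.sub_apply, LinearMap.comp_apply,
          LinearMap.add_apply, map_add]
        abel
      map_smul' := fun r f => Subtype.ext <| LinearMap.ext fun m => by
        simp [smul_sub] }
  map_add' x y := LinearMap.ext fun f => Subtype.ext <| LinearMap.ext fun m => by
    simp only [map_add, LinearMap.coe_mk, AddHom.coe_mk, LinearMap.sub_apply,
      LinearMap.comp_apply, LinearMap.add_apply, Submodule.coe_add]
    abel
  map_smul' r x := LinearMap.ext fun f => Subtype.ext <| LinearMap.ext fun m => by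
    simp [smul_sub]

theorem homA_apply (a : A) (f : homSub M N) (m : M.carrier) :
    (homA M N a f).1 m = N.actA a (f.1 m) := rfl

theorem homL_apply (x : L) (f : homSub M N) (m : M.carrier) :
    (homL M N x f).1 m = N.actL x (f.1 m) - f.1 (M.actL x m) := rfl

/-- The action of the enveloping algebra on `Hom_A(M, N)`. -/
def homAct : Env k A L →ₐ[k] Module.End k (homSub M N) :=
  Env.lift (B := Module.End k (homSub M N)) (homA M N) (homL M N)
    (fun x y => LinearMap.ext fun f => Subtype.ext <| LinearMap.ext fun m => by
      simp only [Module.End.mul_apply, LinearMap.sub_apply, Submodule.coe_sub, homL_apply,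
        map_sub, LMod.actL_lie]
      abel)
    (fun a x => LinearMap.ext fun f => Subtype.ext <| LinearMap.ext fun m => by
      simp only [Module.End.mul_apply, homL_apply, homA_apply, LMod.actL_smul, homSub_map, map_sub])
    (fun x a => LinearMap.ext fun f => Subtype.ext <| LinearMap.ext fun m => by
      simp only [Module.End.mul_apply, LinearMap.sub_apply, Submodule.coe_sub, homL_apply,
        homA_apply, map_sub, LMod.actL_actA]
      abel)

theorem homAct_incA (a : A) (f : homSub M N) (m : M.carrier) :
    (homAct M N (incA k A L a) f).1 m = N.actA a (f.1 m) := by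
  rw [homAct, Env.lift_incA, homA_apply]

theorem homAct_incL (x : L) (f : homSub M N) (m : M.carrier) :
    (homAct M N (incL k A L x) f).1 m = N.actL x (f.1 m) - f.1 (M.actL x m) := by
  rw [homAct, Env.lift_incL, homL_apply]

theorem insertL_balanced (a : A) (h : Env k A L) (m : M.carrier) :
    (diagMod (regMod k A L) M).act (rmulA k A L a h) ((insertL (P := regMod k A L) M 1).1 m)
      = (diagMod (regMod k A L) M).act h ((insertL (P := regMod k A L) M 1).1 (M.actA a m)) := by
  rw [act_balanced, (insertL (P := regMod k A L) M 1).2]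

/-- The map `h ⊗ m ↦ h (1 ⊗ m)`. -/
def tensorIdent : IndTensor M →ₗ[k] DiagTensor (regMod k A L) M :=
  Bal.lift ((diagAct (regMod k A L) M).toLinearMap.compl₂ (insertL (P := regMod k A L) M 1).1)
    (insertL_balanced M)

theorem tensorIdent_mk (h : Env k A L) (m : M.carrier) :
    tensorIdent M (Bal.mk h m)
      = (diagMod (regMod k A L) M).act h
        (Bal.mk (1 : Env k A L) m : DiagTensor (regMod k A L) M) :=
  Bal.lift_mk (β := M.actA) _ (insertL_balanced M) h m

theorem tensorIdent_one (m : M.carrier) :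
    tensorIdent M (Bal.mk 1 m) = (Bal.mk (1 : Env k A L) m : DiagTensor (regMod k A L) M) := by
  rw [tensorIdent_mk, map_one, Module.End.one_apply]

theorem isVLin_tensorIdent :
    IsVLin (indMod M) (diagMod (regMod k A L) M) (tensorIdent M) := fun g z => by
  induction z using Bal.induction with
  | hmk h m => rw [indMod_act_mk, tensorIdent_mk, tensorIdent_mk, map_mul, Module.End.mul_apply]
  | hadd y z hy hz => rw [map_add, map_add, hy, hz, map_add, map_add]

/-- The map `m ↦ 1 ⊗ m`, as an element of `Hom_A(M, V L ⊗_A M)`. -/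
def homUnit : homSub M (indMod M) := ⟨(indUnit M).1, (indUnit M).2⟩

theorem homUnit_apply (m : M.carrier) : (homUnit M).1 m = (Bal.mk 1 m : IndTensor M) := rfl

/-- The inverse of `h ⊗ m ↦ h (1 ⊗ m)` has to undo the coproduct, and is obtained without a formula
for that. `V L` acts on `Hom_A(M, V L ⊗_A M)`, elements of `L` by commutators, and `v ⊗ m` is sent
to the value at `m` of `v` applied to the map `m ↦ 1 ⊗ m`. -/
theorem unmix_balanced (a : A) (v : Env k A L) (m : M.carrier) :
    (homAct M (indMod M) ((regMod k A L).actA a v) (homUnit M)).1 m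
      = (homAct M (indMod M) v (homUnit M)).1 (M.actA a m) := by
  have : (regMod k A L).actA a v = incA k A L a * v := rfl
  rw [this, map_mul, Module.End.mul_apply, homAct_incA,
    (homAct M (indMod M) v (homUnit M)).2]

/-- The inverse of `tensorIdent`. -/
def tensorUnmix : DiagTensor (regMod k A L) M →ₗ[k] IndTensor M :=
  Bal.lift ((homSub M (indMod M)).subtype ∘ₗ
    (homAct M (indMod M)).toLinearMap.flip (homUnit M)) (unmix_balanced M)

theorem tensorUnmix_mk (v : Env k A L) (m : M.carrier) :
    tensorUnmix M (Bal.mk (v : (regMod k A L).carrier) m)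
      = (homAct M (indMod M) v (homUnit M)).1 m :=
  Bal.lift_mk (α := (regMod k A L).actA) _ (unmix_balanced M) v m

theorem tensorUnmix_one (m : M.carrier) :
    tensorUnmix M (Bal.mk (1 : Env k A L) m) = (Bal.mk 1 m : IndTensor M) := by
  rw [tensorUnmix_mk, map_one, Module.End.one_apply, homUnit_apply]

theorem isVLin_tensorUnmix :
    IsVLin (diagMod (regMod k A L) M) (indMod M) (tensorUnmix M) := by
  refine IsVLin.of_diag (fun a v m => ?_) fun x v m => ?_
  · have : (regMod k A L).actA a v = incA k A L a * v := rfl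
    rw [this, tensorUnmix_mk, tensorUnmix_mk, map_mul, Module.End.mul_apply, homAct_incA]
  · have : (regMod k A L).actL x v = incL k A L x * v := rfl
    rw [this, tensorUnmix_mk, tensorUnmix_mk, tensorUnmix_mk, map_mul, Module.End.mul_apply,
      homAct_incL, sub_add_cancel]

theorem tensorUnmix_tensorIdent (z : IndTensor M) : tensorUnmix M (tensorIdent M z) = z := by
  refine LinearMap.congr_fun (f := tensorUnmix M ∘ₗ tensorIdent M) (g := LinearMap.id)
    (indMod_ext ((isVLin_tensorUnmix M).comp (isVLin_tensorIdent M)) IsVLin.id fun m => ?_) z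
  rw [LinearMap.comp_apply, tensorIdent_one, tensorUnmix_one, LinearMap.id_apply]

/-- The elements `1 ⊗ m` generate the diagonal tensor product too: by `x u ⊗ m = x (u ⊗ m) - u ⊗ x
m` the first factor can be built up from the generators of `V L`, at the price of changing `m`. -/
theorem tensorIdent_surjective : Function.Surjective (tensorIdent M) := by
  have key : ∀ h u : Env k A L,
      (∀ m, (Bal.mk u m : DiagTensor (regMod k A L) M) ∈ LinearMap.range (tensorIdent M)) →
      ∀ m, (Bal.mk (h * u) m : DiagTensor (regMod k A L) M) ∈ LinearMap.range (tensorIdent M) := by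
    intro h
    induction h using Env.induction with
    | hA a =>
      intro u hu m
      have : (regMod k A L).actA a u = incA k A L a * u := rfl
      rw [← this, Bal.mk_rel]
      exact hu _
    | hL x =>
      intro u hu m
      have : (regMod k A L).actL x u = incL k A L x * u := rfl
      have e := diagMod_actL_mk (regMod k A L) M x u m
      rw [← this, eq_sub_of_add_eq e.symm]
      refine sub_mem ?_ (hu _)
      obtain ⟨z, hz⟩ := hu m
      rw [← hz, ← (isVLin_tensorIdent M).actL]
      exact ⟨_, rfl⟩
    | hadd g h hg hh =>
      intro u hu m
      rw [add_mul]
      have := Bal.mk_add_left (α := (regMod k A L).actA) (β := M.actA) (g * u) (h * u) m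
      rw [this]
      exact add_mem (hg u hu m) (hh u hu m)
    | hmul g h hg hh =>
      intro u hu m
      rw [mul_assoc]
      exact hg _ (hh u hu) m
  intro z
  induction z using Bal.induction with
  | hmk v m =>
    have := key v 1 (fun m => ⟨Bal.mk 1 m, tensorIdent_one M m⟩) m
    rw [mul_one] at this
    exact this
  | hadd y z hy hz =>
    obtain ⟨y, rfl⟩ := hy
    obtain ⟨z, rfl⟩ := hz
    exact ⟨y + z, map_add _ _ _⟩

/-- The tensor identity `V L ⊗_A M ≅ V L ⊗_A M` between the induced module and the diagonal
tensor product. -/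
def tensorIdentEquiv : IndTensor M ≃ₗ[k] DiagTensor (regMod k A L) M :=
  LinearEquiv.ofBijective (tensorIdent M)
    ⟨Function.LeftInverse.injective (tensorUnmix_tensorIdent M), tensorIdent_surjective M⟩

end TensorIdentity

/-! ### Coinvariants -/

section Coinvariants

variable {k A L : Type u} [CommRing k] [CommRing A] [LieRing L] [Module A L]
  [LieRingModule L A] [LieRinehartRing A L] [Algebra k A] [LieAlgebra k L]
  [LieRinehartAlgebra k A L] (c : FlatRightConnection k A L) (M : LMod k (Env k A L))

theorem epsR_apply (D : Env k A L) : epsR c D = (rightAct c D).unop 1 := rfl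

theorem epsR_one : epsR c 1 = 1 := by simp [epsR_apply]

theorem epsR_mul (h g : Env k A L) : epsR c (h * g) = (rightAct c g).unop (epsR c h) := by
  simp [epsR_apply]

theorem epsR_incA_mul (a : A) (g : Env k A L) :
    epsR c (incA k A L a * g) = (rightAct c g).unop a := by
  simp [epsR_apply]

theorem indEpsR_mk (h : Env k A L) (m : M.carrier) :
    indEpsR c M (Bal.mk h m) = M.actA (epsR c h) m :=
  Bal.lift_mk (β := M.actA) _ (indEpsR_balanced c M) h m

theorem indEpsR_one (m : M.carrier) : indEpsR c M (Bal.mk 1 m) = m := by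
  rw [indEpsR_mk, epsR_one]
  simp [LMod.actA]

theorem indEpsR_act (h : Env k A L) (z : IndTensor M) :
    indEpsR c M ((indMod M).act h z) = indEpsR c M ((indMod M).actA (epsR c h) z) := by
  induction z using Bal.induction with
  | hmk g m =>
    rw [indMod_act_mk, indMod_actA_mk, indEpsR_mk, indEpsR_mk, epsR_mul, epsR_incA_mul]
  | hadd y z hy hz => simp only [map_add, hy, hz]

theorem indMk_one_actA (a : A) (m : M.carrier) :
    (Bal.mk 1 (M.actA a m) : IndTensor M) = (indMod M).actA a (Bal.mk 1 m) := by
  rw [indMod_actA_mk, mul_one, ← Bal.mk_rel, rmulA_apply, one_mul]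

/-- Integration by parts, the origin of the antipode in the cyclic operator. In the coinvariants `(x
f)(m) = x f(m) - f(x m)` becomes `f(ε_r(x) m - x m)`, and `ε_r(x) - x` is `S(x) = S⁻¹(x)`. Products
are moved across one factor at a time, which reverses their order. -/
theorem indEpsR_homAct (v : Env k A L) (f : homSub M (indMod M)) (m : M.carrier) :
    indEpsR c M ((homAct M (indMod M) v f).1 m)
      = indEpsR c M (f.1 (M.act ((antipode c).symm v) m)) := by
  rw [antipode_symm_apply]
  induction v using Env.induction generalizing f m with
  | hA a => rw [homAct_incA, antipodeHom_incA, ← f.2, LMod.act_incA]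
  | hL x =>
    have h1 := indEpsR_act c M (incL k A L x) (f.1 m)
    have h2 : epsR c (incL k A L x) = c.nabla x 1 := by simp [epsR_apply]
    rw [homAct_incL, map_sub, ← LMod.act_incL, h1, h2, antipodeHom_incL, map_add, map_neg,
      LinearMap.add_apply, LinearMap.neg_apply, map_add, map_neg, map_add, map_neg,
      LMod.act_incA, LMod.act_incL, f.2]
    abel
  | hadd g h hg hh =>
    rw [map_add, map_add, LinearMap.add_apply, MulOpposite.unop_add, map_add,
      LinearMap.add_apply, map_add, map_add, ← hg, ← hh, ← map_add]
    rfl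
  | hmul g h hg hh =>
    rw [map_mul, Module.End.mul_apply, hg, hh, map_mul, MulOpposite.unop_mul, map_mul,
      Module.End.mul_apply]

theorem indEpsR_tensorUnmix (v : Env k A L) (m : M.carrier) :
    indEpsR c M (tensorUnmix M (Bal.mk (v : (regMod k A L).carrier) m))
      = M.act ((antipode c).symm v) m := by
  rw [tensorUnmix_mk, indEpsR_homAct, homUnit_apply, indEpsR_one]

end Coinvariants

/-! ### Comparison of the chains with the tensor powers -/

section Comparison

variable {k A L : Type u} [CommRing k] [CommRing A] [LieRing L] [Module A L]
  [LieRingModule L A] [LieRinehartRing A L] [Algebra k A] [LieAlgebra k L]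
  [LieRinehartAlgebra k A L]

/-- The isomorphism of induced modules given by an isomorphism of modules. -/
def indEquiv {M N : LMod k (Env k A L)} (e : M.carrier ≃ₗ[k] N.carrier)
    (he : IsVLin M N e.toLinearMap) : IndTensor M ≃ₗ[k] IndTensor N :=
  LinearEquiv.ofLinearMap (indLin he.toAHom) (indLin he.symm.toAHom)
    (Bal.hom_ext fun h m => by
      rw [LinearMap.comp_apply, indLin_mk, indLin_mk, LinearMap.id_apply]
      exact congrArg (Bal.mk h) (e.apply_symm_apply m))
    (Bal.hom_ext fun h m => by
      rw [LinearMap.comp_apply, indLin_mk, indLin_mk, LinearMap.id_apply]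
      exact congrArg (Bal.mk h) (e.symm_apply_apply m))

variable (k A L) in
/-- The comparison isomorphism, bundled with its linearity. -/
def psiAux : (n : ℕ) → {e : Chain k A L n ≃ₗ[k] SymT k A L n //
    IsVLin (chainMod k A L n) (symTensor k A L n) e.toLinearMap}
  | 0 => ⟨LinearEquiv.refl k A, fun _ _ => rfl⟩
  | n + 1 => ⟨(indEquiv (psiAux n).1 (psiAux n).2).trans (tensorIdentEquiv (symTensor k A L n)),
      (isVLin_tensorIdent _).comp (isVLin_indLin _)⟩

variable (k A L) in
/-- The comparison isomorphism `h ⊗ w ↦ h (1 ⊗ ψ w)` from the chains to the tensor powers. -/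
def psi (n : ℕ) : Chain k A L n ≃ₗ[k] SymT k A L n := (psiAux k A L n).1

theorem isVLin_psi (n : ℕ) :
    IsVLin (chainMod k A L n) (symTensor k A L n) (psi k A L n).toLinearMap := (psiAux k A L n).2

theorem psi_act {n : ℕ} (h : Env k A L) (w : Chain k A L n) :
    psi k A L n ((chainMod k A L n).act h w) = (symTensor k A L n).act h (psi k A L n w) :=
  isVLin_psi n h w

theorem psi_symm_act {n : ℕ} (h : Env k A L) (w : SymT k A L n) : (psi k A L n).symm
    ((symTensor k A L n).act h w) = (chainMod k A L n).act h ((psi k A L n).symm w) :=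
  (isVLin_psi n).symm h w

theorem psi_one_tmul {n : ℕ} (w : Chain k A L n) :
    psi k A L (n + 1) (Chain.tmul 1 w) = SymT.tmul 1 (psi k A L n w) :=
  (congrArg (tensorIdent (symTensor k A L n)) (indLin_mk (isVLin_psi n).toAHom 1 w)).trans
    (tensorIdent_one (symTensor k A L n) (psi k A L n w))

theorem psi_symm_apply (n : ℕ) (z : SymT k A L (n + 1)) : (psi k A L (n + 1)).symm z
    = indLin (isVLin_psi n).symm.toAHom (tensorUnmix (symTensor k A L n) z) := by
  obtain ⟨y, rfl⟩ := tensorIdent_surjective _ z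
  rw [tensorUnmix_tensorIdent]
  exact congrArg (indEquiv (psi k A L n) (isVLin_psi n)).symm
    ((tensorIdentEquiv (symTensor k A L n)).symm_apply_apply y)

theorem chain_ext {n : ℕ} {N : LMod k (Env k A L)} {f g : Chain k A L (n + 1) →ₗ[k] N.carrier}
    (hf : IsVLin (chainMod k A L (n + 1)) N f) (hg : IsVLin (chainMod k A L (n + 1)) N g)
    (h : ∀ w, f (Chain.tmul 1 w) = g (Chain.tmul 1 w)) : f = g := indMod_ext hf hg h

theorem Chain.induction_on {n : ℕ} {p : Chain k A L (n + 1) → Prop}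
    (h : ∀ g w, p (Chain.tmul g w)) (hadd : ∀ y z, p y → p z → p (y + z))
    (z : Chain k A L (n + 1)) : p z := Bal.induction h hadd z

theorem Chain.act_tmul {n : ℕ} (g h : Env k A L) (w : Chain k A L n) :
    (chainMod k A L (n + 1)).act g (Chain.tmul h w) = Chain.tmul (g * h) w :=
  indMod_act_mk (chainMod k A L n) g h w

theorem barFace_zero_tmul {n : ℕ} (h : Env k A L) (w : Chain k A L n) :
    (barFace k A L n 0).1 (Chain.tmul h w) = (chainMod k A L n).act h w := by
  cases n <;> exact multLin_mk _ h w

theorem barFace_succ_tmul {n i : ℕ} (h : Env k A L) (w : Chain k A L (n + 1)) :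
    (barFace k A L (n + 1) (i + 1)).1 (Chain.tmul h w) = Chain.tmul h ((barFace k A L n i).1 w) :=
  indLin_mk (barFace k A L n i) h w

theorem isVLin_barFace (n i : ℕ) :
    IsVLin (chainMod k A L (n + 1)) (chainMod k A L n) (barFace k A L n i).1 := by
  cases n with
  | zero =>
    cases i with
    | zero => exact isVLin_multLin _
    | succ i => exact IsVLin.zero
  | succ n =>
    cases i with
    | zero => exact isVLin_multLin _
    | succ i => exact isVLin_indLin _

/-- Both sides are `V L`-linear, so `w` may be taken of the form `1 ⊗ w'`. There the first face
returns `w'` on either side, and the other faces pass to `w'`. -/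
theorem psi_barFace (n i : ℕ) (w : Chain k A L (n + 1)) :
    psi k A L n ((barFace k A L n i).1 w) = symFace k A L n i (psi k A L (n + 1) w) := by
  have hL := (isVLin_psi n).comp (isVLin_barFace (k := k) (A := A) (L := L) n i)
  have hR := (isVLin_symFace n i).comp (isVLin_psi (k := k) (A := A) (L := L) (n + 1))
  refine LinearMap.congr_fun (chain_ext hL hR fun w => ?_) w
  rw [LinearMap.comp_apply, LinearMap.comp_apply, LinearEquiv.coe_coe, LinearEquiv.coe_coe,
    psi_one_tmul]
  cases i with
  | zero =>
    rw [barFace_zero_tmul, symFace_zero, epsL_one, map_one]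
    simp [LMod.actA]
  | succ i =>
    cases n with
    | zero => exact map_zero _
    | succ n =>
      rw [barFace_succ_tmul, symFace_succ, psi_one_tmul, psi_barFace n i w]

theorem commPsi_balanced {n : ℕ} (a : A) (u : Chain k A L n) (v : Env k A L) :
    SymT.tmul v (psi k A L n ((chainMod k A L n).actA a u))
      = SymT.tmul ((regMod k A L).actA a v) (psi k A L n u) := by
  rw [← LMod.act_incA, psi_act, LMod.act_incA, SymT.tmul_actA, SymT.actA_tmul]
  rfl

variable (k A L) in
/-- The map `u ⊗ v ↦ v ⊗ ψ u`. -/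
def commPsi (n : ℕ) : DiagTensor (chainMod k A L n) (regMod k A L) →ₗ[k] SymT k A L (n + 1) :=
  Bal.lift (((Bal.mkBilin (regMod k A L).actA (symTensor k A L n).actA).compl₂
    (psi k A L n).toLinearMap).flip) commPsi_balanced

theorem commPsi_mk {n : ℕ} (u : Chain k A L n) (v : Env k A L) :
    commPsi k A L n (Bal.mk u (v : (regMod k A L).carrier)) = SymT.tmul v (psi k A L n u) :=
  Bal.lift_mk (β := (regMod k A L).actA) _ commPsi_balanced u v

theorem isVLin_commPsi (n : ℕ) : IsVLin (diagMod (chainMod k A L n) (regMod k A L))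
    (symTensor k A L (n + 1)) (commPsi k A L n) := by
  refine IsVLin.of_diag (fun a u v => ?_) fun x u v => ?_
  · rw [commPsi_mk, commPsi_mk, ← LMod.act_incA, psi_act, LMod.act_incA, SymT.tmul_actA]
  · have e : (regMod k A L).actL x v = incL k A L x * v := rfl
    rw [e, commPsi_mk, commPsi_mk, commPsi_mk, SymT.actL_tmul, ← LMod.act_incL, psi_act,
      LMod.act_incL]
    exact add_comm _ _

theorem isVLin_spread (n : ℕ) : IsVLin (chainMod k A L (n + 1))
    (diagMod (chainMod k A L n) (regMod k A L)) (spread k A L n).1 := by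
  cases n with
  | zero =>
    refine IsVLin.of_gen (spread k A L 0).2 fun x z => ?_
    induction z using Chain.induction_on with
    | h g a =>
      rw [← LMod.act_incL, Chain.act_tmul]
      refine (zeroLin_mk _ _).trans ?_
      refine Eq.trans ?_ (congrArg (diagAct (baseMod k A L) (regMod k A L) (incL k A L x))
        (zeroLin_mk g a)).symm
      rw [diagAct_incL]
      have e1 : (baseMod k A L).actL x (1 : A) = 0 :=
        (anchorAct_incL k A L x (1 : A)).trans (lie_one_eq_zero x)
      rw [e1, mul_assoc]
      have e2 := Bal.mk_smul_left (α := (baseMod k A L).actA) (β := (regMod k A L).actA) (0 : k)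
        (0 : A) (g * incA k A L a)
      rw [zero_smul, zero_smul] at e2
      rw [e2, zero_add]
      rfl
    | hadd y z hy hz => simp only [map_add, hy, hz]
  | succ n =>
    intro g z
    induction z using Chain.induction_on with
    | h h w =>
      rw [Chain.act_tmul]
      refine (succLin_mk (spread k A L n) (g * h) w).trans ?_
      rw [map_mul]
      exact congrArg (diagAct (chainMod k A L (n + 1)) (regMod k A L) g)
        (succLin_mk (spread k A L n) h w).symm
    | hadd y z hy hz => simp only [map_add, hy, hz]

variable (k A L) in
/-- The map `u ⊗ v ↦ (1 ⊗ u) ⊗ v`. -/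
def chainUnitDiag (n : ℕ) : DiagTensor (chainMod k A L n) (regMod k A L) →ₗ[k]
    DiagTensor (chainMod k A L (n + 1)) (regMod k A L) :=
  (diagMap (indUnit (chainMod k A L n)) (regMod k A L)).1

theorem chainUnitDiag_mk {n : ℕ} (u : Chain k A L n) (v : Env k A L) :
    chainUnitDiag k A L n (Bal.mk u (v : (regMod k A L).carrier))
      = Bal.mk (Chain.tmul 1 u) (v : (regMod k A L).carrier) :=
  diagLin_mk (indUnit (chainMod k A L n)) (regMod k A L) u v

theorem spread_one_tmul {n : ℕ} (w : Chain k A L (n + 1)) :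
    (spread k A L (n + 1)).1 (Chain.tmul 1 w)
      = chainUnitDiag k A L n ((spread k A L n).1 w) := by
  refine (succLin_mk (spread k A L n) 1 w).trans ?_
  rw [map_one]
  rfl

theorem swap_one_commPsi {n : ℕ} (y : DiagTensor (chainMod k A L n) (regMod k A L)) :
    symSwap k A L n (SymT.tmul 1 (commPsi k A L n y))
      = commPsi k A L (n + 1) (chainUnitDiag k A L n y) := by
  induction y using Bal.induction with
  | hmk u v => rw [commPsi_mk, symSwap_tmul, chainUnitDiag_mk, commPsi_mk, psi_one_tmul]
  | hadd y z hy hz => simp only [map_add, SymT.tmul_add, hy, hz]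

theorem tmul_one_psi_zero (a : A) :
    SymT.tmul 1 (psi k A L 0 a) = commPsi k A L 0 ((spread k A L 0).1 (Chain.tmul (n := 0) 1 a)) := by
  refine Eq.trans ?_ (congrArg (commPsi k A L 0) (zeroLin_mk (1 : Env k A L) a)).symm
  rw [one_mul]
  refine Eq.trans ?_ (commPsi_mk (n := 0) (1 : A) (incA k A L a)).symm
  have e := SymT.tmul_actA (k := k) (L := L) (n := 0) a (1 : Env k A L) (1 : A)
  replace e := e.trans ((SymT.actA_tmul (n := 0) a (1 : Env k A L) (1 : A)).trans
    (by rw [mul_one]))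
  refine Eq.trans (congrArg (SymT.tmul (n := 0) 1) ?_) e
  exact ((anchorAct_incA k A L a (1 : A)).trans (mul_one _)).symm

/-- `spread` distributes coproducts in the same way as the diagonal action does inside `psi`. By
linearity only `1 ⊗ w` matters, where one step in the recursion for the rotation matches one step in
that for `spread`. -/
theorem symRot_psi (n : ℕ) (w : Chain k A L (n + 1)) :
    symRot k A L (n + 1) (psi k A L (n + 1) w) = commPsi k A L n ((spread k A L n).1 w) := by
  have hL := (isVLin_symRot (n + 1)).comp (isVLin_psi (k := k) (A := A) (L := L) (n + 1))
  have hR := (isVLin_commPsi n).comp (isVLin_spread (k := k) (A := A) (L := L) n)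
  refine LinearMap.congr_fun (chain_ext hL hR fun w => ?_) w
  rw [LinearMap.comp_apply, LinearMap.comp_apply, LinearEquiv.coe_coe, psi_one_tmul]
  cases n with
  | zero =>
    rw [symRot_one, LinearMap.id_apply]
    exact tmul_one_psi_zero (A := A) w
  | succ n =>
    rw [symRot_tmul, symRot_psi n, swap_one_commPsi, spread_one_tmul]

variable (c : FlatRightConnection k A L)

/-- The projection of the tensor power `V L^{⊗ (n + 1)}` to its coinvariants `C_n`. -/
def symCoinv (n : ℕ) : SymT k A L (n + 1) →ₗ[k] Chain k A L n :=
  firstFace c n ∘ₗ (psi k A L (n + 1)).symm.toLinearMap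

theorem symCoinv_psi (n : ℕ) (w : Chain k A L (n + 1)) :
    symCoinv c n (psi k A L (n + 1) w) = firstFace c n w :=
  congrArg (firstFace c n) ((psi k A L (n + 1)).symm_apply_apply w)

theorem firstFace_tmul {n : ℕ} (h : Env k A L) (w : Chain k A L n) :
    firstFace c n (Chain.tmul h w) = (chainMod k A L n).actA (epsR c h) w :=
  indEpsR_mk c (chainMod k A L n) h w

theorem firstFace_one_tmul {n : ℕ} (w : Chain k A L n) :
    firstFace c n (Chain.tmul 1 w) = w := indEpsR_one c (chainMod k A L n) w

theorem firstFace_act {n : ℕ} (h : Env k A L) (w : Chain k A L (n + 1)) :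
    firstFace c n ((chainMod k A L (n + 1)).act h w)
      = firstFace c n ((chainMod k A L (n + 1)).actA (epsR c h) w) :=
  indEpsR_act c (chainMod k A L n) h w

/-- Removing the first factor in the coinvariants costs an inverse antipode (`indEpsR_tensorUnmix`);
the rest is transport along `psi`. -/
theorem symCoinv_tmul {n : ℕ} (v : Env k A L) (w : Chain k A L n) :
    symCoinv c n (SymT.tmul v (psi k A L n w))
      = (chainMod k A L n).act ((antipode c).symm v) w := by
  have h1 : ∀ z : IndTensor (symTensor k A L n),
      indEpsR c (chainMod k A L n) (indLin (isVLin_psi n).symm.toAHom z)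
        = (psi k A L n).symm (indEpsR c (symTensor k A L n) z) := fun z => by
    induction z using Bal.induction with
    | hmk h m =>
      rw [indLin_mk, indEpsR_mk, indEpsR_mk]
      exact (psi_symm_act _ _).symm
    | hadd y z hy hz => simp only [map_add, hy, hz]
  refine (congrArg (firstFace c n) (psi_symm_apply n _)).trans ((h1 _).trans ?_)
  refine (congrArg (psi k A L n).symm
    (indEpsR_tensorUnmix c (symTensor k A L n) v (psi k A L n w))).trans ?_
  rw [psi_symm_act, LinearEquiv.symm_apply_apply]

theorem rotate_mk (M : LMod k (Env k A L)) (m : M.carrier) (h : Env k A L) :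
    rotate c M (Bal.mk m (h : (regMod k A L).carrier))
      = (Bal.mk ((antipode c).symm h) m : IndTensor M) :=
  Bal.lift_mk (β := (regMod k A L).actA) _ (rotate_balanced c M) m h

theorem symCoinv_commPsi (n : ℕ) (y : DiagTensor (chainMod k A L n) (regMod k A L)) :
    symCoinv c n (commPsi k A L n y) = (multLin (chainMod k A L n)) (rotate c (chainMod k A L n) y)
    := by
  induction y using Bal.induction with
  | hmk u v =>
    rw [commPsi_mk, symCoinv_tmul]
    refine Eq.trans ?_ (congrArg (multLin (chainMod k A L n))
      (rotate_mk c (chainMod k A L n) u v)).symm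
    exact (multLin_mk (chainMod k A L n) _ _).symm
  | hadd y z hy hz => simp only [map_add, hy, hz]

theorem multLin_rotate_unit (n : ℕ) (y : DiagTensor (chainMod k A L n) (regMod k A L)) :
    multLin (chainMod k A L (n + 1)) (rotate c (chainMod k A L (n + 1))
      (chainUnitDiag k A L n y))
      = rotate c (chainMod k A L n) y := by
  induction y using Bal.induction with
  | hmk u v =>
    rw [chainUnitDiag_mk]
    refine (congrArg (multLin (chainMod k A L (n + 1)))
      (rotate_mk c (chainMod k A L (n + 1)) (Chain.tmul 1 u) v)).trans ?_
    refine (multLin_mk (chainMod k A L (n + 1)) _ _).trans ?_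
    refine Eq.trans ?_ (rotate_mk c (chainMod k A L n) u v).symm
    refine (Chain.act_tmul _ _ _).trans ?_
    rw [mul_one]
    rfl
  | hadd y z hy hz =>
    rw [map_add, map_add, map_add, map_add, hy, hz]
    rfl

/-- The coinvariant classes of `h ⊗ w` and of `1 ⊗ ε_r(h) w` agree, and `V L`-linear maps respect
this. So such a map may be evaluated on a representative that starts with `1`. -/
theorem firstFace_vlin {m n : ℕ} {f : Chain k A L (m + 1) →ₗ[k] Chain k A L (n + 1)}
    (hf : IsVLin (chainMod k A L (m + 1)) (chainMod k A L (n + 1)) f) (z : Chain k A L (m + 1)) :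
    firstFace c n (f z) = firstFace c n (f (Chain.tmul 1 (firstFace c m z))) := by
  induction z using Chain.induction_on with
  | h h w =>
    have e : (Chain.tmul h w : Chain k A L (m + 1))
        = (chainMod k A L (m + 1)).act h (Chain.tmul 1 w) := by rw [Chain.act_tmul, mul_one]
    have e' : (Chain.tmul 1 ((chainMod k A L m).actA (epsR c h) w) : Chain k A L (m + 1))
        = (chainMod k A L (m + 1)).actA (epsR c h) (Chain.tmul 1 w) := indMk_one_actA _ _ _
    rw [firstFace_tmul, e, hf, firstFace_act, e', hf.actA]
  | hadd y z hy hz =>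
    have e : ∀ y z : Chain k A L m, (Chain.tmul 1 (y + z) : Chain k A L (m + 1))
        = Chain.tmul 1 y + Chain.tmul 1 z := fun y z => Bal.mk_add_right 1 y z
    simp only [map_add, hy, hz, e]

/-- For `n > 0`, write `m' ⊗ m''` for the image of `m` under `spread`. Rotating the representative
`1 ⊗ m` brings `m''` to the front, before `1` and `m'`. Its projection is `S⁻¹(m'')` acting on `1 ⊗
m'`, that is `S⁻¹(m'') ⊗ m'`, which is the cyclic operator on `m`. -/
theorem symCoinv_symRot (n : ℕ) (z : SymT k A L (n + 1)) :
    symCoinv c n (symRot k A L (n + 1) z) = cyclicT c n (symCoinv c n z) := by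
  obtain ⟨w, rfl⟩ := (psi k A L (n + 1)).surjective z
  have hf : IsVLin (chainMod k A L (n + 1)) (chainMod k A L (n + 1))
      ((psi k A L (n + 1)).symm.toLinearMap ∘ₗ symRot k A L (n + 1) ∘ₗ
        (psi k A L (n + 1)).toLinearMap) :=
    (isVLin_psi (n + 1)).symm.comp ((isVLin_symRot _).comp (isVLin_psi _))
  refine (firstFace_vlin c hf w).trans ?_
  rw [symCoinv_psi]
  generalize firstFace c n w = m
  change symCoinv c n (symRot k A L (n + 1) (psi k A L (n + 1) (Chain.tmul 1 m))) = _
  cases n with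
  | zero =>
    rw [symRot_one, LinearMap.id_apply, symCoinv_psi, firstFace_one_tmul]
    rfl
  | succ n =>
    rw [psi_one_tmul, symRot_tmul, symRot_psi, swap_one_commPsi, symCoinv_commPsi,
      multLin_rotate_unit]
    rfl

/-- The first bar face multiplies `h` into `w`, and in the coinvariants this is multiplication by
`ε_r(h)`, as in `d_0`. The other bar faces leave `h` alone. -/
theorem firstFace_barFace (n i : ℕ) (w : Chain k A L (n + 2)) :
    firstFace c n ((barFace k A L (n + 1) i).1 w) = face c n i (firstFace c (n + 1) w) := by
  induction w using Chain.induction_on with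
  | h h w =>
    rw [firstFace_tmul]
    cases i with
    | zero =>
      rw [barFace_zero_tmul, firstFace_act]
      rfl
    | succ i =>
      rw [barFace_succ_tmul, firstFace_tmul]
      exact ((barFace k A L n i).2 _ _).symm
  | hadd y z hy hz => simp only [map_add, hy, hz]

theorem symCoinv_symFace (n i : ℕ) (z : SymT k A L (n + 2)) :
    symCoinv c n (symFace k A L (n + 1) i z) = face c n i (symCoinv c (n + 1) z) := by
  obtain ⟨w, rfl⟩ := (psi k A L (n + 2)).surjective z
  rw [← psi_barFace, symCoinv_psi, symCoinv_psi, firstFace_barFace]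

theorem firstFace_surjective (n : ℕ) : Function.Surjective (firstFace c n) := fun w =>
  ⟨Chain.tmul 1 w, firstFace_one_tmul c w⟩

theorem symCoinv_surjective (n : ℕ) : Function.Surjective (symCoinv c n) :=
  (firstFace_surjective c n).comp (psi k A L (n + 1)).symm.surjective

/-- The signed faces of the chains. -/
def chainSFace (n i : ℕ) : Chain k A L (n + 1) →ₗ[k] Chain k A L n := (-1 : k) ^ i • face c n i

theorem symCoinv_symSFace (n i : ℕ) (z : SymT k A L (n + 2)) :
    symCoinv c n (symSFace k A L n i z) = chainSFace c n i (symCoinv c (n + 1) z) := by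
  rw [symSFace, LinearMap.smul_apply, map_smul, symCoinv_symFace]
  rfl

theorem symCoinv_symLam (n : ℕ) (z : SymT k A L (n + 1)) :
    symCoinv c n (symLam k A L n z) = signedT c n (symCoinv c n z) := by
  rw [symLam, LinearMap.smul_apply, map_smul, symCoinv_symRot]
  rfl

theorem symCoinv_symLam_pow (n j : ℕ) (z : SymT k A L (n + 1)) :
    symCoinv c n ((symLam k A L n ^ j) z) = (signedT c n ^ j) (symCoinv c n z) := by
  induction j with
  | zero => rfl
  | succ j ih => rw [pow_succ', pow_succ', Module.End.mul_apply, symCoinv_symLam, ih]; rfl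

theorem symCoinv_faceSum (n m : ℕ) (z : SymT k A L (n + 2)) :
    symCoinv c n (faceSum (E := fun n => SymT k A L (n + 1)) (symSFace k A L) n m z)
      = faceSum (E := Chain k A L) (chainSFace c) n m (symCoinv c (n + 1) z) := by
  rw [faceSum, faceSum, LinearMap.sum_apply, LinearMap.sum_apply, map_sum]
  exact Finset.sum_congr rfl fun i _ => symCoinv_symSFace c n i z

theorem symCoinv_normOp (n : ℕ) (z : SymT k A L (n + 1)) :
    symCoinv c n (normOp (E := fun n => SymT k A L (n + 1)) (symLam k A L) n z)
      = normT c n (symCoinv c n z) := by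
  rw [normOp, normT, LinearMap.sum_apply, LinearMap.sum_apply, map_sum]
  exact Finset.sum_congr rfl fun i _ => symCoinv_symLam_pow c n i z

/-- Like the relations that follow, it holds for the tensor powers and descends along the
surjections `symCoinv`. -/
theorem chainSFace_zero (n : ℕ) :
    chainSFace c n 0 ∘ₗ signedT c (n + 1) = chainSFace c n (n + 1) := by
  ext w
  obtain ⟨z, rfl⟩ := symCoinv_surjective c (n + 1) w
  rw [LinearMap.comp_apply, ← symCoinv_symLam, ← symCoinv_symSFace, ← symCoinv_symSFace,
    ← symSFace_zero_symLam, LinearMap.comp_apply]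

theorem chainSFace_succ (n i : ℕ) (hi : i ≤ n) :
    chainSFace c n (i + 1) ∘ₗ signedT c (n + 1) = signedT c n ∘ₗ chainSFace c n i := by
  ext w
  obtain ⟨z, rfl⟩ := symCoinv_surjective c (n + 1) w
  rw [LinearMap.comp_apply, LinearMap.comp_apply, ← symCoinv_symLam, ← symCoinv_symSFace,
    ← symCoinv_symSFace, ← symCoinv_symLam, ← LinearMap.comp_apply (symLam k A L n),
    ← symSFace_succ_symLam n i hi, LinearMap.comp_apply]

theorem signedT_pow (n : ℕ) : signedT c n ^ (n + 1) = 1 := by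
  ext w
  obtain ⟨z, rfl⟩ := symCoinv_surjective c n w
  rw [← symCoinv_symLam_pow, symLam_pow]
  rfl

theorem symFaceSum_comp (n m : ℕ) (z : SymT k A L (n + 3)) :
    faceSum (E := fun n => SymT k A L (n + 1)) (symSFace k A L) n m
      (faceSum (E := fun n => SymT k A L (n + 1)) (symSFace k A L) (n + 1) (m + 1) z) = 0 :=
  altFace_comp (n + 1) m z

theorem chainFaceSum_comp (n m : ℕ) (z : Chain k A L (n + 2)) :
    faceSum (E := Chain k A L) (chainSFace c) n m
      (faceSum (E := Chain k A L) (chainSFace c) (n + 1) (m + 1) z) = 0 := by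
  obtain ⟨z, rfl⟩ := symCoinv_surjective c (n + 2) z
  rw [← symCoinv_faceSum, ← symCoinv_faceSum, symFaceSum_comp, map_zero]

end Comparison

/-! ### Projectivity of the chains -/

section Projectivity

variable {k A L : Type u} [CommRing k] [CommRing A] [LieRing L] [Module A L]
  [LieRingModule L A] [LieRinehartRing A L] [Algebra k A] [LieAlgebra k L]
  [LieRinehartAlgebra k A L]

/-- The map `(p_j) ↦ ∑ s_j p_j` for a family of elements of `M`. -/
def combA {J : Type*} (M : LMod k (Env k A L)) (p : J → M.carrier) :
    (J →₀ A) →ₗ[k] M.carrier :=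
  Finsupp.lsum k fun j => M.act.toLinearMap.flip (p j) ∘ₗ (incA k A L).toLinearMap

theorem combA_single {J : Type*} (M : LMod k (Env k A L)) (p : J → M.carrier) (j : J) (a : A) :
    combA M p (Finsupp.single j a) = M.actA a (p j) := by
  simp [combA, LMod.actA]

theorem combA_smul {J : Type*} (M : LMod k (Env k A L)) (p : J → M.carrier) (a : A)
    (s : J →₀ A) : combA M p (a • s) = M.actA a (combA M p s) := by
  induction s using Finsupp.induction_linear with
  | zero => simp
  | add s t hs ht => simp only [smul_add, map_add, hs, ht]
  | single j b => rw [Finsupp.smul_single, combA_single, combA_single, smul_eq_mul, LMod.actA_mul]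

/-- Projectivity over `A`, in terms of a dual basis. -/
def AProj (M : LMod k (Env k A L)) : Prop :=
  ∃ s : M.carrier →ₗ[k] (M.carrier →₀ A), (∀ (a : A) m, s (M.actA a m) = a • s m) ∧
    ∀ m, combA M id (s m) = m

/-- Projectivity over the enveloping algebra: maps out of `M` lift through maps whose range is
large enough. -/
def VProj (M : LMod k (Env k A L)) : Prop :=
  ∀ (P N : LMod k (Env k A L)) (f : M.carrier →ₗ[k] N.carrier) (g : P.carrier →ₗ[k] N.carrier),
    IsVLin M N f → IsVLin P N g → (∀ m, f m ∈ LinearMap.range g) →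
    ∃ h : M.carrier →ₗ[k] P.carrier, IsVLin M P h ∧ g ∘ₗ h = f

theorem AProj.baseMod : AProj (baseMod k A L) :=
  ⟨Finsupp.lsingle (1 : A), fun a b => by
    have e : (LRHopf.baseMod k A L).actA a b = a * b := anchorAct_incA k A L a b
    rw [e]
    exact (Finsupp.smul_single a (1 : A) b).symm, fun b => by
    refine (combA_single (LRHopf.baseMod k A L) id (1 : A) b).trans ?_
    exact (anchorAct_incA k A L b (1 : A)).trans (mul_one b)⟩

attribute [local instance] Env.leftModule in
theorem AProj.regMod [Algebra ℚ k] [Module.Projective A L] : AProj (regMod k A L) := by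
  obtain ⟨s, hs⟩ := (Env.projective (k := k) (A := A) (L := L)).out
  refine ⟨⟨s.toAddHom, fun r v => ?_⟩, fun a v => s.map_smul a v, fun v => ?_⟩
  · have e : r • v = algebraMap k A r • v := by
      rw [Env.smul_def, AlgHom.commutes, Algebra.smul_def]
    refine (congrArg s e).trans ((s.map_smul _ v).trans ?_)
    ext j
    simp [Algebra.smul_def]
  · refine Eq.trans ?_ (hs v)
    generalize s v = t
    induction t using Finsupp.induction_linear with
    | zero => simp
    | add s t hs ht => rw [map_add, map_add, hs, ht]
    | single j b =>
      rw [combA_single, Finsupp.linearCombination_single, Env.smul_def]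
      rfl

/-- The dual basis of `V L ⊗_A M` in terms of those of `V L` and of `M`. -/
def indDual (M : LMod k (Env k A L)) (s : Env k A L →ₗ[k] (Env k A L →₀ A)) :
    Env k A L →ₗ[k] (M.carrier →₀ A) →ₗ[k] (IndTensor M →₀ A) :=
  (Finsupp.lsum k).toLinearMap ∘ₗ LinearMap.pi fun j =>
    ((LinearMap.mul k (Env k A L)).compl₂ (incA k A L).toLinearMap).compr₂
      (Finsupp.lmapDomain A k (fun i => (Bal.mk i j : IndTensor M)) ∘ₗ s)

theorem indDual_single (M : LMod k (Env k A L)) (s : Env k A L →ₗ[k] (Env k A L →₀ A))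
    (v : Env k A L) (j : M.carrier) (a : A) : indDual M s v (Finsupp.single j a)
      = Finsupp.mapDomain (fun i => (Bal.mk i j : IndTensor M)) (s (v * incA k A L a)) := by
  simp [indDual]

/-- Dual bases compose: expand `m`, move its coefficients across the tensor sign to the right of
`v`, and expand the resulting products in `V L` as a left `A`-module. -/
theorem AProj.indMod {M : LMod k (Env k A L)} (hM : AProj M) (hV : AProj (LRHopf.regMod k A L)) :
    AProj (indMod M) := by
  obtain ⟨s, hs, hs'⟩ := hM
  obtain ⟨t, ht, ht'⟩ := hV
  have hb : ∀ (a : A) (v : Env k A L) (p : M.carrier →₀ A),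
      indDual M t (rmulA k A L a v) p = indDual M t v (a • p) := fun a v p => by
    induction p using Finsupp.induction_linear with
    | zero => simp
    | add p q hp hq => simp only [smul_add, map_add, hp, hq]
    | single j b =>
      rw [Finsupp.smul_single, indDual_single, indDual_single, rmulA_apply, mul_assoc, smul_eq_mul,
        map_mul (incA k A L)]
  have hl : ∀ (a : A) (v : Env k A L) (p : M.carrier →₀ A),
      indDual M t (incA k A L a * v) p = a • indDual M t v p := fun a v p => by
    induction p using Finsupp.induction_linear with
    | zero => simp
    | add p q hp hq => simp only [smul_add, map_add, hp, hq]
    | single j b =>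
      rw [indDual_single, indDual_single, mul_assoc, ← Finsupp.mapDomain_smul]
      exact congrArg _ (ht a _)
  have hc : ∀ (v : Env k A L) (p : M.carrier →₀ A),
      combA (LRHopf.indMod M) id (indDual M t v p) = (Bal.mk v (combA M id p) : IndTensor M) :=
      fun v p => by
    induction p using Finsupp.induction_linear with
    | zero => rw [map_zero, map_zero, map_zero]; exact (map_zero (Bal.mkBilin _ _ v)).symm
    | add p q hp hq => rw [map_add, map_add, map_add, hp, hq, Bal.mk_add_right]
    | single j b =>
      rw [indDual_single, combA_single]
      refine Eq.trans ?_ ((Bal.mk_rel b v j).trans rfl)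
      refine Eq.trans ?_ (congrArg (fun z => (Bal.mk z j : IndTensor M)) (ht' (v * incA k A L b)))
      generalize t (v * incA k A L b) = q
      induction q using Finsupp.induction_linear with
      | zero =>
        simp only [Finsupp.mapDomain_zero, map_zero]
        exact ((Bal.mkBilin (rmulA k A L) M.actA).map_zero₂ j).symm
      | add p q hp hq =>
        rw [Finsupp.mapDomain_add, map_add, map_add, hp, hq]
        exact (Bal.mk_add_left _ _ _).symm
      | single i a =>
        rw [Finsupp.mapDomain_single, combA_single, combA_single]
        exact indMod_actA_mk M a i j
  refine ⟨Bal.lift ((indDual M t).compl₂ s) fun a v m => ?_, fun a z => ?_, fun z => ?_⟩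
  · rw [LinearMap.compl₂_apply, LinearMap.compl₂_apply, hb, hs]
  · induction z using Bal.induction with
    | hmk v m => rw [indMod_actA_mk, Bal.lift_mk, Bal.lift_mk, LinearMap.compl₂_apply,
        LinearMap.compl₂_apply, hl]
    | hadd y z hy hz => simp only [map_add, smul_add, hy, hz]
  · induction z using Bal.induction with
    | hmk v m => rw [Bal.lift_mk, LinearMap.compl₂_apply, hc, hs']
    | hadd y z hy hz => rw [map_add, map_add, hy, hz]

/-- `V L`-linear maps out of the induced module are `A`-linear maps out of `M`, and the latter lift
by means of a dual basis of `M`. -/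
theorem AProj.vProj_indMod {M : LMod k (Env k A L)} (hM : AProj M) :
    VProj (LRHopf.indMod M) := by
  obtain ⟨s, hs, hs'⟩ := hM
  intro P N f g hf hg hr
  choose p hp using fun m : M.carrier => hr (Bal.mk 1 m)
  have hg0 : ∀ q : M.carrier →₀ A, g (combA P p q) = f (Bal.mk 1 (combA M id q)) := fun q => by
    induction q using Finsupp.induction_linear with
    | zero =>
      rw [map_zero, map_zero, map_zero]
      exact ((congrArg f (map_zero (Bal.mkBilin _ _ 1))).trans (map_zero f)).symm
    | add p q hp hq => rw [map_add, map_add, map_add, hp, hq, Bal.mk_add_right, map_add]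
    | single j b =>
      rw [combA_single, combA_single, hg.actA, hp, indMk_one_actA, hf.actA]
      rfl
  let h0 : AHom M P := ⟨combA P p ∘ₗ s, fun a m => by
    rw [LinearMap.comp_apply, hs, combA_smul, LinearMap.comp_apply]⟩
  have hV : IsVLin (LRHopf.indMod M) P (multLin P ∘ₗ indLin h0) :=
    (isVLin_multLin P).comp (isVLin_indLin h0)
  refine ⟨_, hV, indMod_ext (hg.comp hV) hf fun m => ?_⟩
  rw [LinearMap.comp_apply, LinearMap.comp_apply, indLin_mk, multLin_mk, map_one]
  refine (hg0 (s m)).trans ?_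
  rw [hs']

theorem VProj.of_equiv {M N : LMod k (Env k A L)} (hM : VProj M) (e : M.carrier ≃ₗ[k] N.carrier)
    (he : IsVLin M N e.toLinearMap) : VProj N := fun P Q f g hf hg hr => by
  obtain ⟨h, hh, e1⟩ := hM P Q (f ∘ₗ e.toLinearMap) g (hf.comp he) hg fun m => hr _
  refine ⟨h ∘ₗ e.symm.toLinearMap, hh.comp he.symm, ?_⟩
  rw [← LinearMap.comp_assoc, e1]
  ext m
  simp

variable [Algebra ℚ k] [Module.Projective A L]

theorem aProj_chainMod (n : ℕ) : AProj (chainMod k A L n) := by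
  induction n with
  | zero => exact AProj.baseMod
  | succ n ih => exact ih.indMod AProj.regMod

theorem vProj_chainMod (n : ℕ) : VProj (chainMod k A L (n + 1)) :=
  (aProj_chainMod n).vProj_indMod

theorem vProj_symTensor (n : ℕ) : VProj (symTensor k A L (n + 1)) :=
  (vProj_chainMod n).of_equiv (psi k A L (n + 1)) (isVLin_psi (n + 1))

end Projectivity

/-! ### The cyclic double complex of a cyclic object -/

section CyclicBicomplex

variable {k : Type*} [CommRing k] {C : ℕ → Type*} [∀ n, AddCommGroup (C n)]
  [∀ n, Module k (C n)]

/-- The relations between the operators of the cyclic double complex. -/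
structure CyclicRel (b b' : ∀ n, C (n + 1) →ₗ[k] C n) (lam nrm : ∀ n, Module.End k (C n)) :
    Prop where
  b_b : ∀ n x, b n (b (n + 1) x) = 0
  b'_b' : ∀ n x, b' n (b' (n + 1) x) = 0
  b_lam : ∀ n x, b n (x - lam (n + 1) x) = b' n x - lam n (b' n x)
  b'_nrm : ∀ n x, b' n (nrm (n + 1) x) = nrm n (b n x)
  nrm_lam : ∀ n x, nrm n (x - lam n x) = 0
  lam_nrm : ∀ n x, nrm n x - lam n (nrm n x) = 0

variable (b b' : ∀ n, C (n + 1) →ₗ[k] C n) (lam nrm : ∀ n, Module.End k (C n))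

/-- The total differential of the double complex, on sequences of chains; the column of the
component `q` of the value is congruent to `n + q` modulo two. -/
def colD (n : ℕ) : ((q : ℕ) → C q) →ₗ[k] ((q : ℕ) → C q) :=
  LinearMap.pi fun q =>
    if Even (n + q) then b q ∘ₗ LinearMap.proj (q + 1) + (1 - lam q) ∘ₗ LinearMap.proj q
    else -(b' q ∘ₗ LinearMap.proj (q + 1)) + nrm q ∘ₗ LinearMap.proj q

theorem colD_even {n q : ℕ} (h : Even (n + q)) (g : (q : ℕ) → C q) :
    colD b b' lam nrm n g q = b q (g (q + 1)) + (g q - lam q (g q)) := by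
  simp [colD, h]

theorem colD_odd {n q : ℕ} (h : ¬ Even (n + q)) (g : (q : ℕ) → C q) :
    colD b b' lam nrm n g q = -b' q (g (q + 1)) + nrm q (g q) := by
  simp [colD, h]

theorem colD_congr {n q : ℕ} {g g' : (q : ℕ) → C q} (h : g q = g' q)
    (h' : g (q + 1) = g' (q + 1)) : colD b b' lam nrm n g q = colD b b' lam nrm n g' q := by
  by_cases hn : Even (n + q)
  · rw [colD_even _ _ _ _ hn, colD_even _ _ _ _ hn, h, h']
  · rw [colD_odd _ _ _ _ hn, colD_odd _ _ _ _ hn, h, h']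

theorem colD_eq_of_even {n m : ℕ} (h : Even (n + m)) :
    colD b b' lam nrm n = colD b b' lam nrm m := by
  refine LinearMap.ext fun g => funext fun q => ?_
  have e : Even (n + q) ↔ Even (m + q) := by grind
  by_cases hn : Even (n + q)
  · rw [colD_even _ _ _ _ hn, colD_even _ _ _ _ (e.1 hn)]
  · rw [colD_odd _ _ _ _ hn, colD_odd _ _ _ _ fun h => hn (e.2 h)]

/-- The columns have period two, so that a cycle of degree `n + 2` without its first two columns can
be read as a cycle of degree `n`. -/
theorem colD_add_two (n : ℕ) : colD b b' lam nrm (n + 2) = colD b b' lam nrm n :=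
  colD_eq_of_even b b' lam nrm ⟨n + 1, by ring⟩

variable {b b' lam nrm}

theorem CyclicRel.colD_colD (H : CyclicRel b b' lam nrm) (n : ℕ) (g : (q : ℕ) → C q) :
    colD b b' lam nrm n (colD b b' lam nrm (n + 1) g) = 0 := by
  funext q
  by_cases hn : Even (n + q)
  · have h1 : ¬ Even (n + 1 + q) := by grind
    have h2 : Even (n + 1 + (q + 1)) := by grind
    rw [colD_even _ _ _ _ hn, colD_odd _ _ _ _ h1, colD_even _ _ _ _ h2, map_add, H.b_b, H.b_lam,
      map_add, map_neg, ← sub_eq_zero.1 (H.lam_nrm q (g q))]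
    simp
  · have h1 : Even (n + 1 + q) := by grind
    have h2 : ¬ Even (n + 1 + (q + 1)) := by grind
    rw [colD_odd _ _ _ _ hn, colD_even _ _ _ _ h1, colD_odd _ _ _ _ h2, map_add, map_neg, H.b'_b',
      H.b'_nrm, map_add, H.nrm_lam]
    simp

variable (b b' lam nrm) in
/-- The first components of a sequence form a cycle of degree `n`. -/
def IsCyc (n : ℕ) (g : (q : ℕ) → C q) : Prop := ∀ q < n, colD b b' lam nrm (n + 1) g q = 0

variable (b b' lam nrm) in
/-- The first components of a sequence form a boundary of degree `n`. -/
def IsBdry (n : ℕ) (g : (q : ℕ) → C q) : Prop :=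
  ∃ y : (q : ℕ) → C q, ∀ q ≤ n, colD b b' lam nrm n y q = g q

/-- Cycles of degree `n` are tested with index `n + 1` in place of `n - 1`, which has the same
parity and needs no separate case for `n = 0`. -/
theorem CyclicRel.isCyc_colD (H : CyclicRel b b' lam nrm) (n : ℕ) (y : (q : ℕ) → C q) :
    IsCyc b b' lam nrm n (colD b b' lam nrm n y) := fun q _ => by
  have := congrFun (H.colD_colD (n + 1) y) q
  rwa [show n + 1 + 1 = n + 2 from rfl, colD_add_two] at this

theorem IsCyc.sub {n : ℕ} {g g' : (q : ℕ) → C q} (h : IsCyc b b' lam nrm n g)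
    (h' : IsCyc b b' lam nrm n g') : IsCyc b b' lam nrm n (g - g') := fun q hq => by
  rw [map_sub, Pi.sub_apply, h q hq, h' q hq, sub_zero]

theorem IsCyc.add {n : ℕ} {g g' : (q : ℕ) → C q} (h : IsCyc b b' lam nrm n g)
    (h' : IsCyc b b' lam nrm n g') : IsCyc b b' lam nrm n (g + g') := fun q hq => by
  rw [map_add, Pi.add_apply, h q hq, h' q hq, add_zero]

theorem IsBdry.of_sub_colD {n : ℕ} {g y : (q : ℕ) → C q}
    (h : IsBdry b b' lam nrm n (g - colD b b' lam nrm n y)) : IsBdry b b' lam nrm n g := by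
  obtain ⟨z, hz⟩ := h
  exact ⟨z + y, fun q hq => by rw [map_add, Pi.add_apply, hz q hq]; simp⟩

theorem colD_single_of_lt {n m q : ℕ} (h : q + 1 < m) (z : C m) :
    colD b b' lam nrm n (Pi.single m z) q = 0 := by
  have h1 : (Pi.single m z : (q : ℕ) → C q) q = 0 := Pi.single_eq_of_ne (by omega) z
  have h2 : (Pi.single m z : (q : ℕ) → C q) (q + 1) = 0 := Pi.single_eq_of_ne (by omega) z
  by_cases hn : Even (n + q)
  · rw [colD_even _ _ _ _ hn, h1, h2]; simp
  · rw [colD_odd _ _ _ _ hn, h1, h2]; simp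

theorem colD_single_even {n q : ℕ} (h : Even (n + q)) (z : C (q + 1)) :
    colD b b' lam nrm n (Pi.single (q + 1) z) q = b q z := by
  rw [colD_even _ _ _ _ h, Pi.single_eq_same, Pi.single_eq_of_ne (by omega)]; simp

theorem colD_single_odd {n q : ℕ} (h : ¬ Even (n + q)) (z : C (q + 1)) :
    colD b b' lam nrm n (Pi.single (q + 1) z) q = -b' q z := by
  rw [colD_odd _ _ _ _ h, Pi.single_eq_same, Pi.single_eq_of_ne (by omega)]; simp

theorem isCyc_single {n : ℕ} {z : C n} (hz : z ∈ cycles b n) :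
    IsCyc b b' lam nrm n (Pi.single n z) := fun q hq => by
  rcases Nat.lt_or_ge (q + 1) n with h | h
  · exact colD_single_of_lt h z
  · obtain rfl : n = q + 1 := by omega
    rw [colD_single_even (by grind)]
    exact hz

variable (b b' lam nrm) in
/-- A retraction, up to homotopy, of the double complex to its first column. -/
structure ColRetract (R : ∀ n, ((q : ℕ) → C q) →ₗ[k] C n) : Prop where
  congr : ∀ n g g', (∀ q ≤ n, g q = g' q) → R n g = R n g'
  comm : ∀ n g, b n (R (n + 1) g) = R n (colD b b' lam nrm n g)
  single : ∀ n, ∀ z ∈ cycles b n, ∃ u, R n (Pi.single n z) = z + b n u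

theorem ColRetract.mem_cycles {R : ∀ n, ((q : ℕ) → C q) →ₗ[k] C n}
    (hR : ColRetract b b' lam nrm R) {n : ℕ} {g : (q : ℕ) → C q}
    (hg : IsCyc b b' lam nrm n g) : R n g ∈ cycles b n := by
  cases n with
  | zero => trivial
  | succ n =>
    change b n (R (n + 1) g) = 0
    rw [hR.comm, hR.congr n _ 0, map_zero]
    intro q hq
    have := hg q (by omega)
    rwa [show n + 1 + 1 = n + 2 from rfl, colD_add_two] at this

variable {R : ∀ n, ((q : ℕ) → C q) →ₗ[k] C n} (H : CyclicRel b b' lam nrm)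
  (hR : ColRetract b b' lam nrm R) (h0 : ∀ x : C 0, ∃ w, b' 0 w = x)
  (h1 : ∀ n (x : C (n + 1)), b' n x = 0 → ∃ w, b' (n + 1) w = x)

-- On a cycle that lives in the first column the retraction is the identity up to a boundary of `b`,
-- so the cycle itself is a boundary of `b`.
include H hR in
theorem isBdry_of_concentrated {n : ℕ} {g : (q : ℕ) → C q} (hg : IsCyc b b' lam nrm n g)
    (hr : ∃ u, R n g = b n u) (hz : ∀ q < n, g q = 0) : IsBdry b b' lam nrm n g := by
  obtain ⟨u, hu⟩ := hr
  have hgz : ∀ q ≤ n, g q = (Pi.single n (g n) : (q : ℕ) → C q) q := fun q hq => by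
    rcases hq.lt_or_eq with h | rfl
    · rw [hz q h, Pi.single_eq_of_ne h.ne]
    · rw [Pi.single_eq_same]
  have hc : g n ∈ cycles b n := by
    cases n with
    | zero => trivial
    | succ n =>
      have := hg n (by omega)
      rwa [colD_even _ _ _ _ (by grind), hz n (by omega), map_zero, sub_zero, add_zero] at this
  obtain ⟨v, hv⟩ := hR.single n _ hc
  refine ⟨Pi.single (n + 1) (u - v), fun q hq => ?_⟩
  rcases hq.lt_or_eq with h | rfl
  · rw [colD_single_of_lt (by omega), hz q h]
  · rw [colD_single_even (by grind), map_sub, ← hu, hR.congr q _ _ hgz, hv]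
    simp

-- With two columns left, the entry in the second one is a `b'`-cycle, hence a `b'`-boundary, and
-- can be cleared. This changes the retraction only by a boundary.
include H hR h0 h1 in
theorem isBdry_of_low {n : ℕ} {g : (q : ℕ) → C q} (hg : IsCyc b b' lam nrm n g)
    (hr : ∃ u, R n g = b n u) (hz : ∀ q, q + 1 < n → g q = 0) : IsBdry b b' lam nrm n g := by
  cases n with
  | zero => exact isBdry_of_concentrated H hR hg hr fun q hq => absurd hq (by omega)
  | succ n =>
    have hw : ∃ w, b' n w = g n := by
      cases n with
      | zero => exact h0 _
      | succ n =>
        refine h1 n _ ?_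
        have := hg n (by omega)
        rwa [colD_odd _ _ _ _ (by grind), hz n (by omega), map_zero, add_zero, neg_eq_zero] at this
    obtain ⟨w, hw⟩ := hw
    -- The sign of `w` compensates for the vertical differential `-b'` of the odd columns.
    refine IsBdry.of_sub_colD (y := Pi.single (n + 1) (-w))
      (isBdry_of_concentrated H hR (hg.sub (H.isCyc_colD _ _)) ?_ fun q hq => ?_)
    · obtain ⟨u, hu⟩ := hr
      exact ⟨u - R (n + 2) (Pi.single (n + 1) (-w)), by rw [map_sub, map_sub, hu, ← hR.comm]⟩
    · rcases Nat.lt_succ_iff_lt_or_eq.1 hq with h | rfl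
      · rw [Pi.sub_apply, colD_single_of_lt (by omega), hz q (by omega), sub_zero]
      · rw [Pi.sub_apply, colD_single_odd (by grind), map_neg, neg_neg, hw, sub_self]

include H hR h0 h1 in
/-- A cycle of the double complex is a boundary if the retractions of all its shifts are. -/
theorem isBdry_of_retract (n : ℕ) (g : (q : ℕ) → C q) (hg : IsCyc b b' lam nrm n g)
    (hr : ∀ m ≤ n, Even (n + m) → ∃ u, R m g = b m u) : IsBdry b b' lam nrm n g := by
  induction n using Nat.twoStepInduction with
  | zero => exact isBdry_of_low H hR h0 h1 hg (hr 0 le_rfl (by grind)) fun q hq => by omega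
  | one => exact isBdry_of_low H hR h0 h1 hg (hr 1 le_rfl (by grind)) fun q hq => by omega
  | more n ih _ =>
    -- Without its first two columns `g` is a cycle of degree `n` and bounds by induction.
    -- Subtracting that boundary leaves a cycle in the first two columns.
    obtain ⟨y, hy⟩ := ih (fun q hq => by
      have := hg q (by omega)
      rwa [show n + 2 + 1 = n + 1 + 2 from rfl, colD_add_two] at this) fun m hm he =>
      hr m (by omega) (by grind)
    refine IsBdry.of_sub_colD (y := y)
      (isBdry_of_low H hR h0 h1 (hg.sub (H.isCyc_colD _ _)) ?_ fun q hq => ?_)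
    · obtain ⟨u, hu⟩ := hr (n + 2) le_rfl (by grind)
      exact ⟨u - R (n + 3) y, by rw [map_sub, map_sub, hu, ← hR.comm]⟩
    · rw [Pi.sub_apply, colD_add_two, hy q (by omega), sub_self]

-- An extension needs an entry `w` of the second column with `b' w = N g_n`, and then a primitive of
-- `-(1 - λ) w` for the first. The class of `(1 - λ) w` is the obstruction, Connes' boundary of the
-- cycle. It vanishes: `(1 - λ) w`, placed in the first column, is the total boundary of `g`
-- extended by `w`, so its retraction is a boundary of `b`, and the retraction is the identity on
-- such classes.
include H hR h0 h1 in
theorem exists_isCyc_lift {n : ℕ} {g : (q : ℕ) → C q} (hg : IsCyc b b' lam nrm n g) :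
    ∃ g' : (q : ℕ) → C q, (∀ q ≤ n, g' q = g q) ∧ IsCyc b b' lam nrm (n + 2) g' := by
  have hw : ∃ w, b' n w = nrm n (g n) := by
    cases n with
    | zero => exact h0 _
    | succ n =>
      refine h1 n _ ?_
      have := hg n (by omega)
      rw [colD_even _ _ _ _ (by grind)] at this
      rw [H.b'_nrm, eq_neg_of_add_eq_zero_left this, map_neg, H.nrm_lam, neg_zero]
  obtain ⟨w, hw⟩ := hw
  let g1 : (q : ℕ) → C q := fun q => if q ≤ n then g q else (Pi.single (n + 1) w : (q : ℕ) → C q) q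
  have e1 : ∀ q ≤ n, g1 q = g q := fun q hq => if_pos hq
  have e2 : g1 (n + 1) = w := (if_neg (by omega)).trans (Pi.single_eq_same _ _)
  have e3 : g1 (n + 2) = 0 := (if_neg (by omega)).trans (Pi.single_eq_of_ne (by omega) _)
  have hd : ∀ q ≤ n, colD b b' lam nrm (n + 1) g1 q = 0 := fun q hq => by
    rcases hq.lt_or_eq with h | rfl
    · rw [← hg q h]
      exact colD_congr _ _ _ _ (e1 q hq) (e1 (q + 1) h)
    · rw [colD_odd _ _ _ _ (by grind), e1 q le_rfl, e2, hw, neg_add_cancel]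
  have hv : w - lam (n + 1) w ∈ cycles b (n + 1) := by
    change b n _ = 0
    rw [H.b_lam, hw, H.lam_nrm]
  have hd' : ∀ q ≤ n + 1, colD b b' lam nrm (n + 1) g1 q
      = (Pi.single (n + 1) (w - lam (n + 1) w) : (q : ℕ) → C q) q := fun q hq => by
    rcases hq.lt_or_eq with h | rfl
    · rw [hd q (by omega), Pi.single_eq_of_ne h.ne]
    · rw [Pi.single_eq_same, colD_even _ _ _ _ (by grind), e2, e3, map_zero, zero_add]
  obtain ⟨u, hu⟩ := hR.single _ _ hv
  have hc := hR.comm (n + 1) g1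
  rw [hR.congr _ _ _ hd', hu] at hc
  -- By `hc`, `(1 - λ) w` is `b` of `R g1 - u`; the negative of this is the entry needed in the
  -- first column.
  let g2 : (q : ℕ) → C q := g1 + Pi.single (n + 2) (u - R (n + 2) g1)
  have f1 : ∀ q ≤ n + 1, g2 q = g1 q := fun q hq => by
    change g1 q + (Pi.single (n + 2) (u - R (n + 2) g1) : (q : ℕ) → C q) q = g1 q
    rw [Pi.single_eq_of_ne (by omega), add_zero]
  refine ⟨g2, fun q hq => (f1 q (by omega)).trans (e1 q hq), fun q hq => ?_⟩
  rw [show n + 2 + 1 = n + 1 + 2 from rfl, colD_add_two, map_add, Pi.add_apply, hd' q (by omega)]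
  rcases Nat.lt_succ_iff_lt_or_eq.1 hq with h | rfl
  · rw [colD_single_of_lt (by omega), Pi.single_eq_of_ne h.ne, add_zero]
  · rw [Pi.single_eq_same, colD_single_even (by grind), map_sub, hc]
    abel

include H hR h0 h1 in
/-- Every family of cycles in the first column comes, up to boundaries, from a cycle of the double
complex. -/
theorem exists_retract_eq (n : ℕ) (c : (q : ℕ) → C q)
    (hc : ∀ m ≤ n, Even (n + m) → c m ∈ cycles b m) :
    ∃ g, IsCyc b b' lam nrm n g ∧ ∀ m ≤ n, Even (n + m) → ∃ u, R m g = c m + b m u := by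
  -- The retraction in degree `n` can be prescribed by a correction in the first column. Retractions
  -- in smaller degrees see only entries with `q < n` and are not disturbed.
  have key : ∀ (n : ℕ) (g : (q : ℕ) → C q), IsCyc b b' lam nrm n g → c n ∈ cycles b n →
      ∃ g' : (q : ℕ) → C q, (∀ q < n, g' q = g q) ∧ IsCyc b b' lam nrm n g' ∧
        ∃ u, R n g' = c n + b n u := fun n g hg hn => by
    have hz : c n - R n g ∈ cycles b n := Submodule.sub_mem _ hn (hR.mem_cycles hg)
    obtain ⟨u, hu⟩ := hR.single _ _ hz
    refine ⟨g + Pi.single n (c n - R n g), fun q hq => ?_, hg.add (isCyc_single hz), u, ?_⟩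
    · rw [Pi.add_apply, Pi.single_eq_of_ne hq.ne, add_zero]
    · rw [map_add, hu]; abel
  have zero : ∀ n, IsCyc b b' lam nrm n 0 := fun n q _ => by rw [map_zero]; rfl
  induction n using Nat.twoStepInduction with
  | zero =>
    obtain ⟨g, -, hg, hu⟩ := key 0 0 (zero 0) trivial
    exact ⟨g, hg, fun m hm _ => by obtain rfl : m = 0 := by omega
                                   exact hu⟩
  | one =>
    obtain ⟨g, -, hg, hu⟩ := key 1 0 (zero 1) (hc 1 le_rfl (by grind))
    exact ⟨g, hg, fun m hm he => by obtain rfl : m = 1 := by grind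
                                    exact hu⟩
  | more n ih _ =>
    obtain ⟨g0, hg0, hr0⟩ := ih fun m hm he => hc m (by omega) (by grind)
    obtain ⟨g1, e1, hg1⟩ := exists_isCyc_lift H hR h0 h1 hg0
    obtain ⟨g2, e2, hg2, hu⟩ := key (n + 2) g1 hg1 (hc _ le_rfl (by grind))
    refine ⟨g2, hg2, fun m hm he => ?_⟩
    rcases hm.lt_or_eq with h | rfl
    · have hmn : m ≤ n := by grind
      obtain ⟨u, hu⟩ := hr0 m hmn (by grind)
      exact ⟨u, (hR.congr m g2 g0 fun q hq => (e2 q (by omega)).trans (e1 q (by omega))).trans hu⟩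
    · exact hu

end CyclicBicomplex

/-! ### The total complex of a cyclic object -/

section TotalComplex

variable {k : Type*} [CommRing k] {C : ℕ → Type*} [∀ n, AddCommGroup (C n)]
  [∀ n, Module k (C n)]

theorem CyclicRel.of_faces {f : ∀ n : ℕ, ℕ → C (n + 1) →ₗ[k] C n} {lam : ∀ n, Module.End k (C n)}
    (h0 : ∀ n, f n 0 ∘ₗ lam (n + 1) = f n (n + 1))
    (h1 : ∀ n i, i ≤ n → f n (i + 1) ∘ₗ lam (n + 1) = lam n ∘ₗ f n i)
    (hp : ∀ n, lam n ^ (n + 1) = 1)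
    (hc : ∀ n m z, faceSum f n m (faceSum f (n + 1) (m + 1) z) = 0) :
    CyclicRel (fun n => faceSum f n (n + 2)) (fun n => faceSum f n (n + 1)) lam (normOp lam) where
  b_b n x := hc n (n + 2) x
  b'_b' n x := hc n (n + 1) x
  b_lam n x := LinearMap.congr_fun (faceSum_one_sub h0 h1 n) x
  b'_nrm n x := LinearMap.congr_fun (faceSum_normOp h1 hp n) x
  nrm_lam n x := by
    rw [map_sub, sub_eq_zero]
    exact (LinearMap.congr_fun (normOp_mul_lam hp n) x).symm
  lam_nrm n x := by
    rw [sub_eq_zero]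
    exact (LinearMap.congr_fun (lam_mul_normOp hp n) x).symm

variable (k C) in
/-- The first components of a sequence of chains. -/
def cutTot (n : ℕ) : ((q : ℕ) → C q) →ₗ[k] ((q : Fin (n + 1)) → C q) :=
  LinearMap.pi fun q => LinearMap.proj (q : ℕ)

variable (k C) in
/-- Extension of a finite sequence of chains by zero. -/
def extTot (n : ℕ) : ((q : Fin (n + 1)) → C q) →ₗ[k] ((q : ℕ) → C q) :=
  LinearMap.pi fun q => if h : q < n + 1 then
    LinearMap.proj (φ := fun q : Fin (n + 1) => C q) ⟨q, h⟩ else 0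

theorem extTot_apply {n : ℕ} (x : (q : Fin (n + 1)) → C q) (q : Fin (n + 1)) :
    extTot k C n x q = x q := by
  rw [extTot, LinearMap.pi_apply, dif_pos q.2]
  rfl

theorem cutTot_apply {n : ℕ} (g : (q : ℕ) → C q) (q : Fin (n + 1)) :
    cutTot k C n g q = g q := rfl

theorem cutTot_extTot {n : ℕ} (x : (q : Fin (n + 1)) → C q) : cutTot k C n (extTot k C n x) = x :=
  funext fun q => extTot_apply x q

theorem extTot_cutTot {n q : ℕ} (h : q ≤ n) (g : (q : ℕ) → C q) :
    extTot k C n (cutTot k C n g) q = g q :=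
  extTot_apply (cutTot k C n g) ⟨q, Nat.lt_succ_of_le h⟩

variable (b b' : ∀ n, C (n + 1) →ₗ[k] C n) (lam nrm : ∀ n, Module.End k (C n))

/-- The total differential of the cyclic double complex. -/
def totD (n : ℕ) : ((q : Fin (n + 2)) → C q) →ₗ[k] ((q : Fin (n + 1)) → C q) :=
  cutTot k C n ∘ₗ colD b b' lam nrm n ∘ₗ extTot k C (n + 1)

theorem totD_cutTot (n : ℕ) (g : (q : ℕ) → C q) :
    totD b b' lam nrm n (cutTot k C (n + 1) g) = cutTot k C n (colD b b' lam nrm n g) :=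
  funext fun q => colD_congr b b' lam nrm (extTot_cutTot (by omega) g) (extTot_cutTot (by omega) g)

theorem totD_even {n : ℕ} {q : Fin (n + 1)} (h : Even (n + q)) (x : (q : Fin (n + 2)) → C q) :
    totD b b' lam nrm n x q
      = b q (x q.succ) + (1 - lam q) (x q.castSucc) := by
  refine (colD_even b b' lam nrm h _).trans ?_
  rw [← extTot_apply (k := k) x q.succ, ← extTot_apply (k := k) x q.castSucc]
  rfl

theorem totD_odd {n : ℕ} {q : Fin (n + 1)} (h : ¬ Even (n + q)) (x : (q : Fin (n + 2)) → C q) :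
    totD b b' lam nrm n x q = -b' q (x q.succ) + nrm q (x q.castSucc) := by
  refine (colD_odd b b' lam nrm h _).trans ?_
  rw [← extTot_apply (k := k) x q.succ, ← extTot_apply (k := k) x q.castSucc]
  rfl

variable {b b' lam nrm}

theorem CyclicRel.totD_totD (H : CyclicRel b b' lam nrm) (n : ℕ)
    (x : (q : Fin (n + 3)) → C q) :
    totD b b' lam nrm n (totD b b' lam nrm (n + 1) x) = 0 := by
  rw [← cutTot_extTot (k := k) x, totD_cutTot, totD_cutTot, H.colD_colD, map_zero]

/-- Compatible families of maps commute with the total differentials. -/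
theorem totD_map {C' : ℕ → Type*} [∀ n, AddCommGroup (C' n)] {k' : Type*} [CommRing k']
    [∀ n, Module k' (C' n)] {d d' : ∀ n, C' (n + 1) →ₗ[k'] C' n} {mu nu : ∀ n, Module.End k' (C' n)}
    (φ : ∀ n, C n →+ C' n) (h1 : ∀ n x, φ n (b n x) = d n (φ (n + 1) x))
    (h2 : ∀ n x, φ n (b' n x) = d' n (φ (n + 1) x)) (h3 : ∀ n x, φ n (lam n x) = mu n (φ n x))
    (h4 : ∀ n x, φ n (nrm n x) = nu n (φ n x)) (n : ℕ) (x : (q : Fin (n + 2)) → C q) :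
    (fun q : Fin (n + 1) => φ q (totD b b' lam nrm n x q))
      = totD d d' mu nu n fun q : Fin (n + 2) => φ q (x q) := by
  funext q
  by_cases h : Even (n + (q : ℕ))
  · rw [totD_even _ _ _ _ h, totD_even _ _ _ _ h, map_add, h1]
    refine congrArg (_ + ·) ((map_sub (φ q) _ _).trans (congrArg (_ - ·) (h3 _ _)))
  · rw [totD_odd _ _ _ _ h, totD_odd _ _ _ _ h, map_add, map_neg, h2, h4]
    rfl

/-- The first column is a subcomplex, since no horizontal differential starts there. -/
theorem totD_single_last (n : ℕ) (z : C (n + 1)) :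
    totD b b' lam nrm n (Pi.single (M := fun q : Fin (n + 2) => C q) (Fin.last (n + 1)) z)
      = Pi.single (M := fun q : Fin (n + 1) => C q) (Fin.last n) (b n z) := by
  funext q
  have e1 : (Pi.single (M := fun q : Fin (n + 2) => C q) (Fin.last (n + 1)) z) q.castSucc = 0 :=
    Pi.single_eq_of_ne (M := fun q : Fin (n + 2) => C q) (Fin.castSucc_lt_last q).ne z
  rcases Fin.eq_castSucc_or_eq_last q with ⟨i, rfl⟩ | rfl
  · have hne : i.castSucc.succ ≠ Fin.last (n + 1) := fun h => by
      have h' : (i : ℕ) + 1 = n + 1 := congrArg Fin.val h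
      omega
    have e2 : (Pi.single (M := fun q : Fin (n + 2) => C q) (Fin.last (n + 1)) z) i.castSucc.succ
        = 0 := Pi.single_eq_of_ne (M := fun q : Fin (n + 2) => C q) hne z
    have e3 : (Pi.single (M := fun q : Fin (n + 1) => C q) (Fin.last n) (b n z)) i.castSucc = 0 :=
      Pi.single_eq_of_ne (M := fun q : Fin (n + 1) => C q) (Fin.castSucc_lt_last i).ne _
    by_cases h : Even (n + (i.castSucc : ℕ))
    · rw [totD_even _ _ _ _ h, e1, e2, e3]; simp
    · rw [totD_odd _ _ _ _ h, e1, e2, e3]; simp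
  · have h : Even (n + (Fin.last n : ℕ)) := by simp
    rw [totD_even _ _ _ _ h, e1, map_zero, add_zero, Pi.single_eq_same]
    exact congrArg (b n) (Pi.single_eq_same (M := fun q : Fin (n + 2) => C q) (Fin.last (n + 1)) z)

end TotalComplex

/-! ### The cyclic relations on the chains and on the tensor powers. -/

section ChainComplexes

variable {k A L : Type u} [CommRing k] [CommRing A] [LieRing L] [Module A L]
  [LieRingModule L A] [LieRinehartRing A L] [Algebra k A] [LieAlgebra k L]
  [LieRinehartAlgebra k A L] (c : FlatRightConnection k A L)

theorem cyclicRel_chain :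
    CyclicRel (C := Chain k A L) (hochschildB c) (hochschildB' c) (signedT c) (normT c) :=
  CyclicRel.of_faces (C := Chain k A L) (f := chainSFace c) (lam := signedT c) (chainSFace_zero c)
    (chainSFace_succ c) (signedT_pow c) (chainFaceSum_comp c)

theorem cycD_eq (n : ℕ) :
    cycD c n = totD (C := Chain k A L) (hochschildB c) (hochschildB' c) (signedT c) (normT c) n := by
  refine LinearMap.ext fun x => funext fun q => ?_
  have e : Even (n + (q : ℕ)) ↔ Even (n - (q : ℕ)) := by
    have := q.2
    grind
  rw [cycD, LinearMap.pi_apply]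
  by_cases h : Even (n + (q : ℕ))
  · rw [totD_even _ _ _ _ h, if_pos (e.1 h)]
    rfl
  · rw [totD_odd _ _ _ _ h, if_neg fun h' => h (e.2 h')]
    rfl

variable (k A L) in
/-- The Hochschild differential of the tensor powers. -/
def symB (n : ℕ) : SymT k A L (n + 2) →ₗ[k] SymT k A L (n + 1) :=
  faceSum (E := fun n => SymT k A L (n + 1)) (symSFace k A L) n (n + 2)

variable (k A L) in
/-- The truncated differential of the tensor powers. -/
def symB' (n : ℕ) : SymT k A L (n + 2) →ₗ[k] SymT k A L (n + 1) :=
  faceSum (E := fun n => SymT k A L (n + 1)) (symSFace k A L) n (n + 1)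

variable (k A L) in
/-- The norm operator of the tensor powers. -/
def symNorm (n : ℕ) : Module.End k (SymT k A L (n + 1)) :=
  normOp (E := fun n => SymT k A L (n + 1)) (symLam k A L) n

variable (k A L) in
theorem cyclicRel_sym : CyclicRel (C := fun n => SymT k A L (n + 1)) (symB k A L) (symB' k A L)
    (symLam k A L) (symNorm k A L) :=
  CyclicRel.of_faces (C := fun n => SymT k A L (n + 1)) (f := symSFace k A L) (lam := symLam k A L)
    symSFace_zero_symLam symSFace_succ_symLam symLam_pow symFaceSum_comp

theorem isVLin_symB (n : ℕ) :
    IsVLin (symTensor k A L (n + 2)) (symTensor k A L (n + 1)) (symB k A L n) :=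
  IsVLin.sum _ fun i _ => isVLin_symSFace n i

theorem isVLin_symB' (n : ℕ) :
    IsVLin (symTensor k A L (n + 2)) (symTensor k A L (n + 1)) (symB' k A L n) :=
  IsVLin.sum _ fun i _ => isVLin_symSFace n i

theorem isVLin_symNorm (n : ℕ) :
    IsVLin (symTensor k A L (n + 1)) (symTensor k A L (n + 1)) (symNorm k A L n) :=
  IsVLin.sum _ fun i _ => (isVLin_symLam n).pow i

/-! ### The bar resolution -/

variable (k A L) in
/-- The differential `∑_{i=0}^{n} (-1)^i d_{i+1} : C_{n+1} → C_n` of the bar resolution. -/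
def barD (n : ℕ) : Chain k A L (n + 1) →ₗ[k] Chain k A L n :=
  ∑ i ∈ Finset.range (n + 1), (-1 : k) ^ i • (barFace k A L n i).1

theorem isVLin_barD (n : ℕ) : IsVLin (chainMod k A L (n + 1)) (chainMod k A L n) (barD k A L n) :=
  IsVLin.sum _ fun i _ => (isVLin_barFace n i).smul _

theorem Chain.tmul_smul {n : ℕ} (h : Env k A L) (r : k) (w : Chain k A L n) :
    Chain.tmul h (r • w) = r • Chain.tmul h w := Bal.mk_smul_right r h w

theorem Chain.tmul_zero {n : ℕ} (h : Env k A L) : Chain.tmul h (0 : Chain k A L n) = 0 :=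
  map_zero (Bal.mkBilin (rmulA k A L) (chainMod k A L n).actA h)

theorem Chain.tmul_sum {n : ℕ} (h : Env k A L) {ι : Type*} (s : Finset ι)
    (w : ι → Chain k A L n) : Chain.tmul h (∑ i ∈ s, w i) = ∑ i ∈ s, Chain.tmul h (w i) :=
  map_sum (Bal.mkBilin (rmulA k A L) (chainMod k A L n).actA h) w s

theorem barD_zero (z : Chain k A L 1) : barD k A L 0 z = (barFace k A L 0 0).1 z := by
  rw [barD, Finset.sum_range_one, pow_zero, one_smul]

theorem barD_zero_one (w : Chain k A L 0) : barD k A L 0 (Chain.tmul 1 w) = w := by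
  rw [barD_zero, barFace_zero_tmul, map_one]
  rfl

/-- This is `d s + s d = 1` for `s w = 1 ⊗ w`. It gives exactness, and also `d d = 0`, because the
elements `1 ⊗ w` generate over `V L`. -/
theorem barD_succ_one {n : ℕ} (w : Chain k A L (n + 1)) :
    barD k A L (n + 1) (Chain.tmul 1 w) = w - Chain.tmul 1 (barD k A L n w) := by
  rw [barD, Finset.sum_range_succ', LinearMap.add_apply, pow_zero, one_smul, barFace_zero_tmul,
    map_one, barD, LinearMap.sum_apply, LinearMap.sum_apply, Chain.tmul_sum, sub_eq_neg_add,
    ← Finset.sum_neg_distrib]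
  refine congrArg₂ (· + ·) (Finset.sum_congr rfl fun i _ => ?_) rfl
  rw [LinearMap.smul_apply, barFace_succ_tmul, LinearMap.smul_apply, Chain.tmul_smul, pow_succ,
    mul_neg_one, neg_smul]

theorem barD_barD (n : ℕ) (z : Chain k A L (n + 2)) :
    barD k A L n (barD k A L (n + 1) z) = 0 := by
  refine LinearMap.congr_fun (f := barD k A L n ∘ₗ barD k A L (n + 1)) (g := 0)
    (chain_ext ((isVLin_barD n).comp (isVLin_barD (n + 1))) IsVLin.zero fun w => ?_) z
  rw [LinearMap.comp_apply, barD_succ_one, map_sub, LinearMap.zero_apply]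
  cases n with
  | zero => rw [barD_zero_one, sub_self]
  | succ n => rw [barD_succ_one, barD_barD n w, Chain.tmul_zero, sub_zero, sub_self]

theorem barD_surjective (w : Chain k A L 0) : ∃ z, barD k A L 0 z = w := ⟨_, barD_zero_one w⟩

theorem barD_exact (n : ℕ) (w : Chain k A L (n + 1)) (hw : barD k A L n w = 0) :
    ∃ z, barD k A L (n + 1) z = w :=
  ⟨Chain.tmul 1 w, by rw [barD_succ_one, hw, Chain.tmul_zero, sub_zero]⟩

theorem firstFace_barD (n : ℕ) (w : Chain k A L (n + 2)) :
    firstFace c n (barD k A L (n + 1) w) = hochschildB c n (firstFace c (n + 1) w) := by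
  rw [barD, hochschildB, LinearMap.sum_apply, LinearMap.sum_apply, map_sum]
  refine Finset.sum_congr rfl fun i _ => ?_
  rw [LinearMap.smul_apply, map_smul, firstFace_barFace, LinearMap.smul_apply]

theorem psi_barD (n : ℕ) (w : Chain k A L (n + 2)) :
    psi k A L (n + 1) (barD k A L (n + 1) w) = symB k A L n (psi k A L (n + 2) w) := by
  rw [barD, symB, faceSum, LinearMap.sum_apply, LinearMap.sum_apply, map_sum]
  refine Finset.sum_congr rfl fun i _ => ?_
  rw [LinearMap.smul_apply, map_smul, psi_barFace]
  rfl

/-! ### The contraction of the truncated complex -/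

variable (k A L) in
/-- The map `h¹ ⊗ ⋯ ⊗ hⁿ ↦ h¹ ⊗ ⋯ ⊗ hⁿ ⊗ 1`. -/
def appendOne : (n : ℕ) → AHom (chainMod k A L n) (chainMod k A L (n + 1))
  | 0 => indUnit (baseMod k A L)
  | n + 1 => indMap (appendOne n)

theorem appendOne_tmul {n : ℕ} (h : Env k A L) (w : Chain k A L n) :
    (appendOne k A L (n + 1)).1 (Chain.tmul h w) = Chain.tmul h ((appendOne k A L n).1 w) :=
  indLin_mk (appendOne k A L n) h w

theorem isVLin_appendOne (n : ℕ) :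
    IsVLin (chainMod k A L (n + 1)) (chainMod k A L (n + 2)) (appendOne k A L (n + 1)).1 :=
  isVLin_indLin (appendOne k A L n)

theorem barFace_appendOne_last (n : ℕ) (w : Chain k A L (n + 1)) :
    (barFace k A L (n + 1) n).1 ((appendOne k A L (n + 1)).1 w) = w := by
  induction w using Chain.induction_on with
  | h h w =>
    rw [appendOne_tmul]
    cases n with
    | zero =>
      rw [barFace_zero_tmul]
      refine (Chain.act_tmul h 1 w).trans ?_
      rw [mul_one]
    | succ n => rw [barFace_succ_tmul, barFace_appendOne_last n w]
  | hadd y z hy hz => rw [map_add, map_add, hy, hz]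

theorem barFace_appendOne (n i : ℕ) (hi : i < n) (w : Chain k A L (n + 1)) :
    (barFace k A L (n + 1) i).1 ((appendOne k A L (n + 1)).1 w)
      = (appendOne k A L n).1 ((barFace k A L n i).1 w) := by
  induction w using Chain.induction_on with
  | h h w =>
    obtain ⟨n, rfl⟩ : ∃ m, n = m + 1 := ⟨n - 1, by omega⟩
    rw [appendOne_tmul]
    cases i with
    | zero => rw [barFace_zero_tmul, barFace_zero_tmul, isVLin_appendOne n]
    | succ i =>
      rw [barFace_succ_tmul, barFace_succ_tmul, barFace_appendOne n i (by omega) w, appendOne_tmul]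
  | hadd y z hy hz => simp only [map_add, hy, hz]

theorem firstFace_appendOne (n : ℕ) (w : Chain k A L (n + 1)) :
    firstFace c (n + 1) ((appendOne k A L (n + 1)).1 w)
      = (appendOne k A L n).1 (firstFace c n w) := by
  induction w using Chain.induction_on with
  | h h w => rw [appendOne_tmul, firstFace_tmul, firstFace_tmul, (appendOne k A L n).2]
  | hadd y z hy hz => simp only [map_add, hy, hz]

/-- Appending `1` commutes with all faces in `b'` but the last, which undoes it. So, up to sign, it
is a contraction of the `b'`-complex. -/
theorem hochschildB'_appendOne (n : ℕ) (w : Chain k A L (n + 1)) :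
    hochschildB' c (n + 1) ((appendOne k A L (n + 1)).1 w)
      = (appendOne k A L n).1 (hochschildB' c n w) + (-1 : k) ^ (n + 1) • w := by
  rw [hochschildB', Finset.sum_range_succ, LinearMap.add_apply, hochschildB', LinearMap.sum_apply,
    LinearMap.sum_apply, map_sum]
  refine congrArg₂ (· + ·) (Finset.sum_congr rfl fun i hi => ?_)
    (congrArg ((-1 : k) ^ (n + 1) • ·) (barFace_appendOne_last n w))
  rw [LinearMap.smul_apply, LinearMap.smul_apply, map_smul]
  congr 1
  cases i with
  | zero => exact firstFace_appendOne c n w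
  | succ i => exact barFace_appendOne n i (by simpa using hi) w

theorem hochschildB'_surjective (x : Chain k A L 0) : ∃ w, hochschildB' c 0 w = x :=
  ⟨Chain.tmul 1 x, by
    rw [hochschildB', Finset.sum_range_one, pow_zero, one_smul]
    exact firstFace_one_tmul c x⟩

theorem hochschildB'_exact (n : ℕ) (x : Chain k A L (n + 1)) (hx : hochschildB' c n x = 0) :
    ∃ w, hochschildB' c (n + 1) w = x :=
  ⟨(-1 : k) ^ (n + 1) • (appendOne k A L (n + 1)).1 x, by
    rw [map_smul, hochschildB'_appendOne, hx, map_zero, zero_add, smul_smul, ← mul_pow]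
    simp⟩

end ChainComplexes

/-! ### Comparison of projective complexes with resolutions -/

section ComparisonTheorem

variable {k A L : Type u} [CommRing k] [CommRing A] [LieRing L] [Module A L]
  [LieRingModule L A] [LieRinehartRing A L] [Algebra k A] [LieAlgebra k L]
  [LieRinehartAlgebra k A L]

variable {P E : ℕ → LMod k (Env k A L)} {d : ∀ n, (P (n + 1)).carrier →ₗ[k] (P n).carrier}
  {e : ∀ n, (E (n + 1)).carrier →ₗ[k] (E n).carrier}
  (hP : ∀ n, VProj (P (n + 1))) (hd : ∀ n, IsVLin (P (n + 1)) (P n) (d n))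
  (hdd : ∀ n x, d n (d (n + 1) x) = 0) (he : ∀ n, IsVLin (E (n + 1)) (E n) (e n))
  (h0 : ∀ x, ∃ y, e 0 y = x) (h1 : ∀ n x, e n x = 0 → ∃ y, e (n + 1) y = x)

include hP hd hdd he h0 h1 in
/-- A map between the ends of augmented complexes lifts to a chain map from a complex of projective
modules to a resolution. -/
theorem exists_lift (f0 : (P 0).carrier →ₗ[k] (E 0).carrier) (hf0 : IsVLin (P 0) (E 0) f0) :
    ∃ f : ∀ n, (P n).carrier →ₗ[k] (E n).carrier, f 0 = f0 ∧ (∀ n, IsVLin (P n) (E n) (f n)) ∧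
      ∀ n x, e n (f (n + 1) x) = f n (d n x) := by
  -- Two consecutive components are carried through the recursion, because their compatibility is
  -- what allows the choice of the next one.
  let S : ℕ → Type u := fun n =>
    {p : ((P n).carrier →ₗ[k] (E n).carrier) × ((P (n + 1)).carrier →ₗ[k] (E (n + 1)).carrier) //
      IsVLin (P n) (E n) p.1 ∧ IsVLin (P (n + 1)) (E (n + 1)) p.2 ∧
        ∀ x, e n (p.2 x) = p.1 (d n x)}
  have step : ∀ n (p : S n), ∃ p' : S (n + 1), p'.1.1 = p.1.2 := fun n p => by
    obtain ⟨f, hf, ef⟩ := hP (n + 1) (E (n + 2)) (E (n + 1)) (p.1.2 ∘ₗ d (n + 1)) (e (n + 1))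
      (p.2.2.1.comp (hd _)) (he _) fun x => h1 n _ (by
        rw [LinearMap.comp_apply, p.2.2.2, hdd, map_zero])
    exact ⟨⟨(p.1.2, f), p.2.2.1, hf, LinearMap.congr_fun ef⟩, rfl⟩
  obtain ⟨f1, hf1, ef1⟩ := hP 0 (E 1) (E 0) (f0 ∘ₗ d 0) (e 0) (hf0.comp (hd _)) (he _)
    fun x => h0 _
  choose next hnext using step
  let s : ∀ n, S n := Nat.rec ⟨(f0, f1), hf0, hf1, LinearMap.congr_fun ef1⟩ next
  have hs : ∀ n, (s (n + 1)).1.1 = (s n).1.2 := fun n => hnext n (s n)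
  exact ⟨fun n => (s n).1.1, rfl, fun n => (s n).2.1, fun n x =>
    (congrArg (fun p => e n (p x)) (hs n)).trans ((s n).2.2.2 x)⟩

include hP hd hdd he h1 in
/-- Two lifts of the same map are homotopic. -/
theorem exists_homotopy {f g : ∀ n, (P n).carrier →ₗ[k] (E n).carrier}
    (hf : ∀ n, IsVLin (P n) (E n) (f n)) (hg : ∀ n, IsVLin (P n) (E n) (g n))
    (hfd : ∀ n x, e n (f (n + 1) x) = f n (d n x)) (hgd : ∀ n x, e n (g (n + 1) x) = g n (d n x))
    (h00 : f 0 = g 0) :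
    ∃ h : ∀ n, (P n).carrier →ₗ[k] (E (n + 1)).carrier, h 0 = 0 ∧
      (∀ n, IsVLin (P n) (E (n + 1)) (h n)) ∧
      ∀ n x, f (n + 1) x - g (n + 1) x = e (n + 1) (h (n + 1) x) + h n (d n x) := by
  -- Of the homotopy identity in the previous degree only its restriction to the image of `d` is
  -- used. There one of its two terms vanishes, and the remaining identity makes the next difference
  -- a cycle.
  let S : ℕ → Type u := fun n =>
    {h : (P n).carrier →ₗ[k] (E (n + 1)).carrier // IsVLin (P n) (E (n + 1)) h ∧
      ∀ x, f n (d n x) - g n (d n x) = e n (h (d n x))}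
  have step : ∀ n (p : S n), ∃ p' : S (n + 1), ∀ x,
      f (n + 1) x - g (n + 1) x = e (n + 1) (p'.1 x) + p.1 (d n x) := fun n p => by
    obtain ⟨h, hh, eh⟩ := hP n (E (n + 2)) (E (n + 1)) (f (n + 1) - g (n + 1) - p.1 ∘ₗ d n)
      (e (n + 1)) (((hf _).sub (hg _)).sub (p.2.1.comp (hd _))) (he _) fun x => h1 n _ (by
        simp only [LinearMap.sub_apply, LinearMap.comp_apply, map_sub, hfd, hgd]
        rw [p.2.2, sub_self])
    have eh' : ∀ x, f (n + 1) x - g (n + 1) x = e (n + 1) (h x) + p.1 (d n x) := fun x => by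
      have := LinearMap.congr_fun eh x
      simp only [LinearMap.sub_apply, LinearMap.comp_apply] at this
      rw [this, sub_add_cancel]
    exact ⟨⟨h, hh, fun x => by rw [eh', hdd, map_zero, add_zero]⟩, eh'⟩
  choose next hnext using step
  let s : ∀ n, S n := Nat.rec ⟨0, IsVLin.zero, fun x => by simp [h00]⟩ next
  exact ⟨fun n => (s n).1, rfl, fun n => (s n).2.1, fun n => hnext n (s n)⟩

end ComparisonTheorem

/-! ### Products and coinvariants -/

section Products

variable {k A L : Type u} [CommRing k] [CommRing A] [LieRing L] [Module A L]
  [LieRingModule L A] [LieRinehartRing A L] [Algebra k A] [LieAlgebra k L]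
  [LieRinehartAlgebra k A L] {ι : Type} [Fintype ι] [DecidableEq ι]

/-- The product of a family of modules. -/
abbrev piMod (M : ι → LMod k (Env k A L)) : LMod k (Env k A L) where
  carrier := (i : ι) → (M i).carrier
  act :=
    { toFun := fun h => LinearMap.pi fun i => (M i).act h ∘ₗ LinearMap.proj i
      map_one' := by ext; simp
      map_mul' := fun g h => by ext; simp
      map_zero' := by ext; simp
      map_add' := fun g h => by ext; simp
      commutes' := fun r => by ext; simp }

theorem piMod_act (M : ι → LMod k (Env k A L)) (h : Env k A L) (m : (piMod M).carrier) (i : ι) :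
    (piMod M).act h m i = (M i).act h (m i) := rfl

theorem piMod_act_single (M : ι → LMod k (Env k A L)) (h : Env k A L) (i : ι)
    (m : (M i).carrier) : (piMod M).act h (LinearMap.single k (fun i => (M i).carrier) i m)
      = LinearMap.single k (fun i => (M i).carrier) i ((M i).act h m) := by
  funext j
  rw [piMod_act]
  rcases eq_or_ne j i with rfl | hj
  · simp
  · simp [hj]

theorem VProj.piMod {M : ι → LMod k (Env k A L)} (hM : ∀ i, VProj (M i)) :
    VProj (piMod M) := fun P N f g hf hg hr => by
  choose h hh eh using fun i => hM i P N (f ∘ₗ LinearMap.single k (fun i => (M i).carrier) i) g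
    (fun v m => by
      rw [LinearMap.comp_apply, ← piMod_act_single, hf, LinearMap.comp_apply]) hg fun m => hr _
  refine ⟨∑ i, h i ∘ₗ LinearMap.proj i, IsVLin.sum _ fun i _ v m => ?_, ?_⟩
  · rw [LinearMap.comp_apply, LinearMap.comp_apply]
    exact hh i v (m i)
  · ext i m
    rw [LinearMap.comp_apply, ← eh]
    simp only [LinearMap.comp_apply, LinearMap.sum_apply, LinearMap.proj_apply]
    congr 1
    rw [Finset.sum_eq_single i]
    · simp
    · intro j _ hj
      simp [hj]
    · simp

theorem isVLin_totD {M : ℕ → LMod k (Env k A L)}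
    {b b' : ∀ n, (M (n + 1)).carrier →ₗ[k] (M n).carrier} {lam nrm : ∀ n, Module.End k (M n).carrier}
    (h1 : ∀ n, IsVLin (M (n + 1)) (M n) (b n)) (h2 : ∀ n, IsVLin (M (n + 1)) (M n) (b' n))
    (h3 : ∀ n, IsVLin (M n) (M n) (lam n)) (h4 : ∀ n, IsVLin (M n) (M n) (nrm n)) (n : ℕ) :
    IsVLin (LRHopf.piMod fun q : Fin (n + 2) => M q) (LRHopf.piMod fun q : Fin (n + 1) => M q)
      (totD (C := fun n => (M n).carrier) b b' lam nrm n) := fun h x => funext fun q => by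
  rw [piMod_act]
  by_cases hn : Even (n + (q : ℕ))
  · rw [totD_even _ _ _ _ hn, totD_even _ _ _ _ hn, map_add]
    exact congrArg₂ (· + ·) (h1 q h (x q.succ)) ((IsVLin.id.sub (h3 q)) h (x q.castSucc))
  · rw [totD_odd _ _ _ _ hn, totD_odd _ _ _ _ hn, map_add]
    exact congrArg₂ (· + ·) ((h2 q).neg h (x q.succ)) (h4 q h (x q.castSucc))

variable (c : FlatRightConnection k A L)

/-- The submodule generated by the elements `h m - ε_r(h) m`. -/
def coinvKer (M : LMod k (Env k A L)) : Submodule k M.carrier :=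
  Submodule.span k {z | ∃ h m, z = M.act h m - M.actA (epsR c h) m}

/-- `q` presents the coinvariants of `M`, with the section `s`. -/
structure IsCoinv (M : LMod k (Env k A L)) {N : Type u} [AddCommGroup N] [Module k N]
    (q : M.carrier →ₗ[k] N) (s : N →ₗ[k] M.carrier) : Prop where
  act : ∀ h m, q (M.act h m) = q (M.actA (epsR c h) m)
  apply_section : ∀ y, q (s y) = y
  sub_mem : ∀ m, m - s (q m) ∈ coinvKer c M

variable {c} in
-- `m - s (q m)` is a combination of elements that `g` kills.
theorem IsCoinv.desc {M : LMod k (Env k A L)} {N : Type u} [AddCommGroup N] [Module k N]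
    {q : M.carrier →ₗ[k] N} {s : N →ₗ[k] M.carrier} (H : IsCoinv c M q s) {E : Type u}
    [AddCommGroup E] [Module k E] (g : M.carrier →ₗ[k] E)
    (hg : ∀ h m, g (M.act h m) = g (M.actA (epsR c h) m)) (m : M.carrier) :
    g m = g (s (q m)) := by
  have : coinvKer c M ≤ LinearMap.ker g := Submodule.span_le.2 (by
    rintro _ ⟨h, m, rfl⟩
    simp [hg])
  rw [← sub_eq_zero, ← map_sub]
  exact this (H.sub_mem m)

variable (k A L) in
/-- The map `w ↦ 1 ⊗ w`. -/
def chainUnit (n : ℕ) : Chain k A L n →ₗ[k] Chain k A L (n + 1) := (indUnit (chainMod k A L n)).1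

theorem isCoinv_chain (n : ℕ) : IsCoinv c (chainMod k A L (n + 1)) (firstFace c n)
    (chainUnit k A L n) where
  act h m := firstFace_act c h m
  apply_section w := firstFace_one_tmul c w
  sub_mem z := by
    induction z using Chain.induction_on with
    | h h w =>
      refine Submodule.subset_span ⟨h, Chain.tmul 1 w, ?_⟩
      rw [firstFace_tmul, Chain.act_tmul, mul_one]
      exact congrArg (Chain.tmul h w - ·) ((indUnit (chainMod k A L n)).2 _ _)
    | hadd y z hy hz =>
      rw [map_add, map_add, add_sub_add_comm]
      exact Submodule.add_mem _ hy hz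

variable {c} in
theorem IsCoinv.of_equiv {M M' : LMod k (Env k A L)} {N : Type u} [AddCommGroup N] [Module k N]
    {q : M.carrier →ₗ[k] N} {s : N →ₗ[k] M.carrier} (H : IsCoinv c M q s)
    (e : M.carrier ≃ₗ[k] M'.carrier) (he : IsVLin M M' e.toLinearMap) :
    IsCoinv c M' (q ∘ₗ e.symm.toLinearMap) (e.toLinearMap ∘ₗ s) where
  act h m := by
    rw [LinearMap.comp_apply, he.symm, LinearMap.comp_apply, he.symm.actA, H.act]
  apply_section y := by simp [H.apply_section]
  sub_mem m := by
    have h : coinvKer c M ≤ (coinvKer c M').comap e.toLinearMap :=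
      Submodule.span_le.2 (by
        rintro _ ⟨h, m, rfl⟩
        refine Submodule.subset_span ⟨h, e m, ?_⟩
        rw [map_sub, he, he.actA]
        rfl)
    have h2 := h (H.sub_mem (e.symm m))
    rw [Submodule.mem_comap, map_sub, LinearEquiv.coe_coe, e.apply_symm_apply] at h2
    exact h2

theorem isCoinv_sym (n : ℕ) : IsCoinv c (symTensor k A L (n + 1)) (symCoinv c n)
    ((psi k A L (n + 1)).toLinearMap ∘ₗ chainUnit k A L n) :=
  (isCoinv_chain c n).of_equiv (psi k A L (n + 1)) (isVLin_psi (n + 1))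

variable {c} in
theorem IsCoinv.piMod {M : ι → LMod k (Env k A L)} {N : ι → Type u} [∀ i, AddCommGroup (N i)]
    [∀ i, Module k (N i)] {q : ∀ i, (M i).carrier →ₗ[k] N i} {s : ∀ i, N i →ₗ[k] (M i).carrier}
    (H : ∀ i, IsCoinv c (M i) (q i) (s i)) :
    IsCoinv c (piMod M) (LinearMap.pi fun i => q i ∘ₗ LinearMap.proj i)
      (LinearMap.pi fun i => s i ∘ₗ LinearMap.proj i) where
  act h m := funext fun i => (H i).act h (m i)
  apply_section y := funext fun i => (H i).apply_section (y i)
  sub_mem m := by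
    have h : ∀ i, coinvKer c (M i) ≤ (coinvKer c (LRHopf.piMod M)).comap
        (LinearMap.single k (fun i => (M i).carrier) i) := fun i => Submodule.span_le.2 (by
      rintro _ ⟨h, m, rfl⟩
      refine Submodule.subset_span ⟨h, LinearMap.single k (fun i => (M i).carrier) i m, ?_⟩
      rw [← LMod.act_incA, ← LMod.act_incA, piMod_act_single, piMod_act_single, map_sub])
    rw [← LinearMap.sum_single_apply (fun i => (M i).carrier) (m - _)]
    exact Submodule.sum_mem _ fun i _ => h i ((H i).sub_mem (m i))

end Products

/-! ### The retraction of the cyclic double complex to the Hochschild complex -/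

section Retraction

variable (k A L : Type u) [CommRing k] [CommRing A] [LieRing L] [Module A L]
  [LieRingModule L A] [LieRinehartRing A L] [Algebra k A] [LieAlgebra k L]
  [LieRinehartAlgebra k A L]

/-- The total complex of the cyclic double complex of the tensor powers, augmented to `A`. -/
def totMod : ℕ → LMod k (Env k A L)
  | 0 => baseMod k A L
  | n + 1 => piMod fun q : Fin (n + 1) => symTensor k A L (q + 1)

/-- The differential of `totMod`. -/
def totDiff : (n : ℕ) → (totMod k A L (n + 1)).carrier →ₗ[k] (totMod k A L n).carrier
  | 0 => symFace k A L 0 0 ∘ₗ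
      LinearMap.proj (φ := fun q : Fin 1 => SymT k A L (q + 1)) (0 : Fin 1)
  | n + 1 => totD (C := fun n => SymT k A L (n + 1)) (symB k A L) (symB' k A L) (symLam k A L)
      (symNorm k A L) n

variable {k A L}

theorem isVLin_totDiff (n : ℕ) : IsVLin (totMod k A L (n + 1)) (totMod k A L n) (totDiff k A L n) := by
  cases n with
  | zero => exact fun h x => isVLin_symFace 0 0 h (x 0)
  | succ n =>
    exact isVLin_totD (M := fun n => symTensor k A L (n + 1)) isVLin_symB isVLin_symB' isVLin_symLam isVLin_symNorm n

/-- The horizontal map in degree zero is `1 - λ = 0`, and the augmentation kills the vertical one by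
`altFace_comp`. -/
theorem symFace_totD (x : (q : Fin 2) → SymT k A L (q + 1)) :
    symFace k A L 0 0 (totD (C := fun n => SymT k A L (n + 1)) (symB k A L) (symB' k A L)
      (symLam k A L) (symNorm k A L) 0 x 0) = 0 := by
  have h1 : symLam k A L 0 = 1 := by simpa using symLam_pow (k := k) (A := A) (L := L) 0
  have h2 := altFace_comp (k := k) (A := A) (L := L) 0 1 (x 1 : SymT k A L 2)
  rw [Finset.sum_range_one, pow_zero, one_smul] at h2
  refine (congrArg (symFace k A L 0 0) (totD_even (C := fun n => SymT k A L (n + 1)) (n := 0)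
    (q := 0) _ _ _ _ ⟨0, rfl⟩ x)).trans ((map_add _ _ _).trans ?_)
  refine (congrArg₂ (· + ·) h2 ((congrArg _ ?_).trans (map_zero _))).trans (add_zero 0)
  exact LinearMap.congr_fun (sub_eq_zero.2 h1.symm) _

theorem totDiff_totDiff (n : ℕ) (x : (totMod k A L (n + 2)).carrier) :
    totDiff k A L n (totDiff k A L (n + 1) x) = 0 := by
  cases n with
  | zero => exact symFace_totD x
  | succ n => exact (cyclicRel_sym k A L).totD_totD n x

variable (k A L) in
/-- The inclusion of the bar complex as the first column. -/
def inclTot : (n : ℕ) → Chain k A L n →ₗ[k] (totMod k A L n).carrier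
  | 0 => LinearMap.id
  | n + 1 => LinearMap.single k (fun q : Fin (n + 1) => SymT k A L (q + 1)) (Fin.last n) ∘ₗ
      (psi k A L (n + 1)).toLinearMap

theorem isVLin_inclTot (n : ℕ) : IsVLin (chainMod k A L n) (totMod k A L n) (inclTot k A L n) := by
  cases n with
  | zero => exact IsVLin.id
  | succ n =>
    intro h w
    refine (congrArg (LinearMap.single k (fun q : Fin (n + 1) => SymT k A L (q + 1)) (Fin.last n))
      (psi_act h w)).trans ?_
    exact (piMod_act_single (fun q : Fin (n + 1) => symTensor k A L (q + 1)) h (Fin.last n)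
      (psi k A L (n + 1) w)).symm

theorem totDiff_inclTot (n : ℕ) (w : Chain k A L (n + 1)) :
    totDiff k A L n (inclTot k A L (n + 1) w) = inclTot k A L n (barD k A L n w) := by
  cases n with
  | zero =>
    rw [barD_zero]
    refine Eq.trans ?_ (psi_barFace 0 0 w).symm
    exact congrArg (symFace k A L 0 0) (Pi.single_eq_same
      (M := fun q : Fin 1 => SymT k A L (q + 1)) (0 : Fin 1) (psi k A L 1 w))
  | succ n =>
    refine (totD_single_last (C := fun n => SymT k A L (n + 1)) n (psi k A L (n + 2) w)).trans ?_
    rw [← psi_barD]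
    rfl

variable [Algebra ℚ k] [Module.Projective A L]

theorem vProj_totMod (n : ℕ) : VProj (totMod k A L (n + 1)) :=
  VProj.piMod fun q => vProj_symTensor q

-- Only projectivity of the source and exactness of the target matter for lifting the identity of
-- `A`; the total complex need not be exact.
variable (k A L) in
theorem exists_rho : ∃ f : ∀ n, (totMod k A L n).carrier →ₗ[k] Chain k A L n,
    f 0 = LinearMap.id ∧ (∀ n, IsVLin (totMod k A L n) (chainMod k A L n) (f n)) ∧
      ∀ n x, barD k A L n (f (n + 1) x) = f n (totDiff k A L n x) :=
  exists_lift (P := totMod k A L) (E := chainMod k A L) vProj_totMod isVLin_totDiff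
    totDiff_totDiff isVLin_barD barD_surjective barD_exact LinearMap.id IsVLin.id

variable (k A L) in
/-- A chain map from the total complex to the bar resolution. -/
def rho (n : ℕ) : (totMod k A L n).carrier →ₗ[k] Chain k A L n :=
  (exists_rho k A L).choose n

theorem rho_zero : rho k A L 0 = LinearMap.id := (exists_rho k A L).choose_spec.1

theorem isVLin_rho (n : ℕ) : IsVLin (totMod k A L n) (chainMod k A L n) (rho k A L n) :=
  (exists_rho k A L).choose_spec.2.1 n

theorem barD_rho (n : ℕ) (x : (totMod k A L (n + 1)).carrier) :
    barD k A L n (rho k A L (n + 1) x) = rho k A L n (totDiff k A L n x) :=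
  (exists_rho k A L).choose_spec.2.2 n x

/-- The restriction of `rho` to the first column and the identity both lift the identity of `A` from
the bar resolution to itself. -/
theorem exists_homotopy_rho_incl : ∃ h : ∀ n, Chain k A L n →ₗ[k] Chain k A L (n + 1),
    h 0 = 0 ∧ (∀ n, IsVLin (chainMod k A L n) (chainMod k A L (n + 1)) (h n)) ∧
      ∀ n x, rho k A L (n + 1) (inclTot k A L (n + 1) x) - x
        = barD k A L (n + 1) (h (n + 1) x) + h n (barD k A L n x) :=
  exists_homotopy (P := chainMod k A L) (E := chainMod k A L) vProj_chainMod isVLin_barD barD_barD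
    isVLin_barD barD_exact (f := fun n => rho k A L n ∘ₗ inclTot k A L n)
    (g := fun n => LinearMap.id) (fun n => (isVLin_rho n).comp (isVLin_inclTot n))
    (fun n => IsVLin.id)
    (fun n x => by
      rw [LinearMap.comp_apply, barD_rho, totDiff_inclTot, LinearMap.comp_apply])
    (fun n x => rfl) (by rw [rho_zero]; rfl)

variable (c : FlatRightConnection k A L)

/-- The projection of the total complex of the tensor powers to its coinvariants. -/
def coinvTot (n : ℕ) : (totMod k A L (n + 1)).carrier →ₗ[k] CycTot k A L n :=
  LinearMap.pi fun q : Fin (n + 1) => symCoinv c q ∘ₗ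
    LinearMap.proj (φ := fun q : Fin (n + 1) => SymT k A L (q + 1)) q

variable (k A L) in
/-- A section of `coinvTot`. -/
def secTot (n : ℕ) : CycTot k A L n →ₗ[k] (totMod k A L (n + 1)).carrier :=
  LinearMap.pi fun q : Fin (n + 1) =>
    ((psi k A L (q + 1)).toLinearMap ∘ₗ chainUnit k A L q) ∘ₗ
      LinearMap.proj (φ := fun q : Fin (n + 1) => Chain k A L q) q

theorem isCoinv_tot (n : ℕ) : IsCoinv c (totMod k A L (n + 1)) (coinvTot c n) (secTot k A L n) :=
  IsCoinv.piMod fun q : Fin (n + 1) => isCoinv_sym c q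

theorem coinvTot_surjective (n : ℕ) : Function.Surjective (coinvTot c n) := fun x =>
  ⟨secTot k A L n x, (isCoinv_tot c n).apply_section x⟩

theorem coinvTot_totDiff (n : ℕ) (x : (totMod k A L (n + 2)).carrier) :
    coinvTot c n (totDiff k A L (n + 1) x) = cycD c n (coinvTot c (n + 1) x) := by
  rw [cycD_eq]
  exact totD_map (C := fun n => SymT k A L (n + 1)) (C' := Chain k A L)
    (fun n => (symCoinv c n).toAddMonoidHom) (fun n z => symCoinv_faceSum c n (n + 2) z)
    (fun n z => symCoinv_faceSum c n (n + 1) z) (symCoinv_symLam c) (symCoinv_normOp c) n x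

theorem firstFace_vlin_act {M : LMod k (Env k A L)} {n : ℕ}
    {f : M.carrier →ₗ[k] Chain k A L (n + 1)} (hf : IsVLin M (chainMod k A L (n + 1)) f)
    (h : Env k A L) (m : M.carrier) :
    (firstFace c n ∘ₗ f) (M.act h m) = (firstFace c n ∘ₗ f) (M.actA (epsR c h) m) := by
  rw [LinearMap.comp_apply, hf, firstFace_act, LinearMap.comp_apply, hf.actA]

/-- The map from the cyclic double complex to the Hochschild complex. -/
def cycRetract (n : ℕ) : CycTot k A L n →ₗ[k] Chain k A L n :=
  firstFace c n ∘ₗ rho k A L (n + 1) ∘ₗ secTot k A L n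

/-- `V L`-linear maps descend to coinvariants, so the section used to define the retraction does not
matter. -/
theorem cycRetract_coinvTot (n : ℕ) (x : (totMod k A L (n + 1)).carrier) :
    cycRetract c n (coinvTot c n x) = firstFace c n (rho k A L (n + 1) x) :=
  ((isCoinv_tot c n).desc _ (firstFace_vlin_act c (isVLin_rho (n + 1))) x).symm

theorem hochschildB_cycRetract (n : ℕ) (x : CycTot k A L (n + 1)) :
    hochschildB c n (cycRetract c (n + 1) x) = cycRetract c n (cycD c n x) := by
  obtain ⟨y, rfl⟩ := coinvTot_surjective c (n + 1) x
  rw [← coinvTot_totDiff, cycRetract_coinvTot, cycRetract_coinvTot, ← firstFace_barD, barD_rho]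

theorem exists_cycRetract_single (n : ℕ) (z : Chain k A L n) (hz : z ∈ cycles (hochschildB c) n) :
    ∃ u, cycRetract c n (Pi.single (M := fun q : Fin (n + 1) => Chain k A L q) (Fin.last n) z)
      = z + hochschildB c n u := by
  obtain ⟨h, h0, hV, hh⟩ := exists_homotopy_rho_incl (k := k) (A := A) (L := L)
  have e1 : coinvTot c n (inclTot k A L (n + 1) (Chain.tmul 1 z))
      = Pi.single (M := fun q : Fin (n + 1) => Chain k A L q) (Fin.last n) z := by
    refine funext fun q => ?_
    rcases eq_or_ne q (Fin.last n) with rfl | hq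
    · refine (congrArg (symCoinv c n) (Pi.single_eq_same (M := fun q : Fin (n + 1) =>
        SymT k A L (q + 1)) (Fin.last n) (psi k A L (n + 1) (Chain.tmul 1 z)))).trans ?_
      rw [symCoinv_psi, firstFace_one_tmul, Pi.single_eq_same]
    · refine (congrArg (symCoinv c q) (Pi.single_eq_of_ne (M := fun q : Fin (n + 1) =>
        SymT k A L (q + 1)) hq (psi k A L (n + 1) (Chain.tmul 1 z)))).trans ?_
      rw [map_zero, Pi.single_eq_of_ne hq]
  have e2 := congrArg (firstFace c n) (hh n (Chain.tmul 1 z))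
  rw [map_sub, ← cycRetract_coinvTot, e1, firstFace_one_tmul, map_add, firstFace_barD] at e2
  refine ⟨firstFace c (n + 1) (h (n + 1) (Chain.tmul 1 z)), ?_⟩
  rw [sub_eq_iff_eq_add'.1 e2]
  -- In positive degrees the second term of the homotopy depends only on the coinvariant class of
  -- `barD (1 ⊗ z)`, which is `b z = 0`. In degree zero the homotopy itself is zero.
  have e3 : firstFace c n (h n (barD k A L n (Chain.tmul 1 z))) = 0 := by
    cases n with
    | zero => rw [h0, LinearMap.zero_apply, map_zero]
    | succ n =>
      refine ((isCoinv_chain c n).desc _ (firstFace_vlin_act c (hV (n + 1))) _).trans ?_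
      have hz' : hochschildB c n z = 0 := hz
      rw [firstFace_barD, firstFace_one_tmul, hz', map_zero, map_zero]
  rw [e3, add_zero]

theorem colRetract_chain : ColRetract (C := Chain k A L) (hochschildB c) (hochschildB' c)
    (signedT c) (normT c) fun n => cycRetract c n ∘ₗ cutTot k (Chain k A L) n where
  congr n g g' h := congrArg (cycRetract c n) (funext fun q : Fin (n + 1) => h q (by omega))
  comm n g := by
    rw [LinearMap.comp_apply, hochschildB_cycRetract, cycD_eq, totD_cutTot]
    rfl
  single n z hz := by
    obtain ⟨u, hu⟩ := exists_cycRetract_single c n z hz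
    refine ⟨u, Eq.trans (congrArg (cycRetract c n) (funext fun q => ?_)) hu⟩
    rw [cutTot_apply]
    rcases eq_or_ne q (Fin.last n) with rfl | hq
    · rw [Pi.single_eq_same]
      exact Pi.single_eq_same (M := Chain k A L) n z
    · rw [Pi.single_eq_of_ne hq]
      exact Pi.single_eq_of_ne (M := Chain k A L) (fun h => hq (Fin.ext h)) z

end Retraction

/-! ### Functoriality of the retraction -/

section FunctorialityRetract

variable {k : Type u} [CommRing k] {X Y : LRData k} (F : X.Hom Y)

/-- Restriction of a module along `V L → V L'`. -/
abbrev LRData.Hom.resMod (M : LMod k (Env k Y.A Y.L)) : LMod k (Env k X.A X.L) where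
  carrier := M.carrier
  act := M.act.comp F.env

theorem LRData.Hom.resMod_actA (M : LMod k (Env k Y.A Y.L)) (a : X.A) (m : M.carrier) :
    (F.resMod M).actA a m = M.actA (F.σ a) m :=
  congrArg (fun h => M.act h m) (F.env_incA a)

theorem LRData.Hom.resMod_actL (M : LMod k (Env k Y.A Y.L)) (x : X.L) (m : M.carrier) :
    (F.resMod M).actL x m = M.actL (F.f x) m :=
  congrArg (fun h => M.act h m) (F.env_incL x)

theorem LRData.Hom.isVLin_res {M N : LMod k (Env k Y.A Y.L)} {g : M.carrier →ₗ[k] N.carrier}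
    (hg : IsVLin M N g) : IsVLin (F.resMod M) (F.resMod N) g := fun h m => hg (F.env h) m

theorem LRData.Hom.σ_epsL (v : Env k X.A X.L) :
    F.σ (epsL k X.A X.L v) = epsL k Y.A Y.L (F.env v) := by
  rw [epsL, F.σ_anchorAct, map_one, epsL]

theorem LRData.Hom.σ_epsR (v : Env k X.A X.L) : F.σ (epsR X.conn v) = epsR Y.conn (F.env v) := by
  rw [epsR_apply, F.σ_rightAct, map_one, epsR_apply]

/-! #### On the chains -/

theorem LRData.Hom.chain_tmul {n : ℕ} (h : Env k X.A X.L) (w : Chain k X.A X.L n) :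
    F.chain (n + 1) (Chain.tmul h w) = Chain.tmul (F.env h) (F.chain n w) :=
  F.indLin_mk (F.chainAux n) h w

theorem LRData.Hom.isVLin_chain (n : ℕ) :
    IsVLin (chainMod k X.A X.L n) (F.resMod (chainMod k Y.A Y.L n)) (F.chain n) := fun g z => by
  cases n with
  | zero => exact F.σ_anchorAct g z
  | succ n =>
    induction z using Chain.induction_on with
    | h h w =>
      rw [Chain.act_tmul, F.chain_tmul, F.chain_tmul, map_mul]
      exact (Chain.act_tmul _ _ _).symm
    | hadd y z hy hz => rw [map_add, map_add, map_add, map_add, hy, hz]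

theorem LRData.Hom.chain_act {n : ℕ} (g : Env k X.A X.L) (w : Chain k X.A X.L n) :
    F.chain n ((chainMod k X.A X.L n).act g w) = (chainMod k Y.A Y.L n).act (F.env g) (F.chain n w) :=
  F.isVLin_chain n g w

theorem LRData.Hom.chain_barFace (n i : ℕ) (w : Chain k X.A X.L (n + 1)) :
    F.chain n ((barFace k X.A X.L n i).1 w) = (barFace k Y.A Y.L n i).1 (F.chain (n + 1) w) := by
  induction w using Chain.induction_on with
  | h h w =>
    rw [F.chain_tmul]
    cases i with
    | zero => rw [barFace_zero_tmul, barFace_zero_tmul, F.chain_act]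
    | succ i =>
      cases n with
      | zero => exact map_zero _
      | succ n =>
        rw [barFace_succ_tmul, barFace_succ_tmul, F.chain_tmul, LRData.Hom.chain_barFace n i w]
  | hadd y z hy hz => simp only [map_add, hy, hz]

theorem LRData.Hom.chain_firstFace (n : ℕ) (w : Chain k X.A X.L (n + 1)) :
    F.chain n (firstFace X.conn n w) = firstFace Y.conn n (F.chain (n + 1) w) := by
  induction w using Chain.induction_on with
  | h h w =>
    rw [F.chain_tmul, firstFace_tmul, firstFace_tmul, ← F.σ_epsR]
    exact (F.chainAux n).2 _ w
  | hadd y z hy hz => simp only [map_add, hy, hz]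

theorem LRData.Hom.chain_face (n i : ℕ) (w : Chain k X.A X.L (n + 1)) :
    F.chain n (face X.conn n i w) = face Y.conn n i (F.chain (n + 1) w) := by
  cases i with
  | zero => exact F.chain_firstFace n w
  | succ i => exact F.chain_barFace n i w

theorem LRData.Hom.chain_barD (n : ℕ) (w : Chain k X.A X.L (n + 1)) :
    F.chain n (barD k X.A X.L n w) = barD k Y.A Y.L n (F.chain (n + 1) w) := by
  simp only [barD, LinearMap.sum_apply, LinearMap.smul_apply, map_sum, map_smul, F.chain_barFace]

theorem LRData.Hom.chain_hochschildB (n : ℕ) (w : Chain k X.A X.L (n + 1)) :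
    F.chain n (hochschildB X.conn n w) = hochschildB Y.conn n (F.chain (n + 1) w) := by
  simp only [hochschildB, LinearMap.sum_apply, LinearMap.smul_apply, map_sum, map_smul,
    F.chain_face]

theorem LRData.Hom.chain_hochschildB' (n : ℕ) (w : Chain k X.A X.L (n + 1)) :
    F.chain n (hochschildB' X.conn n w) = hochschildB' Y.conn n (F.chain (n + 1) w) := by
  simp only [hochschildB', LinearMap.sum_apply, LinearMap.smul_apply, map_sum, map_smul,
    F.chain_face]

/-! #### On the tensor powers -/

theorem LRData.Hom.env_actA (a : X.A) (v : (regMod k X.A X.L).carrier) :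
    F.env.toLinearMap ((regMod k X.A X.L).actA a v)
      = (regMod k Y.A Y.L).actA (F.σ a) (F.env.toLinearMap v) := by
  change F.env (incA k X.A X.L a * v) = incA k Y.A Y.L (F.σ a) * F.env v
  rw [map_mul, F.env_incA]

/-- The map `v ⊗ m ↦ F(v) ⊗ g(m)`, as a `k`-linear map. -/
def LRData.Hom.diagLin {M : LMod k (Env k X.A X.L)} {M' : LMod k (Env k Y.A Y.L)}
    (g : F.SemiHom M M') :
    DiagTensor (regMod k X.A X.L) M →ₗ[k] DiagTensor (regMod k Y.A Y.L) M' :=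
  Bal.map F.σ F.env.toLinearMap g.1 F.env_actA g.2

theorem LRData.Hom.diagLin_mk {M : LMod k (Env k X.A X.L)} {M' : LMod k (Env k Y.A Y.L)}
    (g : F.SemiHom M M') (v : Env k X.A X.L) (m : M.carrier) :
    F.diagLin g (Bal.mk (v : (regMod k X.A X.L).carrier) m) = Bal.mk (F.env v) (g.1 m) :=
  Bal.map_mk F.σ F.env.toLinearMap g.1 F.env_actA g.2 v m

/-- The map `v ⊗ m ↦ F(v) ⊗ g(m)`. -/
def LRData.Hom.diagMap {M : LMod k (Env k X.A X.L)} {M' : LMod k (Env k Y.A Y.L)}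
    (g : F.SemiHom M M') :
    F.SemiHom (diagMod (regMod k X.A X.L) M) (diagMod (regMod k Y.A Y.L) M') :=
  ⟨F.diagLin g, fun a z => by
    induction z using Bal.induction with
    | hmk v m =>
      rw [diagMod_actA_mk, F.diagLin_mk, F.diagLin_mk]
      refine Eq.trans ?_ (diagMod_actA_mk (regMod k Y.A Y.L) M' (F.σ a) (F.env v) (g.1 m)).symm
      exact congrArg (fun v => Bal.mk v (g.1 m)) (F.env_actA a v)
    | hadd y z hy hz => rw [map_add, map_add, hy, hz, map_add, map_add]⟩

/-- The induced map of tensor powers, as a map over `A → A'`. -/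
def LRData.Hom.symAux : (n : ℕ) → F.SemiHom (symTensor k X.A X.L n) (symTensor k Y.A Y.L n)
  | 0 => F.chainAux 0
  | n + 1 => F.diagMap (LRData.Hom.symAux n)

/-- The induced map of tensor powers. -/
def LRData.Hom.sym (n : ℕ) : SymT k X.A X.L n →ₗ[k] SymT k Y.A Y.L n := (F.symAux n).1

theorem LRData.Hom.sym_tmul {n : ℕ} (v : Env k X.A X.L) (z : SymT k X.A X.L n) :
    F.sym (n + 1) (SymT.tmul v z) = SymT.tmul (F.env v) (F.sym n z) :=
  F.diagLin_mk (F.symAux n) v z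

theorem LRData.Hom.sym_actA {n : ℕ} (a : X.A) (z : SymT k X.A X.L n) :
    F.sym n ((symTensor k X.A X.L n).actA a z) = (symTensor k Y.A Y.L n).actA (F.σ a) (F.sym n z) :=
  (F.symAux n).2 a z

theorem LRData.Hom.isVLin_sym (n : ℕ) :
    IsVLin (symTensor k X.A X.L n) (F.resMod (symTensor k Y.A Y.L n)) (F.sym n) := by
  induction n with
  | zero => exact F.σ_anchorAct
  | succ n ih =>
    refine IsVLin.of_gen (fun a z => ?_) fun x z => ?_
    · rw [F.sym_actA, F.resMod_actA]
    · rw [F.resMod_actL]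
      refine LinearMap.congr_fun (f := F.sym (n + 1) ∘ₗ (symTensor k X.A X.L (n + 1)).actL x)
        (g := (symTensor k Y.A Y.L (n + 1)).actL (F.f x) ∘ₗ F.sym (n + 1))
        (SymT.hom_ext fun v z => ?_) z
      rw [LinearMap.comp_apply, LinearMap.comp_apply, SymT.actL_tmul, map_add, F.sym_tmul,
        F.sym_tmul, F.sym_tmul, SymT.actL_tmul, map_mul, F.env_incL]
      have e := ih.actL x z
      rw [F.resMod_actL] at e
      rw [e]

theorem LRData.Hom.sym_symFace (n i : ℕ) (z : SymT k X.A X.L (n + 1)) :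
    F.sym n (symFace k X.A X.L n i z) = symFace k Y.A Y.L n i (F.sym (n + 1) z) := by
  refine LinearMap.congr_fun (f := F.sym n ∘ₗ symFace k X.A X.L n i)
    (g := symFace k Y.A Y.L n i ∘ₗ F.sym (n + 1)) (SymT.hom_ext fun v z => ?_) z
  rw [LinearMap.comp_apply, LinearMap.comp_apply, F.sym_tmul]
  cases i with
  | zero => rw [symFace_zero, symFace_zero, F.sym_actA, F.σ_epsL]
  | succ i =>
    cases n with
    | zero => exact map_zero _
    | succ n => rw [symFace_succ, symFace_succ, F.sym_tmul, LRData.Hom.sym_symFace n i z]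

theorem LRData.Hom.sym_symSwap (n : ℕ) (z : SymT k X.A X.L (n + 2)) :
    F.sym (n + 2) (symSwap k X.A X.L n z) = symSwap k Y.A Y.L n (F.sym (n + 2) z) := by
  refine LinearMap.congr_fun (f := F.sym (n + 2) ∘ₗ symSwap k X.A X.L n)
    (g := symSwap k Y.A Y.L n ∘ₗ F.sym (n + 2)) (SymT.hom_ext₂ fun v v' z => ?_) z
  rw [LinearMap.comp_apply, LinearMap.comp_apply, symSwap_tmul, F.sym_tmul, F.sym_tmul, F.sym_tmul,
    F.sym_tmul, symSwap_tmul]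

theorem LRData.Hom.sym_symRot (n : ℕ) (z : SymT k X.A X.L (n + 1)) :
    F.sym (n + 1) (symRot k X.A X.L (n + 1) z) = symRot k Y.A Y.L (n + 1) (F.sym (n + 1) z) := by
  cases n with
  | zero => rw [symRot_one, symRot_one]; rfl
  | succ n =>
    refine LinearMap.congr_fun (f := F.sym (n + 2) ∘ₗ symRot k X.A X.L (n + 2))
      (g := symRot k Y.A Y.L (n + 2) ∘ₗ F.sym (n + 2)) (SymT.hom_ext fun v z => ?_) z
    rw [LinearMap.comp_apply, LinearMap.comp_apply, symRot_tmul, F.sym_symSwap, F.sym_tmul,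
      F.sym_tmul, LRData.Hom.sym_symRot n z, symRot_tmul]

theorem LRData.Hom.sym_symSFace (n i : ℕ) (z : SymT k X.A X.L (n + 2)) :
    F.sym (n + 1) (symSFace k X.A X.L n i z) = symSFace k Y.A Y.L n i (F.sym (n + 2) z) := by
  rw [symSFace, LinearMap.smul_apply, map_smul, F.sym_symFace]
  rfl

theorem LRData.Hom.sym_symB (n : ℕ) (z : SymT k X.A X.L (n + 2)) :
    F.sym (n + 1) (symB k X.A X.L n z) = symB k Y.A Y.L n (F.sym (n + 2) z) := by
  simp only [symB, faceSum, LinearMap.sum_apply, map_sum, F.sym_symSFace]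

theorem LRData.Hom.sym_symB' (n : ℕ) (z : SymT k X.A X.L (n + 2)) :
    F.sym (n + 1) (symB' k X.A X.L n z) = symB' k Y.A Y.L n (F.sym (n + 2) z) := by
  simp only [symB', faceSum, LinearMap.sum_apply, map_sum, F.sym_symSFace]

theorem LRData.Hom.sym_symLam (n : ℕ) (z : SymT k X.A X.L (n + 1)) :
    F.sym (n + 1) (symLam k X.A X.L n z) = symLam k Y.A Y.L n (F.sym (n + 1) z) := by
  rw [symLam, LinearMap.smul_apply, map_smul, F.sym_symRot]
  rfl

theorem LRData.Hom.sym_symLam_pow (n j : ℕ) (z : SymT k X.A X.L (n + 1)) :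
    F.sym (n + 1) ((symLam k X.A X.L n ^ j) z) = (symLam k Y.A Y.L n ^ j) (F.sym (n + 1) z) := by
  induction j with
  | zero => rfl
  | succ j ih => rw [pow_succ', pow_succ', Module.End.mul_apply, F.sym_symLam, ih]; rfl

theorem LRData.Hom.sym_symNorm (n : ℕ) (z : SymT k X.A X.L (n + 1)) :
    F.sym (n + 1) (symNorm k X.A X.L n z) = symNorm k Y.A Y.L n (F.sym (n + 1) z) := by
  simp only [symNorm, normOp, LinearMap.sum_apply, map_sum, F.sym_symLam_pow]

theorem LRData.Hom.sym_psi (n : ℕ) (w : Chain k X.A X.L n) :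
    F.sym n (psi k X.A X.L n w) = psi k Y.A Y.L n (F.chain n w) := by
  cases n with
  | zero => rfl
  | succ n =>
    refine LinearMap.congr_fun (f := F.sym (n + 1) ∘ₗ (psi k X.A X.L (n + 1)).toLinearMap)
      (g := (psi k Y.A Y.L (n + 1)).toLinearMap ∘ₗ F.chain (n + 1))
      (chain_ext (N := F.resMod (symTensor k Y.A Y.L (n + 1)))
        ((F.isVLin_sym (n + 1)).comp (isVLin_psi (n + 1)))
        (IsVLin.comp (N := F.resMod (chainMod k Y.A Y.L (n + 1))) (F.isVLin_res (isVLin_psi (n + 1)))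
          (F.isVLin_chain (n + 1))) fun w => ?_) w
    rw [LinearMap.comp_apply, LinearMap.comp_apply, LinearEquiv.coe_coe, LinearEquiv.coe_coe,
      psi_one_tmul, F.sym_tmul, F.chain_tmul, map_one, psi_one_tmul, LRData.Hom.sym_psi n w]

theorem LRData.Hom.chain_symCoinv (n : ℕ) (z : SymT k X.A X.L (n + 1)) :
    F.chain n (symCoinv X.conn n z) = symCoinv Y.conn n (F.sym (n + 1) z) := by
  obtain ⟨w, rfl⟩ := (psi k X.A X.L (n + 1)).surjective z
  rw [symCoinv_psi, F.chain_firstFace, F.sym_psi, symCoinv_psi]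

/-- On the tensor powers this is evident, as the rotation permutes factors. It descends along
`symCoinv`, which avoids computing with the antipode. -/
theorem LRData.Hom.chain_signedT (n : ℕ) (w : Chain k X.A X.L n) :
    F.chain n (signedT X.conn n w) = signedT Y.conn n (F.chain n w) := by
  obtain ⟨z, rfl⟩ := symCoinv_surjective X.conn n w
  rw [← symCoinv_symLam, F.chain_symCoinv, F.chain_symCoinv, F.sym_symLam, symCoinv_symLam]

theorem LRData.Hom.chain_normT (n : ℕ) (w : Chain k X.A X.L n) :
    F.chain n (normT X.conn n w) = normT Y.conn n (F.chain n w) := by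
  obtain ⟨z, rfl⟩ := symCoinv_surjective X.conn n w
  rw [← symCoinv_normOp, F.chain_symCoinv, F.chain_symCoinv, ← symCoinv_normOp]
  exact congrArg _ (F.sym_symNorm n z)

/-! #### On the total complexes -/

theorem LRData.Hom.cycTot_cycD (n : ℕ) (x : CycTot k X.A X.L (n + 1)) :
    F.cycTot n (cycD X.conn n x) = cycD Y.conn n (F.cycTot (n + 1) x) := by
  rw [cycD_eq, cycD_eq]
  exact totD_map (C := Chain k X.A X.L) (C' := Chain k Y.A Y.L)
    (fun n => (F.chain n).toAddMonoidHom) F.chain_hochschildB F.chain_hochschildB' F.chain_signedT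
    F.chain_normT n x

/-- The induced map of the total complexes of the tensor powers. -/
def LRData.Hom.tot : (n : ℕ) → (totMod k X.A X.L n).carrier →ₗ[k] (totMod k Y.A Y.L n).carrier
  | 0 => F.chain 0
  | n + 1 => LinearMap.pi fun q : Fin (n + 1) => F.sym (q + 1) ∘ₗ
      LinearMap.proj (φ := fun q : Fin (n + 1) => SymT k X.A X.L (q + 1)) q

theorem LRData.Hom.isVLin_tot (n : ℕ) :
    IsVLin (totMod k X.A X.L n) (F.resMod (totMod k Y.A Y.L n)) (F.tot n) := by
  cases n with
  | zero => exact F.isVLin_chain 0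
  | succ n =>
    exact fun h x => funext fun q : Fin (n + 1) => F.isVLin_sym (q + 1) h (x q)

theorem LRData.Hom.tot_totDiff (n : ℕ) (x : (totMod k X.A X.L (n + 1)).carrier) :
    F.tot n (totDiff k X.A X.L n x) = totDiff k Y.A Y.L n (F.tot (n + 1) x) := by
  cases n with
  | zero => exact F.sym_symFace 0 0 _
  | succ n =>
    exact totD_map (C := fun n => SymT k X.A X.L (n + 1)) (C' := fun n => SymT k Y.A Y.L (n + 1))
      (fun n => (F.sym (n + 1)).toAddMonoidHom) F.sym_symB F.sym_symB' F.sym_symLam F.sym_symNorm n x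

theorem LRData.Hom.coinvTot_tot (n : ℕ) (x : (totMod k X.A X.L (n + 1)).carrier) :
    coinvTot Y.conn n (F.tot (n + 1) x) = F.cycTot n (coinvTot X.conn n x) :=
  funext fun q : Fin (n + 1) => (F.chain_symCoinv q (x q)).symm

variable [Algebra ℚ k]

/-- Both composites lift `A → A'` from a complex of projective `V L`-modules to the bar resolution
of `A'`, which remains exact when restricted along `V L → V L'`. -/
theorem LRData.Hom.exists_homotopy_rho :
    ∃ h : ∀ n, (totMod k X.A X.L n).carrier →ₗ[k] Chain k Y.A Y.L (n + 1), h 0 = 0 ∧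
      (∀ n, IsVLin (totMod k X.A X.L n) (F.resMod (chainMod k Y.A Y.L (n + 1))) (h n)) ∧
      ∀ n x, F.chain (n + 1) (rho k X.A X.L (n + 1) x) - rho k Y.A Y.L (n + 1) (F.tot (n + 1) x)
        = barD k Y.A Y.L (n + 1) (h (n + 1) x) + h n (totDiff k X.A X.L n x) :=
  exists_homotopy (P := totMod k X.A X.L) (E := fun n => F.resMod (chainMod k Y.A Y.L n))
    (d := totDiff k X.A X.L) (e := barD k Y.A Y.L) vProj_totMod isVLin_totDiff totDiff_totDiff
    (fun n => F.isVLin_res (isVLin_barD n)) barD_exact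
    (f := fun n => F.chain n ∘ₗ rho k X.A X.L n) (g := fun n => rho k Y.A Y.L n ∘ₗ F.tot n)
    (fun n => (F.isVLin_chain n).comp (isVLin_rho n))
    (fun n => IsVLin.comp (N := F.resMod (totMod k Y.A Y.L n)) (F.isVLin_res (isVLin_rho n))
      (F.isVLin_tot n))
    (fun n x => by rw [LinearMap.comp_apply, ← F.chain_barD, barD_rho, LinearMap.comp_apply])
    (fun n x => by rw [LinearMap.comp_apply, barD_rho, ← F.tot_totDiff, LinearMap.comp_apply])
    (by rw [rho_zero, rho_zero]; rfl)

theorem LRData.Hom.exists_chain_cycRetract (n : ℕ) (z : CycTot k X.A X.L n)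
    (hz : z ∈ cycles (cycD X.conn) n) : ∃ u, F.chain n (cycRetract X.conn n z)
      = cycRetract Y.conn n (F.cycTot n z) + hochschildB Y.conn n u := by
  obtain ⟨h, h0, hV, hh⟩ := F.exists_homotopy_rho
  obtain ⟨y, rfl⟩ := coinvTot_surjective X.conn n z
  have e := congrArg (firstFace Y.conn n) (hh n y)
  rw [map_sub, map_add, firstFace_barD, ← F.chain_firstFace, ← cycRetract_coinvTot,
    ← cycRetract_coinvTot, F.coinvTot_tot] at e
  refine ⟨firstFace Y.conn (n + 1) (h (n + 1) y), ?_⟩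
  rw [sub_eq_iff_eq_add'.1 e]
  -- The second term of the homotopy sees only the coinvariant class of the total boundary of `y`,
  -- which vanishes because `y` represents a cycle.
  have e3 : firstFace Y.conn n (h n (totDiff k X.A X.L n y)) = 0 := by
    cases n with
    | zero => rw [h0, LinearMap.zero_apply, map_zero]
    | succ n =>
      refine ((isCoinv_tot X.conn n).desc (firstFace Y.conn (n + 1) ∘ₗ h (n + 1))
        (fun v m => ?_) _).trans ?_
      · rw [LinearMap.comp_apply, hV, LinearMap.comp_apply, (hV _).actA, F.resMod_actA, F.σ_epsR]
        exact firstFace_act Y.conn _ _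
      · have hz' : cycD X.conn n (coinvTot X.conn (n + 1) y) = 0 := hz
        rw [coinvTot_totDiff, hz', map_zero, map_zero]
  rw [e3, add_zero]

end FunctorialityRetract

/-! ### Homology in the category of modules -/

section HomologyBridge

variable {k : Type u} [CommRing k] {C : ℕ → Type u} [∀ n, AddCommGroup (C n)]
  [∀ n, Module k (C n)] {d : ∀ n, C (n + 1) →ₗ[k] C n} {K : ChainComplex (ModuleCat.{u} k) ℕ}
  (e : ∀ n, C n ≃ₗ[k] K.X n) (he : ∀ n x, (K.d (n + 1) n).hom (e (n + 1) x) = e n (d n x))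

theorem cycles_comp_d (he : ∀ n x, (K.d (n + 1) n).hom (e (n + 1) x) = e n (d n x)) (n : ℕ) :
    ModuleCat.ofHom ((e n).toLinearMap ∘ₗ (cycles d n).subtype) ≫
      K.d n ((ComplexShape.down ℕ).next n) = 0 := by
  cases n with
  | zero => rw [K.shape _ _ (by simp), Limits.comp_zero]
  | succ n =>
    rw [ChainComplex.next_nat_succ]
    refine ModuleCat.hom_ext (LinearMap.ext fun z => ?_)
    refine (he n z.1).trans ?_
    have hz : d n z.1 = 0 := z.2
    rw [hz, map_zero]
    rfl

/-- The map from cycles to the cycles of an isomorphic complex. -/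
def cyclesLift (n : ℕ) : ModuleCat.of k (cycles d n) ⟶ K.cycles n :=
  K.liftCycles (ModuleCat.ofHom ((e n).toLinearMap ∘ₗ (cycles d n).subtype)) _ rfl
    (cycles_comp_d e he n)

theorem iCycles_cyclesLift (n : ℕ) (z : cycles d n) :
    (K.iCycles n).hom ((cyclesLift e he n).hom z) = e n z := by
  have := K.liftCycles_i (ModuleCat.ofHom ((e n).toLinearMap ∘ₗ (cycles d n).subtype)) _ rfl
    (cycles_comp_d e he n)
  exact LinearMap.congr_fun (congrArg ModuleCat.Hom.hom this) z

theorem iCycles_injective (n : ℕ) : Function.Injective (K.iCycles n).hom :=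
  (ModuleCat.mono_iff_injective _).1 inferInstance

theorem cyclesLift_surjective (n : ℕ) : Function.Surjective (cyclesLift e he n).hom := fun c => by
  have hc : (e n).symm ((K.iCycles n).hom c) ∈ cycles d n := by
    cases n with
    | zero => trivial
    | succ n =>
      refine (e n).injective ?_
      rw [← he, LinearEquiv.apply_symm_apply, map_zero]
      exact LinearMap.congr_fun (congrArg ModuleCat.Hom.hom (K.iCycles_d (n + 1) n)) c
  refine ⟨⟨_, hc⟩, iCycles_injective n ?_⟩
  rw [iCycles_cyclesLift, LinearEquiv.apply_symm_apply]

theorem homologyπ_eq_zero_iff (n : ℕ) (c : K.cycles n) :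
    (K.homologyπ n).hom c = 0 ↔ ∃ x : K.X (n + 1), (K.toCycles (n + 1) n).hom x = c := by
  have h : (ShortComplex.mk (K.toCycles (n + 1) n) (K.homologyπ n) (by simp)).Exact :=
    ShortComplex.exact_of_g_is_cokernel _ (K.homologyIsCokernel (n + 1) n (by simp))
  constructor
  · exact (ShortComplex.moduleCat_exact_iff _).1 h c
  · rintro ⟨x, rfl⟩
    exact LinearMap.congr_fun (congrArg ModuleCat.Hom.hom (K.toCycles_comp_homologyπ (n + 1) n)) x

/-- The map from cycles to the homology of an isomorphic complex. -/
def homologyLift (n : ℕ) : cycles d n →ₗ[k] K.homology n :=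
  (K.homologyπ n).hom ∘ₗ (cyclesLift e he n).hom

theorem homologyLift_surjective (n : ℕ) : Function.Surjective (homologyLift e he n) :=
  ((ModuleCat.epi_iff_surjective (K.homologyπ n)).1 inferInstance).comp
    (cyclesLift_surjective e he n)

theorem ker_homologyLift (n : ℕ) : boundaries d n = LinearMap.ker (homologyLift e he n) := by
  ext z
  rw [LinearMap.mem_ker, homologyLift, LinearMap.comp_apply, homologyπ_eq_zero_iff]
  have h : ∀ x, (K.iCycles n).hom ((K.toCycles (n + 1) n).hom x) = (K.d (n + 1) n).hom x :=
    fun x => LinearMap.congr_fun (congrArg ModuleCat.Hom.hom (K.toCycles_i (n + 1) n)) x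
  constructor
  · rintro ⟨y, hy⟩
    refine ⟨e (n + 1) y, iCycles_injective n ?_⟩
    rw [h, he, iCycles_cyclesLift, hy]
    rfl
  · rintro ⟨x, hx⟩
    refine ⟨(e (n + 1)).symm x, (e n).injective ?_⟩
    rw [← he, LinearEquiv.apply_symm_apply, ← h, hx, iCycles_cyclesLift]
    rfl

/-- The homology of a sequence of linear maps is the homology of an isomorphic complex. -/
def homologyEquiv (n : ℕ) : Homology d n ≃ₗ[k] K.homology n :=
  (Submodule.quotEquivOfEq _ _ (ker_homologyLift e he n)).trans
    ((homologyLift e he n).quotKerEquivOfSurjective (homologyLift_surjective e he n))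

theorem homologyEquiv_mk (n : ℕ) (z : cycles d n) :
    homologyEquiv e he n (Submodule.Quotient.mk z) = (K.homologyπ n).hom ((cyclesLift e he n).hom z) :=
  rfl

/-- Cycles of a complex embed into its chains, so equality of the two classes can be checked on
chains. -/
theorem homologyMap_homologyEquiv {C' : ℕ → Type u} [∀ n, AddCommGroup (C' n)]
    [∀ n, Module k (C' n)] {d' : ∀ n, C' (n + 1) →ₗ[k] C' n} {K' : ChainComplex (ModuleCat.{u} k) ℕ}
    (e' : ∀ n, C' n ≃ₗ[k] K'.X n) (he' : ∀ n x, (K'.d (n + 1) n).hom (e' (n + 1) x) = e' n (d' n x))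
    (φ : K ⟶ K') (n : ℕ) (z : cycles d n) (z' : cycles d' n)
    (hz : (φ.f n).hom (e n z) = e' n z') :
    (HomologicalComplex.homologyMap φ n).hom (homologyEquiv e he n (Submodule.Quotient.mk z))
      = homologyEquiv e' he' n (Submodule.Quotient.mk z') := by
  rw [homologyEquiv_mk, homologyEquiv_mk]
  refine (LinearMap.congr_fun (congrArg ModuleCat.Hom.hom
    (HomologicalComplex.homologyπ_naturality φ n)) ((cyclesLift e he n).hom z)).trans ?_
  refine congrArg (K'.homologyπ n).hom (iCycles_injective n ?_)
  refine (LinearMap.congr_fun (congrArg ModuleCat.Hom.hom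
    (HomologicalComplex.cyclesMap_i φ n)) ((cyclesLift e he n).hom z)).trans ?_
  rw [iCycles_cyclesLift, ← hz, ← iCycles_cyclesLift e he n z]
  rfl

end HomologyBridge

/-! ### Projective resolutions from exact sequences -/

section ResolutionOfExact

universe v w

variable {𝒞 : Type w} [Category.{v} 𝒞] [Abelian 𝒞] {Z : 𝒞}

/-- The projective resolution given by an exact sequence. -/
def resolutionOfExact (P : ℕ → 𝒞) (hP : ∀ n, Projective (P n)) (d : ∀ n, P (n + 1) ⟶ P n)
    (hd : ∀ n, d (n + 1) ≫ d n = 0) (π : P 0 ⟶ Z) (hπ : d 0 ≫ π = 0) (hepi : Epi π)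
    (h0 : (ShortComplex.mk _ _ hπ).Exact) (h : ∀ n, (ShortComplex.mk _ _ (hd n)).Exact) :
    ProjectiveResolution Z where
  complex := ChainComplex.of P d hd
  projective := hP
  π := (ChainComplex.toSingle₀Equiv (ChainComplex.of P d hd) Z).symm ⟨π, by
    refine Eq.trans ?_ hπ
    exact congrArg (· ≫ π) (ChainComplex.of_d P d 0)⟩
  quasiIso := ⟨fun n => by
    cases n with
    | zero =>
      -- In degree zero, being a quasi-isomorphism to the single complex means that `P 1 → P 0 → Z`
      -- is exact and `π` an epimorphism.
      rw [ChainComplex.quasiIsoAt₀_iff, ShortComplex.quasiIso_iff_of_zeros']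
      · refine (ShortComplex.exact_and_epi_g_iff_of_iso ?_).2 ⟨h0, by dsimp; infer_instance⟩
        refine ShortComplex.isoMk (Iso.refl _) (Iso.refl _) (Iso.refl _) ?_ ?_
        · exact (Category.id_comp _).trans
            ((ChainComplex.of_d P d 0).symm.trans (Category.comp_id _).symm)
        · exact (Category.id_comp _).trans
            ((ChainComplex.toSingle₀Equiv_symm_apply_f_zero (C := ChainComplex.of P d hd) π _).symm.trans
              (Category.comp_id _).symm)
      all_goals rfl
    | succ n =>
      -- In positive degrees the single complex is exact, so only exactness of the given sequence
      -- remains.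
      rw [quasiIsoAt_iff_exactAt' _ _ (ChainComplex.exactAt_succ_single_obj _ _),
        HomologicalComplex.exactAt_iff' _ (n + 2) (n + 1) n (by simp) (by simp)]
      refine ShortComplex.exact_of_iso ?_ (h n)
      refine ShortComplex.isoMk (Iso.refl _) (Iso.refl _) (Iso.refl _) ?_ ?_
      · exact (Category.id_comp _).trans
          ((ChainComplex.of_d P d (n + 1)).trans (Category.comp_id _).symm)
      · exact (Category.id_comp _).trans
          ((ChainComplex.of_d P d n).trans (Category.comp_id _).symm)⟩

end ResolutionOfExact

/-! ### Modules over the enveloping algebra as objects of the category of modules -/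

section ModuleBridge

variable {k A L : Type u} [CommRing k] [CommRing A] [LieRing L] [Module A L]
  [LieRingModule L A] [Algebra k A] [LieAlgebra k L]

/-- The identity of `M`, as a map to the restriction of scalars of `M.toModuleCat`. -/
def LMod.toOf (M : LMod k (Env k A L)) :
    M.carrier ≃ₗ[k] (LMod.ofModuleCat k M.toModuleCat).carrier where
  toFun m := m
  invFun m := m
  left_inv _ := rfl
  right_inv _ := rfl
  map_add' _ _ := rfl
  map_smul' r m := by
    have h : r • m = M.act (algebraMap k _ r) m := by
      rw [AlgHom.commutes, Module.algebraMap_end_apply]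
    exact h

/-- The morphism of modules given by a linear map. -/
def IsVLin.toHomOf {M : LMod k (Env k A L)} {P : ModuleCat.{u} (Env k A L)}
    {f : M.carrier →ₗ[k] (LMod.ofModuleCat k P).carrier} (hf : IsVLin M (LMod.ofModuleCat k P) f) :
    M.toModuleCat ⟶ P :=
  letI : Module (Env k A L) M.carrier := Module.compHom M.carrier M.act.toRingHom
  ModuleCat.ofHom (X := M.carrier) (Y := P)
    { toFun := f
      map_add' := map_add f
      map_smul' := hf }

/-- The morphism of modules given by a linear map. -/
def IsVLin.toHom {M N : LMod k (Env k A L)} {f : M.carrier →ₗ[k] N.carrier} (hf : IsVLin M N f) :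
    M.toModuleCat ⟶ N.toModuleCat :=
  letI : Module (Env k A L) M.carrier := Module.compHom M.carrier M.act.toRingHom
  letI : Module (Env k A L) N.carrier := Module.compHom N.carrier N.act.toRingHom
  ModuleCat.ofHom (X := M.carrier) (Y := N.carrier)
    { toFun := f
      map_add' := map_add f
      map_smul' := hf }

/-- An epimorphism of modules is surjective, so the condition on the range holds automatically. -/
theorem VProj.projective {M : LMod k (Env k A L)} (hM : VProj M) : Projective M.toModuleCat where
  factors {E X} f e he := by
    obtain ⟨h, hV, hh⟩ := hM (LMod.ofModuleCat k E) (LMod.ofModuleCat k X)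
      (linOver k f ∘ₗ M.toOf.toLinearMap) (linOver k e) (fun v m => linOver_act f v (M.toOf m))
      (linOver_act e) fun m => (ModuleCat.epi_iff_surjective e).1 he _
    exact ⟨hV.toHomOf, ModuleCat.hom_ext (LinearMap.ext fun m => LinearMap.congr_fun hh m)⟩

theorem IsVLin.toHom_comp_toHom {M N P : LMod k (Env k A L)} {f : M.carrier →ₗ[k] N.carrier}
    {g : N.carrier →ₗ[k] P.carrier} (hf : IsVLin M N f) (hg : IsVLin N P g)
    (h : ∀ m, g (f m) = 0) : hf.toHom ≫ hg.toHom = 0 :=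
  ModuleCat.hom_ext (LinearMap.ext h)

theorem IsVLin.exact_toHom {M N P : LMod k (Env k A L)} {f : M.carrier →ₗ[k] N.carrier}
    {g : N.carrier →ₗ[k] P.carrier} (hf : IsVLin M N f) (hg : IsVLin N P g)
    (h : hf.toHom ≫ hg.toHom = 0) (he : ∀ n, g n = 0 → ∃ m, f m = n) :
    (ShortComplex.mk _ _ h).Exact :=
  (ShortComplex.moduleCat_exact_iff _).2 he

end ModuleBridge

/-! ### The bar resolution -/

section BarResolution

variable {k A L : Type u} [CommRing k] [CommRing A] [LieRing L] [Module A L]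
  [LieRingModule L A] [LieRinehartRing A L] [Algebra k A] [LieAlgebra k L]
  [LieRinehartAlgebra k A L]

variable (k A L) in
/-- The differential of the bar resolution. -/
def barHom (n : ℕ) : (chainMod k A L (n + 1)).toModuleCat ⟶ (chainMod k A L n).toModuleCat :=
  (isVLin_barD n).toHom

theorem barHom_comp (n : ℕ) : barHom k A L (n + 1) ≫ barHom k A L n = 0 :=
  (isVLin_barD (n + 1)).toHom_comp_toHom (isVLin_barD n) (barD_barD n)

variable [Algebra ℚ k] [Module.Projective A L]

variable (k A L) in
/-- The bar resolution of `A`. -/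
def barRes : ProjectiveResolution (baseMod k A L).toModuleCat :=
  resolutionOfExact (fun n => (chainMod k A L (n + 1)).toModuleCat)
    (fun n => (vProj_chainMod n).projective) (fun n => barHom k A L (n + 1))
    (fun n => barHom_comp (n + 1)) (barHom k A L 0) (barHom_comp 0)
    ((ModuleCat.epi_iff_surjective _).2 (barD_surjective (k := k) (A := A) (L := L)))
    ((isVLin_barD 1).exact_toHom (isVLin_barD 0) (barHom_comp 0) fun w hw =>
      barD_exact 0 w hw)
    (fun n => (isVLin_barD (n + 2)).exact_toHom (isVLin_barD (n + 1)) (barHom_comp (n + 1))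
      fun w hw => barD_exact (n + 1) w hw)

theorem barRes_d (n : ℕ) : (barRes k A L).complex.d (n + 1) n = barHom k A L (n + 1) :=
  ChainComplex.of_d (fun n => (chainMod k A L (n + 1)).toModuleCat)
    (fun n => barHom k A L (n + 1)) n

theorem barRes_π : (barRes k A L).π.f 0 = barHom k A L 0 :=
  ChainComplex.toSingle₀Equiv_symm_apply_f_zero (C := (barRes k A L).complex) _ _

end BarResolution

/-! ### Coinvariants as tensor products -/

section TensorCoinv

variable {k A L : Type u} [CommRing k] [CommRing A] [LieRing L] [Module A L]
  [LieRingModule L A] [LieRinehartRing A L] [Algebra k A] [LieAlgebra k L]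
  [LieRinehartAlgebra k A L] {c : FlatRightConnection k A L} {M : LMod k (Env k A L)}

variable (c M) in
/-- The map `m ↦ 1 ⊗ m`. -/
def tensorOne : M.carrier →ₗ[k] TensorOver (rightAct c) M.toModuleCat :=
  Bal.mkBilin _ _ (1 : A) ∘ₗ M.toOf.toLinearMap

theorem tensorOne_act (h : Env k A L) (m : M.carrier) :
    tensorOne c M (M.act h m) = Bal.mk (epsR c h) (M.toOf m) :=
  (Bal.mk_rel (α := fun v : Env k A L => (rightAct c v).unop)
    (β := fun v : Env k A L => (LMod.ofModuleCat k M.toModuleCat).act v) h (1 : A) (M.toOf m)).symm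

theorem tensorOne_actA (a : A) (m : M.carrier) :
    tensorOne c M (M.actA a m) = Bal.mk a (M.toOf m) := by
  refine (tensorOne_act (incA k A L a) m).trans ?_
  rw [epsR_apply, rightAct_incA, mul_one]

variable {N : Type u} [AddCommGroup N] [Module k N] {q : M.carrier →ₗ[k] N}
  {s : N →ₗ[k] M.carrier}

/-- The map `a ⊗ m ↦ q (a m)` to the coinvariants. -/
def IsCoinv.ofTensor (H : IsCoinv c M q s) : TensorOver (rightAct c) M.toModuleCat →ₗ[k] N :=
  Bal.lift (((M.act.toLinearMap ∘ₗ (incA k A L).toLinearMap).compl₂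
    M.toOf.symm.toLinearMap).compr₂ q) fun v a m => by
    change q (M.actA ((rightAct c v).unop a) (M.toOf.symm m))
      = q (M.act (incA k A L a) (M.act v (M.toOf.symm m)))
    rw [← Module.End.mul_apply, ← map_mul, H.act, epsR_incA_mul]

theorem IsCoinv.ofTensor_mk (H : IsCoinv c M q s) (a : A) (m : M.carrier) :
    H.ofTensor (Bal.mk a (M.toOf m)) = q (M.actA a m) :=
  Bal.lift_mk _ _ _ _

/-- The coinvariants are the tensor product with `A_∇`. -/
def IsCoinv.equivTensor (H : IsCoinv c M q s) : N ≃ₗ[k] TensorOver (rightAct c) M.toModuleCat :=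
  LinearEquiv.ofLinearMap (tensorOne c M ∘ₗ s) H.ofTensor
    (Bal.hom_ext fun a m => by
      refine (congrArg (fun y => tensorOne c M (s y)) (H.ofTensor_mk a (M.toOf.symm m))).trans ?_
      refine (H.desc (tensorOne c M) (fun h m => ?_) _).symm.trans (tensorOne_actA a _)
      rw [tensorOne_act, tensorOne_actA])
    (LinearMap.ext fun y => by
      refine (H.ofTensor_mk 1 (s y)).trans ?_
      rw [LMod.actA, map_one, map_one, Module.End.one_apply, H.apply_section]
      rfl)

theorem IsCoinv.equivTensor_apply (H : IsCoinv c M q s) (m : M.carrier) :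
    H.equivTensor (q m) = tensorOne c M m :=
  (H.desc (tensorOne c M) (fun h m => by rw [tensorOne_act, tensorOne_actA]) m).symm

end TensorCoinv

/-! ### Hochschild homology is Lie-Rinehart homology -/

section HochschildTor

variable {k A L : Type u} [CommRing k] [CommRing A] [LieRing L] [Module A L]
  [LieRingModule L A] [LieRinehartRing A L] [Algebra k A] [LieAlgebra k L]
  [LieRinehartAlgebra k A L] [Algebra ℚ k] [Module.Projective A L]
  (c : FlatRightConnection k A L)

/-- The complex computing Lie-Rinehart homology from the bar resolution. -/
abbrev barTensor : ChainComplex (ModuleCat.{u} k) ℕ :=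
  ((tensorFunctor (rightAct c)).mapHomologicalComplex _).obj (barRes k A L).complex

/-- The chains as the tensor product of `A_∇` with the bar resolution. -/
def chainEquiv (n : ℕ) : Chain k A L n ≃ₗ[k] (barTensor c).X n := (isCoinv_chain c n).equivTensor

/-- The differential on the tensor product is read off on the representatives `1 ⊗ w`, where
`firstFace_barD` turns the bar differential into `b`. -/
theorem barTensor_d (n : ℕ) (w : Chain k A L (n + 1)) :
    ((barTensor c).d (n + 1) n).hom (chainEquiv c (n + 1) w) = chainEquiv c n (hochschildB c n w) := by
  have e : (barTensor c).d (n + 1) n = (tensorFunctor (rightAct c)).map (barHom k A L (n + 1)) :=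
    congrArg (tensorFunctor (rightAct c)).map (barRes_d n)
  rw [e]
  refine (tensorMap_mk (rightAct c) (barHom k A L (n + 1)) (1 : A) _).trans ?_
  refine ((isCoinv_chain c n).equivTensor_apply _).symm.trans ?_
  exact congrArg (chainEquiv c n) ((firstFace_barD c n (Chain.tmul 1 w)).trans
    (congrArg (hochschildB c n) (firstFace_one_tmul c w)))

/-- Dual Hopf-Hochschild homology is Lie-Rinehart homology. -/
def hochschildEquiv (n : ℕ) : HH c n ≃ₗ[k] lrHomology c n :=
  (homologyEquiv (chainEquiv c) (barTensor_d c) n).trans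
    ((barRes k A L).isoLeftDerivedObj (tensorFunctor (rightAct c)) n).symm.toLinearEquiv

theorem hochschildEquiv_mk (n : ℕ) (z : cycles (hochschildB c) n) :
    hochschildEquiv c n (Submodule.Quotient.mk z)
      = ((barRes k A L).isoLeftDerivedObj (tensorFunctor (rightAct c)) n).inv.hom
        (homologyEquiv (chainEquiv c) (barTensor_d c) n (Submodule.Quotient.mk z)) := rfl

end HochschildTor

/-! ### Naturality of the Hochschild isomorphism. -/

section HochschildNatural

variable {k : Type u} [CommRing k] [Algebra ℚ k] {X Y : LRData k} (F : X.Hom Y)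

/-- The map induced on the modules of the bar resolutions. -/
def LRData.Hom.chainHom (n : ℕ) : (chainMod k X.A X.L n).toModuleCat ⟶
    F.res.obj (chainMod k Y.A Y.L n).toModuleCat :=
  (F.isVLin_chain n).toHom

theorem LRData.Hom.chainHom_comp (n : ℕ) : F.chainHom (n + 1) ≫ F.res.map (barHom k Y.A Y.L n)
    = barHom k X.A X.L n ≫ F.chainHom n :=
  ModuleCat.hom_ext (LinearMap.ext fun w => (F.chain_barD n w).symm)

/-- The map induced on the bar resolutions. -/
def LRData.Hom.barMap : (barRes k X.A X.L).complex ⟶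
    (F.res.mapHomologicalComplex _).obj (barRes k Y.A Y.L).complex where
  f n := F.chainHom (n + 1)
  comm' i j hij := by
    obtain rfl : j + 1 = i := hij
    refine Eq.trans (congrArg (F.chainHom (j + 2) ≫ ·) (congrArg F.res.map (barRes_d j))) ?_
    refine Eq.trans ?_ (congrArg (· ≫ F.chainHom (j + 1)) (barRes_d j)).symm
    exact F.chainHom_comp (j + 1)

theorem LRData.Hom.barMap_augmentation :
    F.barMap.f 0 ≫ F.res.map ((barRes k Y.A Y.L).π.f 0) = (barRes k X.A X.L).π.f 0 ≫ F.baseHom := by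
  refine Eq.trans (congrArg (F.chainHom 1 ≫ ·) (congrArg F.res.map barRes_π)) ?_
  refine Eq.trans ?_ (congrArg (· ≫ F.baseHom) barRes_π).symm
  exact F.chainHom_comp 0

/-- The map induced on the complexes that compute Lie-Rinehart homology. -/
def LRData.Hom.barTensorMap : barTensor X.conn ⟶ barTensor Y.conn :=
  ((tensorFunctor (rightAct X.conn)).mapHomologicalComplex _).map F.barMap ≫
    (NatTrans.mapHomologicalComplex F.tensorNat _).app (barRes k Y.A Y.L).complex

theorem LRData.Hom.barTensorMap_chainEquiv (n : ℕ) (w : Chain k X.A X.L n) :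
    (F.barTensorMap.f n).hom (chainEquiv X.conn n w) = chainEquiv Y.conn n (F.chain n w) := by
  refine (congrArg (F.tensorApp _) (tensorMap_mk (rightAct X.conn) (F.chainHom (n + 1)) (1 : X.A)
    ((chainMod k X.A X.L (n + 1)).toOf (Chain.tmul 1 w)))).trans ?_
  refine (F.tensorApp_mk _ (1 : X.A) _).trans ?_
  have e : F.chain (n + 1) (Chain.tmul 1 w) = Chain.tmul 1 (F.chain n w) := by
    rw [F.chain_tmul, map_one]
  exact congrArg₂ (fun a y => (Bal.mk a ((chainMod k Y.A Y.L (n + 1)).toOf y) :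
    TensorOver (rightAct Y.conn) (chainMod k Y.A Y.L (n + 1)).toModuleCat)) (map_one F.σ) e

/-- The map induced on Lie-Rinehart homology. -/
def LRData.Hom.torMap (n : ℕ) : lrHomology X.conn n ⟶ lrHomology Y.conn n :=
  ((barRes k X.A X.L).isoLeftDerivedObj (tensorFunctor (rightAct X.conn)) n).hom ≫
    HomologicalComplex.homologyMap F.barTensorMap n ≫
    ((barRes k Y.A Y.L).isoLeftDerivedObj (tensorFunctor (rightAct Y.conn)) n).inv

theorem LRData.Hom.isInduced_torMap (n : ℕ) : F.IsInduced n (F.torMap n) :=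
  ⟨barRes k X.A X.L, barRes k Y.A Y.L, F.barMap, F.barMap_augmentation, rfl⟩

theorem LRData.Hom.torMap_hochschildEquiv (n : ℕ) (z : cycles (hochschildB X.conn) n)
    (z' : cycles (hochschildB Y.conn) n) (h : F.chain n z = z') :
    (F.torMap n).hom (hochschildEquiv X.conn n (Submodule.Quotient.mk z))
      = hochschildEquiv Y.conn n (Submodule.Quotient.mk z') := by
  rw [hochschildEquiv_mk, hochschildEquiv_mk, torMap, ← homologyMap_homologyEquiv (chainEquiv X.conn)
    (barTensor_d X.conn) (chainEquiv Y.conn) (barTensor_d Y.conn) F.barTensorMap n z z'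
    (by rw [F.barTensorMap_chainEquiv, h])]
  have e := ((barRes k X.A X.L).isoLeftDerivedObj (tensorFunctor (rightAct X.conn)) n).inv_hom_id
  refine congrArg (((barRes k Y.A Y.L).isoLeftDerivedObj (tensorFunctor (rightAct Y.conn)) n).inv.hom)
    (congrArg (HomologicalComplex.homologyMap F.barTensorMap n).hom ?_)
  exact LinearMap.congr_fun (congrArg ModuleCat.Hom.hom e) _

theorem LRData.Hom.chain_mem_cycles (n : ℕ) {z : Chain k X.A X.L n}
    (hz : z ∈ cycles (hochschildB X.conn) n) : F.chain n z ∈ cycles (hochschildB Y.conn) n := by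
  cases n with
  | zero => trivial
  | succ n =>
    have hz' : hochschildB X.conn n z = 0 := hz
    change hochschildB Y.conn n (F.chain (n + 1) z) = 0
    rw [← F.chain_hochschildB, hz', map_zero]

theorem LRData.Hom.cycTot_mem_cycles (n : ℕ) {z : CycTot k X.A X.L n}
    (hz : z ∈ cycles (cycD X.conn) n) : F.cycTot n z ∈ cycles (cycD Y.conn) n := by
  cases n with
  | zero => trivial
  | succ n =>
    have hz' : cycD X.conn n z = 0 := hz
    change cycD Y.conn n (F.cycTot (n + 1) z) = 0
    rw [← F.cycTot_cycD, hz', map_zero]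

end HochschildNatural

/-! ### The decomposition of cyclic homology -/

section Decomposition

variable {k : Type*} [CommRing k] {C : ℕ → Type*} [∀ n, AddCommGroup (C n)]
  [∀ n, Module k (C n)] {b b' : ∀ n, C (n + 1) →ₗ[k] C n} {lam nrm : ∀ n, Module.End k (C n)}

theorem IsCyc.of_le {n m : ℕ} {g : (q : ℕ) → C q} (hg : IsCyc b b' lam nrm n g) (hm : m ≤ n)
    (h : Even (n + m)) : IsCyc b b' lam nrm m g := fun q hq => by
  rw [colD_eq_of_even _ _ _ _ (n := m + 1) (m := n + 1) (by grind)]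
  exact hg q (by omega)

variable {D : ∀ n, ((q : Fin (n + 2)) → C q) →ₗ[k] ((q : Fin (n + 1)) → C q)}
  (hD : ∀ n, D n = totD b b' lam nrm n)

include hD in
theorem mem_cycles_tot {n : ℕ} {x : (q : Fin (n + 1)) → C q} :
    x ∈ cycles (X := fun n => (q : Fin (n + 1)) → C q) D n
      ↔ IsCyc b b' lam nrm n (extTot k C n x) := by
  cases n with
  | zero => exact ⟨fun _ q hq => absurd hq (Nat.not_lt_zero q), fun _ => trivial⟩
  | succ n =>
    change D n x = 0 ↔ _
    rw [hD, IsCyc, colD_eq_of_even _ _ _ _ (n := n + 1 + 1) (m := n) (by grind)]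
    exact ⟨fun h q hq => congrFun h ⟨q, hq⟩, fun h => funext fun q => h q q.2⟩

variable {R : ∀ n, ((q : ℕ) → C q) →ₗ[k] C n} (hR : ColRetract b b' lam nrm R)

-- Truncation to `q ≤ m` with `n - m` even is an iterate of the periodicity operator, so it
-- preserves cycles.
include hD hR in
theorem retract_mem_cycles {n m : ℕ} (hm : m ≤ n) (h : Even (n + m))
    {x : (q : Fin (n + 1)) → C q}
    (hx : x ∈ cycles (X := fun n => (q : Fin (n + 1)) → C q) D n) :
    R m (extTot k C n x) ∈ cycles b m :=
  hR.mem_cycles (((mem_cycles_tot hD).1 hx).of_le hm h)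

include hD hR in
theorem retract_totD {n m : ℕ} (hm : m ≤ n) (h : Even (n + m)) (y : (q : Fin (n + 2)) → C q) :
    R m (extTot k C n (D n y)) = b m (R (m + 1) (extTot k C (n + 1) y)) := by
  rw [hR.comm, hD, colD_eq_of_even _ _ _ _ (n := m) (m := n) (by grind)]
  exact hR.congr m _ _ fun q hq =>
    extTot_cutTot (k := k) (hq.trans hm) (colD b b' lam nrm n (extTot k C (n + 1) y))

/-- The component of degree `m` of a class in cyclic homology. -/
def cycComponent {n m : ℕ} (hm : m ≤ n) (h : Even (n + m)) :
    Homology (X := fun n => (q : Fin (n + 1)) → C q) D n →ₗ[k] Homology b m :=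
  Submodule.mapQ _ _ ((R m ∘ₗ extTot k C n).restrict fun _ => retract_mem_cycles hD hR hm h) <| by
    rintro ⟨x, hx⟩ ⟨y, hy⟩
    refine ⟨R (m + 1) (extTot k C (n + 1) y), ?_⟩
    rw [← retract_totD hD hR hm h, hy]
    rfl

theorem even_add_sub_two_mul {n : ℕ} (i : Fin (n / 2 + 1)) : Even (n + (n - 2 * (i : ℕ))) :=
  ⟨n - i, by omega⟩

/-- The components of a class in cyclic homology. -/
def cycComponents (n : ℕ) : Homology (X := fun n => (q : Fin (n + 1)) → C q) D n →ₗ[k]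
    ((i : Fin (n / 2 + 1)) → Homology b (n - 2 * (i : ℕ))) :=
  LinearMap.pi fun i => cycComponent hD hR (Nat.sub_le _ _) (even_add_sub_two_mul i)

variable (H : CyclicRel b b' lam nrm) (h0 : ∀ x : C 0, ∃ w, b' 0 w = x)
  (h1 : ∀ n (x : C (n + 1)), b' n x = 0 → ∃ w, b' (n + 1) w = x)

theorem exists_index {n m : ℕ} (hm : m ≤ n) (h : Even (n + m)) :
    ∃ i : Fin (n / 2 + 1), m = n - 2 * (i : ℕ) := by
  obtain ⟨r, hr⟩ := h
  exact ⟨⟨n - r, by omega⟩, by simp only; omega⟩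

theorem sub_two_mul_injective (n : ℕ) :
    Function.Injective fun i : Fin (n / 2 + 1) => n - 2 * (i : ℕ) := fun i j h => by
  have h' : n - 2 * (i : ℕ) = n - 2 * (j : ℕ) := h
  exact Fin.ext (by omega)

-- If all components of a class vanish, then every shift of a representing cycle retracts to a
-- boundary of `b`, and `isBdry_of_retract` applies.
include H h0 h1 in
theorem cycComponents_injective (n : ℕ) : Function.Injective (cycComponents hD hR n) := by
  rw [← LinearMap.ker_eq_bot, LinearMap.ker_eq_bot']
  intro x hx
  obtain ⟨⟨x, hxc⟩, rfl⟩ := Submodule.Quotient.mk_surjective _ x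
  refine (Submodule.Quotient.mk_eq_zero _).2 ?_
  obtain ⟨y, hy⟩ := isBdry_of_retract H hR h0 h1 n (extTot k C n x) ((mem_cycles_tot hD).1 hxc)
    fun m hm h => by
      obtain ⟨i, rfl⟩ := exists_index hm h
      obtain ⟨u, hu⟩ := (Submodule.Quotient.mk_eq_zero _).1 (congrFun hx i)
      exact ⟨u, hu.symm⟩
  refine ⟨cutTot k C (n + 1) y, ?_⟩
  rw [hD, totD_cutTot]
  refine Eq.trans (funext fun q => ?_) (cutTot_extTot (k := k) x)
  exact hy q (by omega)

-- Cycles that represent the given components are realised together by one cycle of the double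
-- complex, by `exists_retract_eq`.
include H h0 h1 in
theorem cycComponents_surjective (n : ℕ) : Function.Surjective (cycComponents hD hR n) := by
  intro y
  choose z hz using fun i => Submodule.Quotient.mk_surjective _ (y i)
  obtain ⟨c, hc⟩ : ∃ c : (q : ℕ) → C q, ∀ i : Fin (n / 2 + 1), c (n - 2 * (i : ℕ)) = z i := by
    classical
    -- The degrees `n - 2 i` are pairwise different, since `2 i ≤ n`; so the representatives fit
    -- into a single sequence. The cast is along an equality of degrees, and other degrees get zero.
    refine ⟨fun q => if h : ∃ i : Fin (n / 2 + 1), n - 2 * (i : ℕ) = q then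
      h.choose_spec ▸ (z h.choose : C (n - 2 * (h.choose : ℕ))) else 0, fun i => ?_⟩
    have h : ∃ j : Fin (n / 2 + 1), n - 2 * (j : ℕ) = n - 2 * (i : ℕ) := ⟨i, rfl⟩
    refine (dif_pos h).trans ?_
    have key : ∀ (j : Fin (n / 2 + 1)) (hj : n - 2 * (j : ℕ) = n - 2 * (i : ℕ)),
        hj ▸ (z j : C (n - 2 * (j : ℕ))) = (z i : C (n - 2 * (i : ℕ))) := fun j hj => by
      obtain rfl := sub_two_mul_injective n hj
      rfl
    exact key _ _
  obtain ⟨g, hg, hu⟩ := exists_retract_eq H hR h0 h1 n c fun m hm h => by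
    obtain ⟨i, rfl⟩ := exists_index hm h
    rw [hc]
    exact (z i).2
  have hgc : IsCyc b b' lam nrm n (extTot k C n (cutTot k C n g)) := fun q hq => by
    rw [← hg q hq]
    exact colD_congr _ _ _ _ (extTot_cutTot (by omega) g) (extTot_cutTot (by omega) g)
  refine ⟨Submodule.Quotient.mk ⟨cutTot k C n g, (mem_cycles_tot hD).2 hgc⟩, funext fun i => ?_⟩
  refine Eq.trans ?_ (hz i)
  obtain ⟨u, hu⟩ := hu (n - 2 * (i : ℕ)) (Nat.sub_le _ _) (even_add_sub_two_mul i)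
  refine (Submodule.Quotient.eq _).2 ⟨u, ?_⟩
  have e : R (n - 2 * (i : ℕ)) (extTot k C n (cutTot k C n g)) = R (n - 2 * (i : ℕ)) g :=
    hR.congr _ _ _ fun q hq => extTot_cutTot (hq.trans (Nat.sub_le _ _)) g
  change _ = R (n - 2 * (i : ℕ)) (extTot k C n (cutTot k C n g)) - (z i : C (n - 2 * (i : ℕ)))
  rw [e, hu, hc, add_sub_cancel_left]

/-- Cyclic homology is the sum of the homologies of the first column. -/
def cycDecomposition (n : ℕ) : Homology (X := fun n => (q : Fin (n + 1)) → C q) D n ≃ₗ[k]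
    ((i : Fin (n / 2 + 1)) → Homology b (n - 2 * (i : ℕ))) :=
  LinearEquiv.ofBijective (cycComponents hD hR n)
    ⟨cycComponents_injective hD hR H h0 h1 n, cycComponents_surjective hD hR H h0 h1 n⟩

end Decomposition

/-! ### Cyclic homology as a sum of Lie-Rinehart homologies. -/

section CyclicTor

variable {k A L : Type u} [CommRing k] [CommRing A] [LieRing L] [Module A L]
  [LieRingModule L A] [LieRinehartRing A L] [Algebra k A] [LieAlgebra k L]
  [LieRinehartAlgebra k A L] [Algebra ℚ k] [Module.Projective A L]
  (c : FlatRightConnection k A L)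

/-- Dual Hopf-cyclic homology as a sum of Lie-Rinehart homologies. -/
def cyclicEquiv (n : ℕ) :
    HC c n ≃ₗ[k] ⨁ i : Fin (n / 2 + 1), lrHomology c (n - 2 * (i : ℕ)) :=
  ((cycDecomposition (cycD_eq c) (colRetract_chain c) (cyclicRel_chain c) (hochschildB'_surjective c)
    (hochschildB'_exact c) n).trans
    (LinearEquiv.piCongrRight fun i => hochschildEquiv c (n - 2 * (i : ℕ)))).trans
    (DirectSum.linearEquivFunOnFintype k (Fin (n / 2 + 1))
      fun i => lrHomology c (n - 2 * (i : ℕ))).symm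

/-- The truncation of the total complex. -/
def truncTot (n m : ℕ) : CycTot k A L n →ₗ[k] CycTot k A L m :=
  cutTot k (Chain k A L) m ∘ₗ extTot k (Chain k A L) n

theorem truncTot_mem_cycles {n m : ℕ} (hm : m ≤ n) (h : Even (n + m)) {z : CycTot k A L n}
    (hz : z ∈ cycles (cycD c) n) : truncTot n m z ∈ cycles (cycD c) m := by
  refine (mem_cycles_tot (cycD_eq c)).2 fun q hq => ?_
  rw [← (((mem_cycles_tot (cycD_eq c)).1 hz).of_le hm h) q hq]
  exact colD_congr _ _ _ _ (extTot_cutTot (k := k) (by omega) (extTot k (Chain k A L) n z))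
    (extTot_cutTot (k := k) (by omega) (extTot k (Chain k A L) n z))

theorem cycRetract_truncTot_mem_cycles {n m : ℕ} (hm : m ≤ n) (h : Even (n + m))
    {z : CycTot k A L n} (hz : z ∈ cycles (cycD c) n) :
    cycRetract c m (truncTot n m z) ∈ cycles (hochschildB c) m :=
  retract_mem_cycles (cycD_eq c) (colRetract_chain c) hm h hz

theorem cyclicEquiv_mk (n : ℕ) (z : cycles (cycD c) n) (i : Fin (n / 2 + 1)) :
    cyclicEquiv c n (Submodule.Quotient.mk z) i = hochschildEquiv c (n - 2 * (i : ℕ))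
      (Submodule.Quotient.mk ⟨cycRetract c (n - 2 * (i : ℕ)) (truncTot n (n - 2 * (i : ℕ)) z),
        cycRetract_truncTot_mem_cycles c (Nat.sub_le _ _) (even_add_sub_two_mul i) z.2⟩) := by
  exact (DirectSum.linearEquivFunOnFintype_apply k (Fin (n / 2 + 1)) _ _ i).symm.trans
    (congrFun (LinearEquiv.apply_symm_apply _ _) i)

end CyclicTor

/-! ### Naturality of the decomposition of cyclic homology. -/

section CyclicNatural

variable {k : Type u} [CommRing k] [Algebra ℚ k] {X Y : LRData k} (F : X.Hom Y)

theorem LRData.Hom.cycTot_truncTot (n m : ℕ) (z : CycTot k X.A X.L n) :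
    F.cycTot m (truncTot n m z) = truncTot n m (F.cycTot n z) := by
  funext q
  change F.chain q (extTot k (Chain k X.A X.L) n z q) = extTot k (Chain k Y.A Y.L) n (F.cycTot n z) q
  by_cases hq : (q : ℕ) < n + 1
  · rw [extTot, extTot, LinearMap.pi_apply, LinearMap.pi_apply, dif_pos hq, dif_pos hq]
    rfl
  · rw [extTot, extTot, LinearMap.pi_apply, LinearMap.pi_apply, dif_neg hq, dif_neg hq]
    exact map_zero _

theorem LRData.Hom.torMap_cyclicEquiv (n : ℕ) (z : cycles (cycD X.conn) n) (i : Fin (n / 2 + 1)) :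
    (F.torMap (n - 2 * (i : ℕ))).hom (cyclicEquiv X.conn n (Submodule.Quotient.mk z) i)
      = cyclicEquiv Y.conn n
        (Submodule.Quotient.mk ⟨F.cycTot n z, F.cycTot_mem_cycles n z.2⟩) i := by
  rw [cyclicEquiv_mk, cyclicEquiv_mk]
  have hz := truncTot_mem_cycles X.conn (Nat.sub_le n (2 * (i : ℕ))) (even_add_sub_two_mul i) z.2
  refine (F.torMap_hochschildEquiv _ _ ⟨_, F.chain_mem_cycles _ (cycRetract_truncTot_mem_cycles
    X.conn (Nat.sub_le _ _) (even_add_sub_two_mul i) z.2)⟩ rfl).trans ?_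
  refine congrArg _ ((Submodule.Quotient.eq _).2 ?_)
  -- The retractions commute with `F` only up to a boundary of `b` on cycles, which suffices in
  -- homology.
  obtain ⟨u, hu⟩ := F.exists_chain_cycRetract _ _ hz
  rw [F.cycTot_truncTot] at hu
  exact ⟨u, (sub_eq_iff_eq_add'.2 hu).symm⟩

end CyclicNatural

end LRHopf

end

/-! ### The theorem, assembled. -/

theorem mainTheorem8 (k : Type u) [CommRing k] [Algebra ℚ k] :
    (∀ (X : LRHopf.LRData k) (n : ℕ),
      LRHopf.hochschildB X.conn n ∘ₗ LRHopf.hochschildB X.conn (n + 1) = 0 ∧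
      LRHopf.cycD X.conn n ∘ₗ LRHopf.cycD X.conn (n + 1) = 0) ∧
    ∃ (Φ : ∀ (X : LRHopf.LRData k) (n : ℕ),
        LRHopf.HH X.conn n ≃ₗ[k] LRHopf.lrHomology X.conn n)
      (Ψ : ∀ (X : LRHopf.LRData k) (n : ℕ),
        LRHopf.HC X.conn n ≃ₗ[k]
          ⨁ i : Fin (n / 2 + 1), LRHopf.lrHomology X.conn (n - 2 * (i : ℕ))),
      ∀ (X Y : LRHopf.LRData k) (F : X.Hom Y),
        ∃ θ : ∀ m : ℕ, LRHopf.lrHomology X.conn m ⟶ LRHopf.lrHomology Y.conn m,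
          (∀ m, F.IsInduced m (θ m)) ∧
          (∀ (n : ℕ) (z : LRHopf.cycles (LRHopf.hochschildB X.conn) n),
            ∃ h : F.chain n z ∈ LRHopf.cycles (LRHopf.hochschildB Y.conn) n,
              Φ Y n (Submodule.Quotient.mk ⟨F.chain n z, h⟩)
                = (θ n).hom (Φ X n (Submodule.Quotient.mk z))) ∧
          (∀ (n : ℕ) (z : LRHopf.cycles (LRHopf.cycD X.conn) n),
            ∃ h : F.cycTot n z ∈ LRHopf.cycles (LRHopf.cycD Y.conn) n,
              ∀ i : Fin (n / 2 + 1),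
                Ψ Y n (Submodule.Quotient.mk ⟨F.cycTot n z, h⟩) i
                  = (θ (n - 2 * (i : ℕ))).hom (Ψ X n (Submodule.Quotient.mk z) i)) := by
  refine ⟨fun X n => ⟨LinearMap.ext (LRHopf.cyclicRel_chain X.conn |>.b_b n), ?_⟩,
    fun X n => LRHopf.hochschildEquiv X.conn n, fun X n => LRHopf.cyclicEquiv X.conn n,
    fun X Y F => ⟨F.torMap, F.isInduced_torMap, fun n z => ⟨F.chain_mem_cycles n z.2, ?_⟩,
      fun n z => ⟨F.cycTot_mem_cycles n z.2, fun i => (F.torMap_cyclicEquiv n z i).symm⟩⟩⟩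
  · rw [LRHopf.cycD_eq, LRHopf.cycD_eq]
    exact LinearMap.ext ((LRHopf.cyclicRel_chain X.conn).totD_totD n)
  · exact (F.torMap_hochschildEquiv n z _ rfl).symm
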